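/- **Proposition 2.1.** Conventions. Capital and lower case Latin indices run from $1$ to $n$; repeated indices are summed, also when both are downstairs or both upstairs; $k_{(IJ)}=\tfrac12(k_{IJ}+k_{JI})$, $k_{[IJ]}=\tfrac12(k_{IJ}-k_{JI})$, and similarly for the other indexed quantities. For a spacelike hypersurface with future pointing unit normal $\nu$, the second fundamental form is $k(X,Y)=g(\nabla_X\nu,Y)$ and the mean curvature is its trace with respect to the induced metric. A Cauchy hypersurface is one that is met exactly once by every inextendible causal curve. Let $n\ge 2$, let $(\Sigma,h_{\mathrm{ref}})$ be a closed Riemannian $n$-manifold with a smooth global orthonormal frame $(E_i)_{i=1}^n$ and dual frame $(\eta^i)_{i=1}^n$, and let $V\in C^\infty(\mathbb R)$. Let $(a,b)\subseteq(0,\infty)$ be an open interval, let $t_0\in(a,b)$, and put $M=(a,b)\times\Sigma$. The $E_i$ and $\eta^i$ are extended to $M$ so that $[\partial_t,E_i]=0$, the $E_i$ are tangent to the slices $\Sigma_t=\{t\}\times\Sigma$, and $\eta^i(\partial_t)=0$. *Initial values.* Let $\bar e_I^i,\bar\omega^I_i,\bar k_{IJ},\bar\gamma_{IJK},\bar\phi_0,\bar\phi_1\in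 C^\infty(\Sigma)$ be such that, with $\bar e_I=\bar e_I^iE_i$ and $\bar\omega^I=\bar\omega^I_i\eta^i$: $(\bar e_I)$ is a smooth frame of $T\Sigma$; $(\bar\omega^I)$ is its dual frame; $\bar k_{IJ}=\bar k_{JI}$ and $\bar k_{II}=1/t_0$; and $\bar\gamma_{IJK}=\bar\omega^K([\bar e_I,\bar e_J])$. *The FRS equations.* Let $e_I^i,\omega^I_i,k_{IJ},\gamma_{IJK},\phi,N\in C^\infty(M)$ with $N>0$ and put $e_0=N^{-1}\partial_t$, $e_I=e_I^iE_i$, $\omega^I=\omega^I_i\eta^i$. Assume that, on $M$, $$e_0(e_I^i)=-k_{IJ}e_J^i,\qquad e_0(\omega^I_i)=k_{IJ}\omega^J_i,$$ $$e_0\gamma_{IJK}=-2N^{-1}e_{[I}(Nk_{J]K})-k_{IL}\gamma_{LJK}-k_{JL}\gamma_{ILK}+k_{KL}\gamma_{IJL},$$ $$\begin{aligned}e_0k_{IJ}={}&N^{-1}e_{(I}e_{J)}(N)-N^{-1}e_K(N\gamma_{K(IJ)})-e_{(I}(\gamma_{J)KK})-t^{-1}k_{IJ}+\gamma_{KLL}\gamma_{K(IJ)}\\&+\gamma_{I(KL)}\gamma_{J(KL)}-\tfrac14\gamma_{KLI}\gamma_{KLJ}+e_I(\phi)e_J(\phi)+\tfrac2{n-1}(V\circ\phi)\delta_{IJ},\end{aligned}$$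 $$e_0(e_I\phi)=N^{-1}e_I(Ne_0\phi)-k_{IJ}e_J(\phi),$$ $$e_0(e_0\phi)=e_I(e_I\phi)-t^{-1}e_0\phi+N^{-1}e_I(N)e_I(\phi)-\gamma_{JII}e_J(\phi)-V'\circ\phi,$$ $$2e_I(\gamma_{IJJ})-\tfrac14\gamma_{IJK}(\gamma_{IJK}+2\gamma_{IKJ})-\gamma_{IJJ}\gamma_{IKK}-k_{IJ}k_{IJ}+t^{-2}=(e_0\phi)^2+e_I(\phi)e_I(\phi)+2V\circ\phi,$$ $$e_Ik_{IJ}=\gamma_{LII}k_{LJ}+\gamma_{IJL}k_{IL}+e_0(\phi)e_J(\phi),$$ $$\begin{aligned}e_Ie_I(N)={}&t^{-2}(N-1)+\gamma_{JII}e_J(N)-\bigl(e_I(\phi)e_I(\phi)+\tfrac{2n}{n-1}V\circ\phi\bigr)N\\&+\bigl(2e_I(\gamma_{IJJ})-\tfrac14\gamma_{IJK}(\gamma_{IJK}+2\gamma_{IKJ})-\gamma_{IJJ}\gamma_{IKK}\bigr)N,\end{aligned}$$ and that $(e_I^i,\omega^I_i,k_{IJ},\gamma_{IJK},\phi,e_0\phi)|_{t=t_0}=(\bar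 e_I^i,\bar\omega^I_i,\bar k_{IJ},\bar\gamma_{IJK},\bar\phi_0,\bar\phi_1)$. *Conclusion.* Let $g=-N^2\,dt\otimes dt+\omega^I\otimes\omega^I$. Then $g$ is a smooth Lorentz metric on $M$, and with its Levi-Civita connection $\nabla$ $$\mathrm{Ric}_g=d\phi\otimes d\phi+\tfrac2{n-1}(V\circ\phi)\,g,\qquad \Box_g\phi=V'\circ\phi.$$ For each $t\in(a,b)$ the slice $\Sigma_t$ is a spacelike Cauchy hypersurface with constant mean curvature $1/t$. Moreover, for all $I,J,K$: - $(e_I)$ is a smooth frame on $\Sigma_t$ for each $t$, and $(\omega^I)$ is its dual frame; - $e_0$ is the future pointing unit normal of the slices, and $k=k_{IJ}\,\omega^I\otimes\omega^J$ is their second fundamental form; - $(e_I)$ is Fermi–Walker propagated: $\nabla_{e_0}e_I=e_I(\ln N)\,e_0$; - $\gamma_{IJK}=\omega^K([e_I,e_J])$. Finally, the data that $(M,g,\phi)$ induces on $\Sigma_{t_0}$ are $(\Sigma,\bar h,\bar k,\bar\phi_0,\bar\phi_1)$ with $\bar h=\bar\omega^I\otimes\bar\omega^I$ and $\bar k=\bar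 k_{IJ}\bar\omega^I\otimes\bar\omega^J$: the first and second fundamental forms of $\Sigma_{t_0}$ are $\bar h$ and $\bar k$, $\phi|_{\Sigma_{t_0}}=\bar\phi_0$ and $(e_0\phi)|_{\Sigma_{t_0}}=\bar\phi_1$. -/

import Mathlib

open scoped Manifold ContDiff
open Bundle TopologicalSpace

noncomputable section

/-! ### Lorentz geometry on a manifold -/

section Geometry

variable {E : Type*} [NormedAddCommGroup E] [NormedSpace ℝ E] [FiniteDimensional ℝ E]
  {H : Type*} [TopologicalSpace H] (I : ModelWithCorners ℝ E H)
  {M : Type*} [TopologicalSpace M] [ChartedSpace H M]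

/-- `X` is a smooth vector field on `M`. -/
def IsSmoothField [IsManifold I ∞ M] (X : Π x : M, TangentSpace I x) : Prop :=
  ContMDiff I I.tangent ∞ (fun x => (⟨x, X x⟩ : TangentBundle I M))

/-- The derivative `X f` of a function `f` along a vector field `X`. -/
def fieldDeriv (X : Π x : M, TangentSpace I x) (f : M → ℝ) (x : M) : ℝ :=
  mvfderiv I f x (X x)

/-- `θ` is the dual frame (coframe) of the frame `F`: `θ^a(F_b) = δ^a_b`. -/
def IsDualCoframe {ι : Type*} [DecidableEq ι] (θ : ι → Π x : M, TangentSpace I x →L[ℝ] ℝ)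
    (F : ι → Π x : M, TangentSpace I x) : Prop :=
  ∀ x a b, θ a x (F b x) = if a = b then 1 else 0

/-- `g` is a (smooth) Lorentz metric of signature `(-, +, …, +)`: it is symmetric, `g(X, Y)` is
smooth for all smooth vector fields `X`, `Y`, and every tangent space contains a timelike vector
whose `g`-orthogonal complement is positive definite. -/
structure IsLorentzMetric [IsManifold I ∞ M]
    (g : Π x : M, TangentSpace I x →L[ℝ] TangentSpace I x →L[ℝ] ℝ) : Prop where
  symm : ∀ x v w, g x v w = g x w v
  smooth : ∀ X Y : Π x : M, TangentSpace I x, IsSmoothField I X → IsSmoothField I Y →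
    ContMDiff I 𝓘(ℝ, ℝ) ∞ (fun x => g x (X x) (Y x))
  signature : ∀ x, ∃ v, g x v v < 0 ∧ ∀ w, g x v w = 0 → w ≠ 0 → 0 < g x w w

/-- `D` is the Levi-Civita connection of the metric `g`: it is torsion free, and
`X g(Y, Z) = g(∇_X Y, Z) + g(Y, ∇_X Z)`. In Mathlib's convention `∇_X Y` at `x` is `D Y x (X x)`. -/
structure IsLeviCivita [IsManifold I ∞ M]
    (g : Π x : M, TangentSpace I x →L[ℝ] TangentSpace I x →L[ℝ] ℝ)
    (D : CovariantDerivative I E (TangentSpace I : M → Type _)) : Prop where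
  torsion_free : D.torsion = 0
  metric : ∀ (Y Z : Π x : M, TangentSpace I x) (x : M) (u : TangentSpace I x),
    MDifferentiableAt I I.tangent (fun y => (⟨y, Y y⟩ : TangentBundle I M)) x →
    MDifferentiableAt I I.tangent (fun y => (⟨y, Z y⟩ : TangentBundle I M)) x →
    mvfderiv I (fun y => g y (Y y) (Z y)) x u = g x (D Y x u) (Z x) + g x (Y x) (D Z x u)

/-- The covariant derivative `∇_X Y` of vector fields. -/
def covD [IsManifold I ∞ M] (D : CovariantDerivative I E (TangentSpace I : M → Type _))
    (X Y : Π x : M, TangentSpace I x) (x : M) : TangentSpace I x :=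
  D Y x (X x)

/-- The curvature `R(X, Y) Z = ∇_X ∇_Y Z - ∇_Y ∇_X Z - ∇_[X, Y] Z`. -/
def curvature [IsManifold I ∞ M] (D : CovariantDerivative I E (TangentSpace I : M → Type _))
    (X Y Z : Π x : M, TangentSpace I x) (x : M) : TangentSpace I x :=
  covD I D X (covD I D Y Z) x - covD I D Y (covD I D X Z) x
    - covD I D (VectorField.mlieBracket I X Y) Z x

/-- A basis of the tangent space (the tangent space is a copy of the model space `E`). -/
def tangentBasis (x : M) : Module.Basis (Fin (Module.finrank ℝ E)) ℝ (TangentSpace I x) :=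
  (Module.finBasis ℝ E : Module.Basis (Fin (Module.finrank ℝ E)) ℝ E)

/-- The Ricci curvature `Ric(Y, Z)`, the trace of `u ↦ R(u, Y) Z`. Each vector of a basis of the
tangent space at `x` is extended to a vector field that is smooth near `x`; by tensoriality of the
curvature neither the extension nor the basis matters. -/
def ricci [IsManifold I ∞ M] (D : CovariantDerivative I E (TangentSpace I : M → Type _))
    (Y Z : Π x : M, TangentSpace I x) (x : M) : ℝ :=
  ∑ a, (tangentBasis I x).coord a
    (curvature I D (FiberBundle.extend E (tangentBasis I x a)) Y Z x)

/-- The gradient of `f`: the vector field with `g(grad f, ·) = df` (for nondegenerate `g`). -/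
def metricGrad (g : Π x : M, TangentSpace I x →L[ℝ] TangentSpace I x →L[ℝ] ℝ) (f : M → ℝ) (x : M) :
    TangentSpace I x :=
  Function.invFun (fun v => g x v) (mvfderiv I f x)

/-- The wave operator `□_g f = tr (u ↦ ∇_u grad f) = div (grad f)`. -/
def waveOp [IsManifold I ∞ M]
    (g : Π x : M, TangentSpace I x →L[ℝ] TangentSpace I x →L[ℝ] ℝ)
    (D : CovariantDerivative I E (TangentSpace I : M → Type _)) (f : M → ℝ) (x : M) : ℝ :=
  LinearMap.trace ℝ (TangentSpace I x) (D (metricGrad I g f) x).toLinearMap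

/-- A future directed causal curve, where the timelike vector field `T` gives the time orientation.
All open intervals being diffeomorphic, the parameter runs through `ℝ`. The curve is continuous
and, off a set with finitely many points in each bounded interval (where it may break),
differentiable with a future directed causal velocity. -/
structure IsFutureCausalCurve (g : Π x : M, TangentSpace I x →L[ℝ] TangentSpace I x →L[ℝ] ℝ)
    (T : Π x : M, TangentSpace I x) (c : ℝ → M) : Prop where
  continuous : Continuous c
  causal : ∃ B : Set ℝ, (∀ r s : ℝ, (B ∩ Set.Icc r s).Finite) ∧ ∀ s, s ∉ B →
    MDifferentiableAt 𝓘(ℝ, ℝ) I c s ∧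
    g (c s) (mfderiv 𝓘(ℝ, ℝ) I c s (1 : ℝ)) (mfderiv 𝓘(ℝ, ℝ) I c s (1 : ℝ)) ≤ 0 ∧
    g (c s) (mfderiv 𝓘(ℝ, ℝ) I c s (1 : ℝ)) (T (c s)) < 0

/-- A curve is inextendible if it has no limit in `M` at either end. -/
def IsInextendible (c : ℝ → M) : Prop :=
  (∀ q, ¬ Filter.Tendsto c Filter.atTop (nhds q)) ∧ ∀ q, ¬ Filter.Tendsto c Filter.atBot (nhds q)

/-- A Cauchy hypersurface is met exactly once by each inextendible causal curve. -/
def IsCauchy (g : Π x : M, TangentSpace I x →L[ℝ] TangentSpace I x →L[ℝ] ℝ)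
    (T : Π x : M, TangentSpace I x) (A : Set M) : Prop :=
  ∀ c : ℝ → M, IsFutureCausalCurve I g T c → IsInextendible c → ∃! s, c s ∈ A

/-- The trace `tr_h k = h^{ij} k_{ij}` of a bilinear form `k` with respect to a metric `h` on the
tangent space at `x`. -/
def metricTrace {x : M} (h k : TangentSpace I x → TangentSpace I x → ℝ) : ℝ :=
  Matrix.trace
    ((Matrix.of fun a b => h (tangentBasis I x a) (tangentBasis I x b))⁻¹ *
      Matrix.of fun a b => k (tangentBasis I x a) (tangentBasis I x b))

end Geometry

/-! ### The spacetime manifold `𝒥 × S`, with `𝒥` an open interval -/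

section Spacetime

/-- The model with corners of `𝒥 × S`, for an open set `𝒥` of reals and an `n`-manifold `S`. -/
abbrev stModel (n : ℕ) :
    ModelWithCorners ℝ (ℝ × EuclideanSpace ℝ (Fin n)) (ModelProd ℝ (EuclideanSpace ℝ (Fin n))) :=
  𝓘(ℝ, ℝ).prod (𝓡 n)

variable {n : ℕ} {S : Type*} [TopologicalSpace S] [ChartedSpace (EuclideanSpace ℝ (Fin n)) S]
  {𝒥 : Opens ℝ}

/-- The inclusion of `T_p S` in `T_(t,p) (𝒥 × S)`, i.e. the differential of `q ↦ (t, q)` at `p`. -/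
def sliceIncl (x : 𝒥 × S) : TangentSpace (𝓡 n) x.2 →L[ℝ] TangentSpace (stModel n) x :=
  ContinuousLinearMap.inr ℝ (TangentSpace 𝓘(ℝ, ℝ) x.1) (TangentSpace (𝓡 n) x.2)

/-- The differential of the projection `𝒥 × S → S`. -/
def spaceProj (x : 𝒥 × S) : TangentSpace (stModel n) x →L[ℝ] TangentSpace (𝓡 n) x.2 :=
  ContinuousLinearMap.snd ℝ (TangentSpace 𝓘(ℝ, ℝ) x.1) (TangentSpace (𝓡 n) x.2)

/-- The one-form `dt` on `𝒥 × S`. -/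
def dt (x : 𝒥 × S) : TangentSpace (stModel n) x →L[ℝ] ℝ :=
  ContinuousLinearMap.fst ℝ ℝ (TangentSpace (𝓡 n) x.2)

/-- The vector field `∂_t` on `𝒥 × S`. -/
def partialT (x : 𝒥 × S) : TangentSpace (stModel n) x :=
  ContinuousLinearMap.inl ℝ ℝ (TangentSpace (𝓡 n) x.2) 1

/-- The slice `S_t = {t} × S`. -/
def slice (S : Type*) (t : 𝒥) : Set (𝒥 × S) := {x | x.1 = t}

end Spacetime

/-! ### The FRS equations -/

section FRS

/-- Initial values `ē_I^i, ω̄^I_i, k̄_IJ, γ̄_IJK, φ̄₀, φ̄₁ : S → ℝ`. The indices are written in the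
order `e I i`, `om I i`, `k I J`, `γ I J K`. -/
structure FRSInit (n : ℕ) (S : Type*) where
  e : Fin n → Fin n → S → ℝ
  om : Fin n → Fin n → S → ℝ
  k : Fin n → Fin n → S → ℝ
  γ : Fin n → Fin n → Fin n → S → ℝ
  φ₀ : S → ℝ
  φ₁ : S → ℝ

/-- The unknowns `e_I^i, ω^I_i, k_IJ, γ_IJK, φ, N : 𝒥 × S → ℝ`. -/
structure FRSVars (n : ℕ) (𝒥 : Opens ℝ) (S : Type*) where
  e : Fin n → Fin n → 𝒥 × S → ℝ
  om : Fin n → Fin n → 𝒥 × S → ℝ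
  k : Fin n → Fin n → 𝒥 × S → ℝ
  γ : Fin n → Fin n → Fin n → 𝒥 × S → ℝ
  φ : 𝒥 × S → ℝ
  N : 𝒥 × S → ℝ

variable {n : ℕ} {S : Type*} [TopologicalSpace S] [ChartedSpace (EuclideanSpace ℝ (Fin n)) S]
  {𝒥 : Opens ℝ}

namespace FRSInit

variable (d : FRSInit n S) (E : Fin n → Π p : S, TangentSpace (𝓡 n) p)
  (η : Fin n → Π p : S, TangentSpace (𝓡 n) p →L[ℝ] ℝ)

/-- All the functions are smooth. -/
structure Smooth : Prop where
  e : ∀ I i, ContMDiff (𝓡 n) 𝓘(ℝ, ℝ) ∞ (d.e I i)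
  om : ∀ I i, ContMDiff (𝓡 n) 𝓘(ℝ, ℝ) ∞ (d.om I i)
  k : ∀ I J, ContMDiff (𝓡 n) 𝓘(ℝ, ℝ) ∞ (d.k I J)
  γ : ∀ I J K, ContMDiff (𝓡 n) 𝓘(ℝ, ℝ) ∞ (d.γ I J K)
  φ₀ : ContMDiff (𝓡 n) 𝓘(ℝ, ℝ) ∞ d.φ₀
  φ₁ : ContMDiff (𝓡 n) 𝓘(ℝ, ℝ) ∞ d.φ₁

/-- The vector fields `ē_I = ē_I^i E_i`. -/
def frame (I : Fin n) (p : S) : TangentSpace (𝓡 n) p := ∑ i, d.e I i p • E i p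

/-- The one-forms `ω̄^I = ω̄^I_i η^i`. -/
def coframe (I : Fin n) (p : S) : TangentSpace (𝓡 n) p →L[ℝ] ℝ := ∑ i, d.om I i p • η i p

/-- The conditions imposed on the initial values at time `t₀`. -/
structure Admissible [IsManifold (𝓡 n) ∞ S] (t₀ : ℝ) : Prop where
  frame : IsLocalFrameOn (𝓡 n) (EuclideanSpace ℝ (Fin n)) ∞ (d.frame E) Set.univ
  coframe : IsDualCoframe (𝓡 n) (d.coframe η) (d.frame E)
  k_symm : ∀ I J p, d.k I J p = d.k J I p
  k_trace : ∀ p, ∑ I, d.k I I p = 1 / t₀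
  γ_eq : ∀ I J K p,
    d.γ I J K p = d.coframe η K p (VectorField.mlieBracket (𝓡 n) (d.frame E I) (d.frame E J) p)

end FRSInit

namespace FRSVars

variable (v : FRSVars n 𝒥 S) (E : Fin n → Π p : S, TangentSpace (𝓡 n) p)
  (η : Fin n → Π p : S, TangentSpace (𝓡 n) p →L[ℝ] ℝ)

/-- All the functions are smooth. -/
structure Smooth : Prop where
  e : ∀ I i, ContMDiff (stModel n) 𝓘(ℝ, ℝ) ∞ (v.e I i)
  om : ∀ I i, ContMDiff (stModel n) 𝓘(ℝ, ℝ) ∞ (v.om I i)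
  k : ∀ I J, ContMDiff (stModel n) 𝓘(ℝ, ℝ) ∞ (v.k I J)
  γ : ∀ I J K, ContMDiff (stModel n) 𝓘(ℝ, ℝ) ∞ (v.γ I J K)
  φ : ContMDiff (stModel n) 𝓘(ℝ, ℝ) ∞ v.φ
  N : ContMDiff (stModel n) 𝓘(ℝ, ℝ) ∞ v.N

/-- `e_I` on the slice `{t} × S`, as the vector field `p ↦ e_I^i(t, p) E_i(p)` on `S`. -/
def sliceFrame (t : 𝒥) (I : Fin n) (p : S) : TangentSpace (𝓡 n) p := ∑ i, v.e I i (t, p) • E i p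

/-- `ω^I` on the slice `{t} × S`, as the one-form `p ↦ ω^I_i(t, p) η^i(p)` on `S`. -/
def sliceCoframe (t : 𝒥) (I : Fin n) (p : S) : TangentSpace (𝓡 n) p →L[ℝ] ℝ :=
  ∑ i, v.om I i (t, p) • η i p

/-- The vector field `e_0 = N⁻¹ ∂_t` on `𝒥 × S`. -/
def e0 (x : 𝒥 × S) : TangentSpace (stModel n) x := (v.N x)⁻¹ • partialT x

/-- The vector field `e_I = e_I^i E_i` on `𝒥 × S`. -/
def frame (I : Fin n) (x : 𝒥 × S) : TangentSpace (stModel n) x := 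
  sliceIncl x (v.sliceFrame E x.1 I x.2)

/-- The one-form `ω^I = ω^I_i η^i` on `𝒥 × S`. -/
def coframe (I : Fin n) (x : 𝒥 × S) : TangentSpace (stModel n) x →L[ℝ] ℝ :=
  (v.sliceCoframe η x.1 I x.2).comp (spaceProj x)

/-- The spacetime metric `g = -N² dt ⊗ dt + ω^I ⊗ ω^I`. -/
def metric (x : 𝒥 × S) :
    TangentSpace (stModel n) x →L[ℝ] TangentSpace (stModel n) x →L[ℝ] ℝ :=
  (dt x).smulRight ((-(v.N x) ^ 2) • dt x)
    + ∑ I, (v.coframe η I x).smulRight (v.coframe η I x)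

/-- The derivative `e_0 f`. -/
def d0 (f : 𝒥 × S → ℝ) : 𝒥 × S → ℝ := fieldDeriv (stModel n) v.e0 f

/-- The derivative `e_I f`. -/
def dI (I : Fin n) (f : 𝒥 × S → ℝ) : 𝒥 × S → ℝ := fieldDeriv (stModel n) (v.frame E I) f

/-- `γ_{I(JK)} = (γ_IJK + γ_IKJ) / 2`. -/
def γs (I J K : Fin n) (x : 𝒥 × S) : ℝ := (v.γ I J K x + v.γ I K J x) / 2

/-- `2 e_I(γ_IJJ) - (1/4) γ_IJK (γ_IJK + 2 γ_IKJ) - γ_IJJ γ_IKK`, which occurs both in the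
Hamiltonian constraint and in the lapse equation. -/
def scalExpr (x : 𝒥 × S) : ℝ :=
  2 * (∑ I, ∑ J, v.dI E I (v.γ I J J) x)
    - 1 / 4 * (∑ I, ∑ J, ∑ K, v.γ I J K x * (v.γ I J K x + 2 * v.γ I K J x))
    - ∑ I, ∑ J, ∑ K, v.γ I J J x * v.γ I K K x

/-- The FRS equations with potential `V` on `𝒥 × S`. -/
structure Solves (V : ℝ → ℝ) : Prop where
  /-- Evolution of the frame. -/
  frame_eq : ∀ I i x, v.d0 (v.e I i) x = -∑ J, v.k I J x * v.e J i x
  /-- Evolution of the dual frame. -/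
  coframe_eq : ∀ I i x, v.d0 (v.om I i) x = ∑ J, v.k I J x * v.om J i x
  /-- Evolution of `γ`. -/
  γ_eq : ∀ I J K x, v.d0 (v.γ I J K) x =
    -((v.N x)⁻¹ * (v.dI E I (fun y => v.N y * v.k J K y) x
        - v.dI E J (fun y => v.N y * v.k I K y) x))
      - (∑ L, v.k I L x * v.γ L J K x) - (∑ L, v.k J L x * v.γ I L K x)
      + ∑ L, v.k K L x * v.γ I J L x
  /-- Evolution of `k`. -/
  k_eq : ∀ I J x, v.d0 (v.k I J) x =
    (v.N x)⁻¹ * ((v.dI E I (v.dI E J v.N) x + v.dI E J (v.dI E I v.N) x) / 2)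
      - (v.N x)⁻¹ * (∑ K, v.dI E K (fun y => v.N y * v.γs K I J y) x)
      - (∑ K, (v.dI E I (v.γ J K K) x + v.dI E J (v.γ I K K) x) / 2)
      - (x.1 : ℝ)⁻¹ * v.k I J x
      + (∑ K, ∑ L, v.γ K L L x * v.γs K I J x)
      + (∑ K, ∑ L, v.γs I K L x * v.γs J K L x)
      - 1 / 4 * (∑ K, ∑ L, v.γ K L I x * v.γ K L J x)
      + v.dI E I v.φ x * v.dI E J v.φ x
      + 2 / ((n : ℝ) - 1) * V (v.φ x) * (if I = J then 1 else 0)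
  /-- Evolution of the spatial derivatives of the scalar field. -/
  dφ_eq : ∀ I x, v.d0 (v.dI E I v.φ) x =
    (v.N x)⁻¹ * v.dI E I (fun y => v.N y * v.d0 v.φ y) x - ∑ J, v.k I J x * v.dI E J v.φ x
  /-- Evolution of the time derivative of the scalar field. -/
  φ_eq : ∀ x, v.d0 (v.d0 v.φ) x =
    (∑ I, v.dI E I (v.dI E I v.φ) x) - (x.1 : ℝ)⁻¹ * v.d0 v.φ x
      + (v.N x)⁻¹ * (∑ I, v.dI E I v.N x * v.dI E I v.φ x)
      - (∑ I, ∑ J, v.γ J I I x * v.dI E J v.φ x) - deriv V (v.φ x)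
  /-- The Hamiltonian constraint. -/
  hamiltonian : ∀ x,
    v.scalExpr E x - (∑ I, ∑ J, v.k I J x * v.k I J x) + ((x.1 : ℝ)⁻¹) ^ 2 =
      (v.d0 v.φ x) ^ 2 + (∑ I, v.dI E I v.φ x * v.dI E I v.φ x) + 2 * V (v.φ x)
  /-- The momentum constraint. -/
  momentum : ∀ J x, ∑ I, v.dI E I (v.k I J) x =
    (∑ L, ∑ I, v.γ L I I x * v.k L J x) + (∑ I, ∑ L, v.γ I J L x * v.k I L x)
      + v.d0 v.φ x * v.dI E J v.φ x
  /-- The lapse equation. -/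
  lapse : ∀ x, ∑ I, v.dI E I (v.dI E I v.N) x =
    ((x.1 : ℝ)⁻¹) ^ 2 * (v.N x - 1) + (∑ I, ∑ J, v.γ J I I x * v.dI E J v.N x)
      - ((∑ I, v.dI E I v.φ x * v.dI E I v.φ x)
          + 2 * (n : ℝ) / ((n : ℝ) - 1) * V (v.φ x)) * v.N x
      + v.scalExpr E x * v.N x

/-- The initial condition
`(e_I^i, ω^I_i, k_IJ, γ_IJK, φ, e_0 φ) = (ē_I^i, ω̄^I_i, k̄_IJ, γ̄_IJK, φ̄₀, φ̄₁)` at `t = t₀`. -/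
structure HasInit (d : FRSInit n S) (t₀ : 𝒥) : Prop where
  e : ∀ I i p, v.e I i (t₀, p) = d.e I i p
  om : ∀ I i p, v.om I i (t₀, p) = d.om I i p
  k : ∀ I J p, v.k I J (t₀, p) = d.k I J p
  γ : ∀ I J K p, v.γ I J K (t₀, p) = d.γ I J K p
  φ : ∀ p, v.φ (t₀, p) = d.φ₀ p
  e0φ : ∀ p, v.d0 v.φ (t₀, p) = d.φ₁ p

end FRSVars

end FRS

/-! ### The geometry induced on the slices -/

section Induced

variable {n : ℕ} {S : Type*} [TopologicalSpace S] [ChartedSpace (EuclideanSpace ℝ (Fin n)) S]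
  {𝒥 : Opens ℝ}

/-- The first fundamental form that `g` induces on the slice through `x`. -/
def firstForm
    (g : Π x : 𝒥 × S, TangentSpace (stModel n) x →L[ℝ] TangentSpace (stModel n) x →L[ℝ] ℝ)
    (x : 𝒥 × S) (u w : TangentSpace (𝓡 n) x.2) : ℝ :=
  g x (sliceIncl x u) (sliceIncl x w)

/-- `ν` is the future pointing unit normal field of the slices. -/
def IsFutureUnitNormal
    (g : Π x : 𝒥 × S, TangentSpace (stModel n) x →L[ℝ] TangentSpace (stModel n) x →L[ℝ] ℝ)
    (ν : Π x : 𝒥 × S, TangentSpace (stModel n) x) : Prop :=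
  ∀ x, g x (ν x) (ν x) = -1 ∧ (∀ u, g x (ν x) (sliceIncl x u) = 0) ∧ 0 < dt x (ν x)

/-- The second fundamental form `k(u, w) = g(∇_u ν, w)` of the slice through `x`, for the unit
normal field `ν` of the slices. -/
def secondForm [IsManifold (𝓡 n) ∞ S]
    (g : Π x : 𝒥 × S, TangentSpace (stModel n) x →L[ℝ] TangentSpace (stModel n) x →L[ℝ] ℝ)
    (D : CovariantDerivative (stModel n) (ℝ × EuclideanSpace ℝ (Fin n))
      (TangentSpace (stModel n) : 𝒥 × S → Type _))
    (ν : Π x : 𝒥 × S, TangentSpace (stModel n) x)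
    (x : 𝒥 × S) (u w : TangentSpace (𝓡 n) x.2) : ℝ :=
  g x (D ν x (sliceIncl x u)) (sliceIncl x w)

/-- The mean curvature `tr_h k` of the slice through `x`. -/
def meanCurvature [IsManifold (𝓡 n) ∞ S]
    (g : Π x : 𝒥 × S, TangentSpace (stModel n) x →L[ℝ] TangentSpace (stModel n) x →L[ℝ] ℝ)
    (D : CovariantDerivative (stModel n) (ℝ × EuclideanSpace ℝ (Fin n))
      (TangentSpace (stModel n) : 𝒥 × S → Type _))
    (ν : Π x : 𝒥 × S, TangentSpace (stModel n) x) (x : 𝒥 × S) : ℝ :=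
  metricTrace (𝓡 n) (firstForm g x) (secondForm g D ν x)

end Induced

end

noncomputable section

set_option linter.unusedSectionVars false

section FrameCalculus

variable {E : Type*} [NormedAddCommGroup E] [NormedSpace ℝ E] [FiniteDimensional ℝ E]
  {H : Type*} [TopologicalSpace H] {I : ModelWithCorners ℝ E H}
  {M : Type*} [TopologicalSpace M] [ChartedSpace H M] [IsManifold I ∞ M]

open Filter Topology

theorem contMDiffAt_fieldDeriv {X : Π x : M, TangentSpace I x} {f : M → ℝ} {x : M}
    (hX : ContMDiffAt I I.tangent ∞ (fun y => (⟨y, X y⟩ : TangentBundle I M)) x)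
    (hf : ContMDiffAt I 𝓘(ℝ, ℝ) ∞ f x) :
    ContMDiffAt I 𝓘(ℝ, ℝ) ∞ (fieldDeriv I X f) x := by
  have h1 : ContMDiffAt I 𝓘(ℝ, E →L[ℝ] ℝ) ∞
      (inTangentCoordinates I 𝓘(ℝ, ℝ) id f (mfderiv I 𝓘(ℝ, ℝ) f) x) x :=
    hf.mfderiv_const (by simp)
  have h2 := ContMDiffAt.clm_apply_of_inCoordinates (b₁ := id) (b₂ := f)
    (ϕ := fun m => mfderiv I 𝓘(ℝ, ℝ) f m) (v := X) h1 hX hf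
  exact (contMDiff_snd_tangentBundle_modelSpace ℝ 𝓘(ℝ, ℝ)).contMDiffAt.comp x h2

/-- A vector tangent to `M` is determined by its action on smooth germs. -/
theorem tangent_ext {x : M} {u w : TangentSpace I x}
    (h : ∀ f : M → ℝ, ContMDiffAt I 𝓘(ℝ, ℝ) ∞ f x → mvfderiv I f x u = mvfderiv I f x w) :
    u = w := by
  obtain ⟨e, he⟩ := isInvertible_mfderiv_extChartAt (I := I) (mem_extChartAt_source (I := I) x)
  apply e.injective
  refine (Module.finBasis ℝ E).ext_elem fun i => ?_
  set l : E →ₗ[ℝ] ℝ := (Module.finBasis ℝ E).coord i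
  have hl : ContMDiff 𝓘(ℝ, E) 𝓘(ℝ, ℝ) ∞ (LinearMap.toContinuousLinearMap l) :=
    (ContinuousLinearMap.contDiff _).contMDiff
  have hc : ContMDiffAt I 𝓘(ℝ, E) ∞ (extChartAt I x) x := contMDiffAt_extChartAt
  have key : ∀ z : TangentSpace I x, mvfderiv I
      (LinearMap.toContinuousLinearMap l ∘ extChartAt I x) x z = l (e z) := by
    intro z
    rw [mvfderiv_comp_apply x (hl.mdifferentiableAt (by simp))
      (hc.mdifferentiableAt (by simp)), ← he]
    simp only [mvfderiv, mfderiv_eq_fderiv, ContinuousLinearMap.fderiv]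
    rfl
  have := h _ (hl.contMDiffAt.comp x hc)
  rw [key, key] at this
  exact this

variable {ι : Type*} [Fintype ι] [DecidableEq ι]

/-- A global smooth frame together with its dual coframe. -/
structure IsSmoothFrame (F : ι → Π x : M, TangentSpace I x)
    (θ : ι → Π x : M, TangentSpace I x →L[ℝ] ℝ) : Prop where
  smooth : ∀ a, IsSmoothField I (F a)
  dual : IsDualCoframe I θ F
  expand : ∀ x u, ∑ a, θ a x u • F a x = u

theorem mdifferentiableAt_finset_sum {κ : Type*} {s : Finset κ} {f : κ → M → ℝ} {x : M}
    (h : ∀ i ∈ s, MDifferentiableAt I 𝓘(ℝ, ℝ) (f i) x) :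
    MDifferentiableAt I 𝓘(ℝ, ℝ) (fun y => ∑ i ∈ s, f i y) x := by
  classical
  induction s using Finset.induction_on with
  | empty => simpa using mdifferentiableAt_const
  | insert i s hi hs =>
    simp only [Finset.sum_insert hi]
    exact (h i (Finset.mem_insert_self i s)).add
      (hs fun j hj => h j (Finset.mem_insert_of_mem hj))

theorem contMDiffAt_det {f : M → Matrix ι ι ℝ} {x : M}
    (h : ∀ i j, ContMDiffAt I 𝓘(ℝ, ℝ) ∞ (fun y => f y i j) x) :
    ContMDiffAt I 𝓘(ℝ, ℝ) ∞ (fun y => (f y).det) x := by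
  simp only [Matrix.det_apply']
  exact contMDiffAt_finsetSum fun σ _ => contMDiffAt_const.mul
    (contMDiffAt_finsetProd fun i _ => h _ _)

theorem contMDiffAt_matrix_inv {f : M → Matrix ι ι ℝ} {x : M}
    (h : ∀ i j, ContMDiffAt I 𝓘(ℝ, ℝ) ∞ (fun y => f y i j) x) (hx : (f x).det ≠ 0) (i j : ι) :
    ContMDiffAt I 𝓘(ℝ, ℝ) ∞ (fun y => (f y)⁻¹ i j) x := by
  simp only [Matrix.inv_def, Matrix.smul_apply, Ring.inverse_eq_inv', smul_eq_mul,
    Matrix.adjugate_apply]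
  refine ((contMDiffAt_det h).inv₀ hx).mul (contMDiffAt_det fun k l => ?_)
  by_cases hk : k = j
  · subst hk
    simpa using contMDiffAt_const
  · simpa [Matrix.updateRow_ne hk] using h k l

namespace IsSmoothFrame

variable {F : ι → Π x : M, TangentSpace I x} {θ : ι → Π x : M, TangentSpace I x →L[ℝ] ℝ}

theorem ext_coframe (hF : IsSmoothFrame F θ) {x : M} {u w : TangentSpace I x}
    (h : ∀ a, θ a x u = θ a x w) : u = w := by
  rw [← hF.expand x u, ← hF.expand x w]
  simp [h]

theorem coframe_sum (hF : IsSmoothFrame F θ) (x : M) (c : ι → ℝ) (a : ι) :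
    θ a x (∑ b, c b • F b x) = c a := by
  simp [hF.dual x a]

theorem linearIndependent (hF : IsSmoothFrame F θ) (x : M) :
    LinearIndependent ℝ (fun a => F a x) := by
  rw [Fintype.linearIndependent_iff]
  intro c hc a
  rw [← hF.coframe_sum x c a, hc, map_zero]

theorem span_eq_top (hF : IsSmoothFrame F θ) (x : M) :
    ⊤ ≤ Submodule.span ℝ (Set.range fun a => F a x) := by
  intro u _
  rw [← hF.expand x u]
  exact Submodule.sum_mem _ fun a _ =>
    Submodule.smul_mem _ _ (Submodule.subset_span (Set.mem_range_self a))

theorem isLocalFrameOn (hF : IsSmoothFrame F θ) : IsLocalFrameOn I E ∞ F Set.univ where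
  linearIndependent _ := hF.linearIndependent _
  generating _ := hF.span_eq_top _
  contMDiffOn a := (hF.smooth a).contMDiffOn

/-- The basis of the tangent space formed by the frame. -/
def basis (hF : IsSmoothFrame F θ) (x : M) : Module.Basis ι ℝ (TangentSpace I x) :=
  Module.Basis.mk (hF.linearIndependent x) (hF.span_eq_top x)

theorem basis_apply (hF : IsSmoothFrame F θ) (x : M) (a : ι) : hF.basis x a = F a x := by
  simp [basis]

theorem basis_repr (hF : IsSmoothFrame F θ) (x : M) (u : TangentSpace I x) (a : ι) :
    (hF.basis x).repr u a = θ a x u := by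
  conv_rhs => rw [← (hF.basis x).sum_repr u]
  simp [basis_apply, hF.dual x a]

/-- In a local trivialization, the coframe is given by smooth coefficients. -/
theorem exists_coeff (hF : IsSmoothFrame F θ) (x : M) :
    ∃ (b : Module.Basis ι ℝ E) (c : ι → ι → M → ℝ),
      (∀ a i, ContMDiffAt I 𝓘(ℝ, ℝ) ∞ (c a i) x) ∧
      ∀ᶠ y in 𝓝 x, ∀ (u : TangentSpace I y) (a : ι), θ a y u = ∑ i, c a i y *
        (trivializationAt E (TangentSpace I) x).localFrameCoeff I b i y u := by
  set t := trivializationAt E (TangentSpace I) x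
  have hx : x ∈ t.baseSet := FiberBundle.mem_baseSet_trivializationAt E (TangentSpace I) x
  let b : Module.Basis ι ℝ E := hF.basis x
  let A : M → Matrix ι ι ℝ := fun y => Matrix.of fun i a => t.localFrameCoeff I b i y (F a y)
  let B : M → Matrix ι ι ℝ := fun y => Matrix.of fun a i => θ a y (t.localFrame b i y)
  have hAs : ∀ i a, ContMDiffAt I 𝓘(ℝ, ℝ) ∞ (fun y => A y i a) x := fun i a =>
    contMDiffAt_localFrameCoeff b hx (hF.smooth a x) i
  have hex : ∀ y ∈ t.baseSet, ∀ (u : TangentSpace I y) a, θ a y u =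
      ∑ i, B y a i * t.localFrameCoeff I b i y u := by
    intro y hy u a
    have h := t.eq_sum_localFrameCoeff_smul (I := I) (b := b)
      (s := fun z => ∑ a, θ a y u • F a z) hy
    simp only [hF.expand] at h
    conv_lhs => rw [h]
    rw [map_sum]
    exact Finset.sum_congr rfl fun i _ => by rw [map_smul, smul_eq_mul, mul_comm]; rfl
  have hBA : ∀ y ∈ t.baseSet, B y * A y = 1 := by
    intro y hy
    ext a c
    rw [Matrix.mul_apply, Matrix.one_apply, ← hF.dual y a c, hex y hy]
    rfl
  refine ⟨b, fun a i y => (A y)⁻¹ a i, fun a i => contMDiffAt_matrix_inv hAs ?_ a i, ?_⟩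
  · exact (Matrix.isUnit_det_of_left_inverse (hBA x hx)).ne_zero
  · filter_upwards [t.open_baseSet.mem_nhds hx] with y hy u a
    rw [hex y hy, Matrix.inv_eq_left_inv (hBA y hy)]

theorem contMDiffAt_coframe (hF : IsSmoothFrame F θ) {X : Π x : M, TangentSpace I x} {x : M}
    (hX : ContMDiffAt I I.tangent ∞ (fun y => (⟨y, X y⟩ : TangentBundle I M)) x) (a : ι) :
    ContMDiffAt I 𝓘(ℝ, ℝ) ∞ (fun y => θ a y (X y)) x := by
  obtain ⟨b, c, hc, h⟩ := hF.exists_coeff x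
  have hx := FiberBundle.mem_baseSet_trivializationAt E (TangentSpace I : M → Type _) x
  refine ContMDiffAt.congr_of_eventuallyEq
    (contMDiffAt_finsetSum (t := Finset.univ) fun i _ => (hc a i).mul
      (contMDiffAt_localFrameCoeff b hx hX i)) ?_
  filter_upwards [h] with y hy
  exact hy _ _

theorem mdifferentiableAt_coframe (hF : IsSmoothFrame F θ) {X : Π x : M, TangentSpace I x} {x : M}
    (hX : MDifferentiableAt I I.tangent (fun y => (⟨y, X y⟩ : TangentBundle I M)) x) (a : ι) :
    MDifferentiableAt I 𝓘(ℝ, ℝ) (fun y => θ a y (X y)) x := by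
  obtain ⟨b, c, hc, h⟩ := hF.exists_coeff x
  have hx := FiberBundle.mem_baseSet_trivializationAt E (TangentSpace I : M → Type _) x
  have h1 : ∀ i, MDifferentiableAt I 𝓘(ℝ, ℝ) (fun y => c a i y *
        (trivializationAt E (TangentSpace I) x).localFrameCoeff I b i y (X y)) x := fun i =>
    ((hc a i).mdifferentiableAt (by simp)).mul (mdifferentiableAt_localFrameCoeff b hx hX i)
  refine (mdifferentiableAt_finset_sum (s := Finset.univ) fun i _ => h1 i).congr_of_eventuallyEq ?_
  filter_upwards [h] with y hy
  exact hy _ _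

end IsSmoothFrame

end FrameCalculus


section FrameBrackets

variable {E : Type*} [NormedAddCommGroup E] [NormedSpace ℝ E] [FiniteDimensional ℝ E]
  {H : Type*} [TopologicalSpace H] {I : ModelWithCorners ℝ E H}
  {M : Type*} [TopologicalSpace M] [ChartedSpace H M] [IsManifold I ∞ M]

open Filter Topology VectorField

theorem IsSmoothField.mdifferentiableAt {X : Π x : M, TangentSpace I x} (hX : IsSmoothField I X)
    (x : M) : MDifferentiableAt I I.tangent (fun y => (⟨y, X y⟩ : TangentBundle I M)) x :=
  (hX x).mdifferentiableAt (by simp)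

theorem IsSmoothField.mlieBracket {X Y : Π x : M, TangentSpace I x} (hX : IsSmoothField I X)
    (hY : IsSmoothField I Y) : IsSmoothField I (mlieBracket I X Y) := by
  have : CompleteSpace E := FiniteDimensional.complete ℝ E
  have : IsManifold I (minSmoothness ℝ 2) M :=
    IsManifold.of_le (n := ∞) (by simpa using ENat.LEInfty.out)
  have : IsManifold I (((⊤ : ℕ∞) : ℕ∞ω) + 1) M := by simpa
  exact ContDiff.mlieBracket_vectorField (m := ⊤) (n := ⊤) hX hY (by simp)

theorem IsSmoothField.fieldDeriv {X : Π x : M, TangentSpace I x} (hX : IsSmoothField I X)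
    {f : M → ℝ} (hf : ContMDiff I 𝓘(ℝ, ℝ) ∞ f) :
    ContMDiff I 𝓘(ℝ, ℝ) ∞ (fieldDeriv I X f) :=
  fun x => contMDiffAt_fieldDeriv (hX x) (hf x)

theorem IsSmoothField.smul {X : Π x : M, TangentSpace I x} (hX : IsSmoothField I X)
    {f : M → ℝ} (hf : ContMDiff I 𝓘(ℝ, ℝ) ∞ f) : IsSmoothField I (fun x => f x • X x) :=
  fun x => (hf x).smul_section (hX x)

theorem IsSmoothField.sum {κ : Type*} {s : Finset κ} {X : κ → Π x : M, TangentSpace I x}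
    (hX : ∀ i ∈ s, IsSmoothField I (X i)) : IsSmoothField I (fun x => ∑ i ∈ s, X i x) :=
  fun x => ContMDiffAt.sum_section fun i hi => hX i hi x

section Deriv

variable {X : Π x : M, TangentSpace I x} {f h : M → ℝ} {x : M}

theorem fieldDeriv_add (hf : MDifferentiableAt I 𝓘(ℝ, ℝ) f x)
    (hh : MDifferentiableAt I 𝓘(ℝ, ℝ) h x) :
    fieldDeriv I X (fun y => f y + h y) x = fieldDeriv I X f x + fieldDeriv I X h x := by
  simp [fieldDeriv, mvfderiv_fun_add hf hh]

theorem fieldDeriv_sub (hf : MDifferentiableAt I 𝓘(ℝ, ℝ) f x)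
    (hh : MDifferentiableAt I 𝓘(ℝ, ℝ) h x) :
    fieldDeriv I X (fun y => f y - h y) x = fieldDeriv I X f x - fieldDeriv I X h x := by
  simp [fieldDeriv, mvfderiv_fun_sub hf hh]

theorem fieldDeriv_neg :
    fieldDeriv I X (fun y => -f y) x = -fieldDeriv I X f x := by
  simp [fieldDeriv, mvfderiv_fun_neg]

theorem fieldDeriv_mul (hf : MDifferentiableAt I 𝓘(ℝ, ℝ) f x)
    (hh : MDifferentiableAt I 𝓘(ℝ, ℝ) h x) :
    fieldDeriv I X (fun y => f y * h y) x =
      f x * fieldDeriv I X h x + h x * fieldDeriv I X f x := by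
  simp [fieldDeriv, mvfderiv_fun_mul hf hh]

theorem fieldDeriv_const (r : ℝ) : fieldDeriv I X (fun _ => r) x = 0 := by
  simp [fieldDeriv, mvfderiv_const]

theorem mvfderiv_finset_sum {κ : Type*} {s : Finset κ} {f : κ → M → ℝ}
    (hf : ∀ i ∈ s, MDifferentiableAt I 𝓘(ℝ, ℝ) (f i) x) :
    mvfderiv I (fun y => ∑ i ∈ s, f i y) x = ∑ i ∈ s, mvfderiv I (f i) x := by
  classical
  induction s using Finset.induction_on with
  | empty => simp [mvfderiv_const]
  | insert i s hi hs =>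
    simp only [Finset.sum_insert hi]
    rw [mvfderiv_fun_add (hf i (Finset.mem_insert_self i s))
      (mdifferentiableAt_finset_sum fun j hj => hf j (Finset.mem_insert_of_mem hj)),
      hs fun j hj => hf j (Finset.mem_insert_of_mem hj)]

theorem fieldDeriv_sum {κ : Type*} {s : Finset κ} {f : κ → M → ℝ}
    (hf : ∀ i ∈ s, MDifferentiableAt I 𝓘(ℝ, ℝ) (f i) x) :
    fieldDeriv I X (fun y => ∑ i ∈ s, f i y) x = ∑ i ∈ s, fieldDeriv I X (f i) x := by
  simp [fieldDeriv, mvfderiv_finset_sum hf]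

end Deriv

theorem mlieBracket_sum_right {κ : Type*} {s : Finset κ} {X : Π x : M, TangentSpace I x}
    {Y : κ → Π x : M, TangentSpace I x} {x : M}
    (hY : ∀ i ∈ s, MDifferentiableAt I I.tangent (fun y => (⟨y, Y i y⟩ : TangentBundle I M)) x) :
    mlieBracket I X (fun y => ∑ i ∈ s, Y i y) x = ∑ i ∈ s, mlieBracket I X (Y i) x := by
  classical
  have : CompleteSpace E := FiniteDimensional.complete ℝ E
  induction s using Finset.induction_on with
  | empty =>
    have : mlieBracket I X (fun _ => 0 : Π x : M, TangentSpace I x) x = 0 :=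
      congrFun (mlieBracket_zero_right (I := I) (W := X)) x
    simpa using this
  | insert i s hi hs =>
    simp only [Finset.sum_insert hi]
    rw [← hs fun j hj => hY j (Finset.mem_insert_of_mem hj)]
    exact mlieBracket_add_right (hY i (Finset.mem_insert_self i s))
      (.sum_section fun j hj => hY j (Finset.mem_insert_of_mem hj))

theorem mlieBracket_smul_sum_right {κ : Type*} {s : Finset κ} {X : Π x : M, TangentSpace I x}
    {Y : κ → Π x : M, TangentSpace I x} {f : κ → M → ℝ} {x : M}
    (hf : ∀ i ∈ s, MDifferentiableAt I 𝓘(ℝ, ℝ) (f i) x)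
    (hY : ∀ i ∈ s, MDifferentiableAt I I.tangent (fun y => (⟨y, Y i y⟩ : TangentBundle I M)) x) :
    mlieBracket I X (fun y => ∑ i ∈ s, f i y • Y i y) x =
      ∑ i ∈ s, (fieldDeriv I X (f i) x • Y i x + f i x • mlieBracket I X (Y i) x) := by
  have : CompleteSpace E := FiniteDimensional.complete ℝ E
  rw [mlieBracket_sum_right (Y := fun i y => f i y • Y i y)
    fun i hi => (hf i hi).smul_section (hY i hi)]
  exact Finset.sum_congr rfl fun i hi => mlieBracket_smul_right (hf i hi) (hY i hi)

theorem mlieBracket_jacobi {X Y Z : Π x : M, TangentSpace I x} (hX : IsSmoothField I X)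
    (hY : IsSmoothField I Y) {x : M}
    (hZ : ContMDiffAt I I.tangent ∞ (fun y => (⟨y, Z y⟩ : TangentBundle I M)) x) :
    mlieBracket I X (mlieBracket I Y Z) x =
      mlieBracket I (mlieBracket I X Y) Z x + mlieBracket I Y (mlieBracket I X Z) x := by
  have : CompleteSpace E := FiniteDimensional.complete ℝ E
  have : IsManifold I (minSmoothness ℝ 3) M :=
    IsManifold.of_le (n := ∞) (by simpa using ENat.LEInfty.out)
  have h2 : minSmoothness ℝ 2 ≤ ∞ := by simpa using ENat.LEInfty.out
  exact leibniz_identity_mlieBracket_apply ((hX x).of_le h2) ((hY x).of_le h2)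
    (hZ.of_le h2)

variable {ι : Type*} [Fintype ι] [DecidableEq ι]

namespace IsSmoothFrame

variable {F : ι → Π x : M, TangentSpace I x} {θ : ι → Π x : M, TangentSpace I x →L[ℝ] ℝ}

/-- The Lie bracket acts on functions as the commutator. -/
theorem fieldDeriv_mlieBracket (hF : IsSmoothFrame F θ) {X Y : Π x : M, TangentSpace I x}
    (hX : IsSmoothField I X) (hY : IsSmoothField I Y) {f : M → ℝ} {x : M}
    (hf : ContMDiffAt I 𝓘(ℝ, ℝ) ∞ f x) :
    fieldDeriv I (mlieBracket I X Y) f x =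
      fieldDeriv I X (fieldDeriv I Y f) x - fieldDeriv I Y (fieldDeriv I X f) x := by
  have : CompleteSpace E := FiniteDimensional.complete ℝ E
  have hm : ∀ {h : M → ℝ} {y : M}, ContMDiffAt I 𝓘(ℝ, ℝ) ∞ h y →
    MDifferentiableAt I 𝓘(ℝ, ℝ) h y := fun h => h.mdifferentiableAt (by simp)
  rcases isEmpty_or_nonempty ι with hι | ⟨⟨a⟩⟩
  · have h0 : ∀ u : TangentSpace I x, u = 0 := fun u => by rw [← hF.expand x u]; simp
    simp [fieldDeriv, h0 (X x), h0 (Y x), h0 (mlieBracket I X Y x)]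
  have hZ := hF.smooth a
  set Z := F a
  have hev : ∀ᶠ y in 𝓝 x, MDifferentiableAt I 𝓘(ℝ, ℝ) f y :=
    (contMDiffAt_iff_contMDiffAt_nhds (by simp)).1 (hf.of_le (by simp : (1 : ℕ∞ω) ≤ ∞)) |>.mono
      fun y hy => hy.mdifferentiableAt (by simp)
  have key : ∀ {U W : Π x : M, TangentSpace I x}, IsSmoothField I U → IsSmoothField I W →
      mlieBracket I U (mlieBracket I W (f • Z)) x =
        fieldDeriv I U (fieldDeriv I W f) x • Z x + fieldDeriv I W f x • mlieBracket I U Z x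
          + (fieldDeriv I U f x • mlieBracket I W Z x
          + f x • mlieBracket I U (mlieBracket I W Z) x) := by
    intro U W hU hW
    have h1 : mlieBracket I W (f • Z) =ᶠ[𝓝 x]
        fieldDeriv I W f • Z + f • mlieBracket I W Z := by
      filter_upwards [hev] with y hy
      exact mlieBracket_smul_right hy (hZ.mdifferentiableAt y)
    have h2 := (EventuallyEq.refl (𝓝 x) U).mlieBracket_vectorField_eq h1
    rw [h2, mlieBracket_add_right, mlieBracket_smul_right, mlieBracket_smul_right]
    · rfl
    · exact hm hf
    · exact (hW.mlieBracket hZ).mdifferentiableAt x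
    · exact hm (contMDiffAt_fieldDeriv (hW x) hf)
    · exact hZ.mdifferentiableAt x
    · exact (hm (contMDiffAt_fieldDeriv (hW x) hf)).smul_section (hZ.mdifferentiableAt x)
    · exact (hm hf).smul_section ((hW.mlieBracket hZ).mdifferentiableAt x)
  have J := mlieBracket_jacobi hX hY (hf.smul_section (hZ x))
  rw [key hX hY, key hY hX, mlieBracket_smul_right (hm hf) (hZ.mdifferentiableAt x),
    mlieBracket_jacobi hX hY (hZ x)] at J
  have J' := congrArg (θ a x) J
  have haa : θ a x (Z x) = 1 := by simpa using hF.dual x a a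
  simp only [map_add, map_smul, smul_eq_mul, haa] at J'
  change fieldDeriv I (mlieBracket I X Y) f x = _
  have : mvfderiv I f x (mlieBracket I X Y x) = fieldDeriv I (mlieBracket I X Y) f x := rfl
  rw [this] at J'
  linarith

/-- The structure functions `C_ab^c` of the frame: `[F_a, F_b] = C_ab^c F_c`. -/
def _root_.structFun (F : ι → Π x : M, TangentSpace I x)
    (θ : ι → Π x : M, TangentSpace I x →L[ℝ] ℝ) (a b c : ι) (x : M) : ℝ :=
  θ c x (mlieBracket I (F a) (F b) x)

theorem mlieBracket_eq (hF : IsSmoothFrame F θ) (a b : ι) :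
    mlieBracket I (F a) (F b) = fun x => ∑ c, structFun F θ a b c x • F c x :=
  funext fun x => (hF.expand x _).symm

theorem contMDiff_structFun (hF : IsSmoothFrame F θ) (a b c : ι) :
    ContMDiff I 𝓘(ℝ, ℝ) ∞ (structFun F θ a b c) :=
  fun x => hF.contMDiffAt_coframe (((hF.smooth a).mlieBracket (hF.smooth b)) x) c

theorem structFun_swap (a b c : ι) (x : M) :
    structFun F θ a b c x = -structFun F θ b a c x := by
  simp only [structFun]
  rw [mlieBracket_swap_apply, map_neg]

theorem commutator (hF : IsSmoothFrame F θ) (a b : ι) {f : M → ℝ} {x : M}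
    (hf : ContMDiffAt I 𝓘(ℝ, ℝ) ∞ f x) :
    fieldDeriv I (F a) (fieldDeriv I (F b) f) x - fieldDeriv I (F b) (fieldDeriv I (F a) f) x =
      ∑ c, structFun F θ a b c x * fieldDeriv I (F c) f x := by
  rw [← hF.fieldDeriv_mlieBracket (hF.smooth a) (hF.smooth b) hf, hF.mlieBracket_eq]
  simp [fieldDeriv]

/-- The Jacobi identity in terms of the structure functions. -/
theorem jacobi (hF : IsSmoothFrame F θ) (a b c m : ι) (x : M) :
    fieldDeriv I (F a) (structFun F θ b c m) x
        + ∑ l, structFun F θ b c l x * structFun F θ a l m x =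
      -(fieldDeriv I (F c) (structFun F θ a b m) x
        + ∑ l, structFun F θ a b l x * structFun F θ c l m x)
      + (fieldDeriv I (F b) (structFun F θ a c m) x
        + ∑ l, structFun F θ a c l x * structFun F θ b l m x) := by
  have key : ∀ a b c, θ m x (mlieBracket I (F a) (mlieBracket I (F b) (F c)) x) =
      fieldDeriv I (F a) (structFun F θ b c m) x
        + ∑ l, structFun F θ b c l x * structFun F θ a l m x := by
    intro a b c
    rw [hF.mlieBracket_eq b c, mlieBracket_smul_sum_right
      (fun l _ => ((hF.contMDiff_structFun b c l) x).mdifferentiableAt (by simp))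
      (fun l _ => (hF.smooth l).mdifferentiableAt x), map_sum]
    simp only [map_add, map_smul, smul_eq_mul, hF.dual x m, Finset.sum_add_distrib]
    simp [structFun]
  have J := congrArg (θ m x) (mlieBracket_jacobi (hF.smooth a) (hF.smooth b) (hF.smooth c x))
  rw [map_add, mlieBracket_swap_apply (V := mlieBracket I (F a) (F b)), map_neg, key, key, key] at J
  exact J

end IsSmoothFrame

end FrameBrackets


section FrameConnection

variable {E : Type*} [NormedAddCommGroup E] [NormedSpace ℝ E] [FiniteDimensional ℝ E]
  {H : Type*} [TopologicalSpace H] {I : ModelWithCorners ℝ E H}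
  {M : Type*} [TopologicalSpace M] [ChartedSpace H M] [IsManifold I ∞ M]
  {ι : Type*} [Fintype ι] [DecidableEq ι]

open Filter Topology VectorField

namespace IsSmoothFrame

variable {F : ι → Π x : M, TangentSpace I x} {θ : ι → Π x : M, TangentSpace I x →L[ℝ] ℝ}

theorem isSmoothField_of_coframe (hF : IsSmoothFrame F θ) {X : Π x : M, TangentSpace I x}
    (h : ∀ a, ContMDiff I 𝓘(ℝ, ℝ) ∞ (fun y => θ a y (X y))) : IsSmoothField I X := by
  have : X = fun x => ∑ a, θ a x (X x) • F a x := funext fun x => (hF.expand x _).symm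
  rw [this]
  exact IsSmoothField.sum fun a _ => (hF.smooth a).smul (h a)

/-- The connection with the coefficients `G b d c = θ^c(∇_{F_b} F_d)`, as a bare function. -/
def _root_.frameConnection (F : ι → Π x : M, TangentSpace I x)
    (θ : ι → Π x : M, TangentSpace I x →L[ℝ] ℝ) (G : ι → ι → ι → M → ℝ)
    (Y : Π x : M, TangentSpace I x) (x : M) : TangentSpace I x →L[ℝ] TangentSpace I x :=
  ∑ c, (mvfderiv I (fun y => θ c y (Y y)) x
    + ∑ b, ∑ d, (G b d c x * θ d x (Y x)) • θ b x).smulRight (F c x)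

theorem coframe_frameConnection (hF : IsSmoothFrame F θ) (G : ι → ι → ι → M → ℝ)
    (Y : Π x : M, TangentSpace I x) (x : M) (u : TangentSpace I x) (c : ι) :
    θ c x (frameConnection F θ G Y x u) = mvfderiv I (fun y => θ c y (Y y)) x u
      + ∑ b, ∑ d, G b d c x * θ d x (Y x) * θ b x u := by
  have : frameConnection F θ G Y x u = ∑ c, (mvfderiv I (fun y => θ c y (Y y)) x u
      + ∑ b, ∑ d, G b d c x * θ d x (Y x) * θ b x u) • F c x := by
    simp [frameConnection]
  rw [this, hF.coframe_sum x (fun c => mvfderiv I (fun y => θ c y (Y y)) x u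
      + ∑ b, ∑ d, G b d c x * θ d x (Y x) * θ b x u)]

/-- The connection with the coefficients `G b d c = θ^c(∇_{F_b} F_d)`. -/
def connection (hF : IsSmoothFrame F θ) (G : ι → ι → ι → M → ℝ) :
    CovariantDerivative I E (TangentSpace I : M → Type _) where
  toFun := frameConnection F θ G
  isCovariantDerivativeOnUniv :=
    { add := by
        intro Y Z x hY hZ _
        ext u
        refine hF.ext_coframe fun c => ?_
        have : (fun y => θ c y ((Y + Z) y)) = fun y => θ c y (Y y) + θ c y (Z y) := by
          funext y; simp
        rw [add_apply, map_add]
        simp only [hF.coframe_frameConnection]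
        rw [this, mvfderiv_fun_add (hF.mdifferentiableAt_coframe hY c)
          (hF.mdifferentiableAt_coframe hZ c)]
        simp only [Pi.add_apply, map_add, mul_add, add_mul, Finset.sum_add_distrib, add_apply]
        ring
      leibniz := by
        intro Y f x hY hf _
        ext u
        refine hF.ext_coframe fun c => ?_
        have : (fun y => θ c y ((f • Y) y)) = fun y => f y * θ c y (Y y) := by
          funext y; simp
        rw [add_apply, map_add, smul_apply, map_smul, ContinuousLinearMap.smulRight_apply, map_smul]
        simp only [hF.coframe_frameConnection]
        rw [this, mvfderiv_fun_mul hf (hF.mdifferentiableAt_coframe hY c)]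
        have e : ∑ b, ∑ d, G b d c x * (f x * θ d x (Y x)) * θ b x u =
            f x * ∑ b, ∑ d, G b d c x * θ d x (Y x) * θ b x u := by
          simp only [Finset.mul_sum]
          refine Finset.sum_congr rfl fun b _ => Finset.sum_congr rfl fun d _ => ?_
          ring
        simp only [Pi.smul_apply', map_smul, smul_eq_mul, add_apply, smul_apply, e]
        ring }

variable {G : ι → ι → ι → M → ℝ}

theorem coframe_connection (hF : IsSmoothFrame F θ) (Y : Π x : M, TangentSpace I x) (x : M)
    (u : TangentSpace I x) (c : ι) :
    θ c x (hF.connection G Y x u) = mvfderiv I (fun y => θ c y (Y y)) x u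
      + ∑ b, ∑ d, G b d c x * θ d x (Y x) * θ b x u :=
  hF.coframe_frameConnection G Y x u c

theorem coframe_covD (hF : IsSmoothFrame F θ) (Y : Π x : M, TangentSpace I x) (x : M) (b c : ι) :
    θ c x (covD I (hF.connection G) (F b) Y x) = fieldDeriv I (F b) (fun y => θ c y (Y y)) x
      + ∑ d, G b d c x * θ d x (Y x) := by
  rw [covD, coframe_connection, Finset.sum_comm]
  simp [hF.dual x, fieldDeriv]

theorem coframe_connection_frame (hF : IsSmoothFrame F θ) (x : M) (u : TangentSpace I x)
    (c d : ι) :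
    θ c x (hF.connection G (F d) x u) = ∑ b, G b d c x * θ b x u := by
  rw [coframe_connection]
  have : (fun y => θ c y (F d y)) = fun _ => if c = d then (1 : ℝ) else 0 := by
    funext y; exact hF.dual y c d
  simp [this, mvfderiv_const, hF.dual x]

theorem coframe_covD_frame (hF : IsSmoothFrame F θ) (x : M) (b c d : ι) :
    θ c x (covD I (hF.connection G) (F b) (F d) x) = G b d c x := by
  rw [covD, coframe_connection_frame]
  simp [hF.dual x]

theorem isSmoothField_covD (hF : IsSmoothFrame F θ)
    (hG : ∀ a b c, ContMDiff I 𝓘(ℝ, ℝ) ∞ (G a b c)) (b : ι) {Y : Π x : M, TangentSpace I x}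
    (hY : IsSmoothField I Y) : IsSmoothField I (covD I (hF.connection G) (F b) Y) := by
  refine hF.isSmoothField_of_coframe fun c => ?_
  simp only [coframe_covD]
  have hc : ∀ c, ContMDiff I 𝓘(ℝ, ℝ) ∞ (fun y => θ c y (Y y)) :=
    fun c x => hF.contMDiffAt_coframe (hY x) c
  exact ((hF.smooth b).fieldDeriv (hc c)).add
    (contMDiff_finsetSum fun d _ => (hG b d c).mul (hc d))

theorem covD_expand (hF : IsSmoothFrame F θ)
    (D : CovariantDerivative I E (TangentSpace I : M → Type _)) (X Y : Π x : M, TangentSpace I x) :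
    covD I D X Y = fun x => ∑ a, θ a x (X x) • covD I D (F a) Y x := by
  funext x
  simp only [covD, ← map_smul, ← map_sum]
  rw [hF.expand]

theorem torsion_connection (hF : IsSmoothFrame F θ)
    (hT : ∀ a b c x, G a b c x - G b a c x = structFun F θ a b c x) :
    (hF.connection G).torsion = 0 := by
  funext x
  have hm := fun a => (hF.smooth a).mdifferentiableAt x
  have key : ∀ a b, (hF.connection G).torsion x (F a x) (F b x) = 0 := by
    intro a b
    rw [CovariantDerivative.torsion_apply _ (hm a) (hm b)]
    refine hF.ext_coframe fun c => ?_
    have e1 := hF.coframe_covD_frame (G := G) x a c b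
    have e2 := hF.coframe_covD_frame (G := G) x b c a
    simp only [covD] at e1 e2
    rw [map_sub, map_sub, e1, e2, hT]
    simp [structFun]
  ext u w
  rw [← hF.expand x u, ← hF.expand x w]
  simp [key]

theorem isLeviCivita_connection (hF : IsSmoothFrame F θ)
    {g : Π x : M, TangentSpace I x →L[ℝ] TangentSpace I x →L[ℝ] ℝ} {ε : ι → ℝ}
    (hg : ∀ x u w, g x u w = ∑ a, ε a * (θ a x u * θ a x w))
    (hT : ∀ a b c x, G a b c x - G b a c x = structFun F θ a b c x)
    (hM : ∀ a b c x, ε c * G a b c x + ε b * G a c b x = 0) :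
    IsLeviCivita I g (hF.connection G) where
  torsion_free := hF.torsion_connection hT
  metric := by
    intro Y Z x u hY hZ
    have hy := fun a => hF.mdifferentiableAt_coframe hY a
    have hz := fun a => hF.mdifferentiableAt_coframe hZ a
    simp only [hg]
    rw [mvfderiv_finset_sum (f := fun a y => ε a * (θ a y (Y y) * θ a y (Z y)))
      fun a _ => mdifferentiableAt_const.mul ((hy a).mul (hz a))]
    have e : ∀ a, mvfderiv I (fun y => ε a * (θ a y (Y y) * θ a y (Z y))) x u =
        ε a * (θ a x (Y x) * mvfderiv I (fun y => θ a y (Z y)) x u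
          + θ a x (Z x) * mvfderiv I (fun y => θ a y (Y y)) x u) := by
      intro a
      have hyz : MDifferentiableAt I 𝓘(ℝ, ℝ) (fun y => θ a y (Y y) * θ a y (Z y)) x :=
        (hy a).mul (hz a)
      rw [mvfderiv_fun_mul mdifferentiableAt_const hyz,
        mvfderiv_fun_mul (hy a) (hz a)]
      simp [mvfderiv_const, mul_add]
    simp only [sum_apply, e, coframe_connection]
    have e2 : ∑ a, ∑ b, ∑ d, ((ε a * G b d a x + ε d * G b a d x) *
        (θ d x (Y x) * θ b x u * θ a x (Z x))) = 0 := by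
      simp [hM]
    have e3 : ∑ a, ∑ b, ∑ d, ε d * G b a d x * (θ d x (Y x) * θ b x u * θ a x (Z x)) =
        ∑ a, ∑ b, ∑ d, ε a * G b d a x * (θ a x (Y x) * θ b x u * θ d x (Z x)) := by
      rw [Finset.sum_comm]
      conv_rhs => rw [Finset.sum_comm]
      exact Finset.sum_congr rfl fun b _ => Finset.sum_comm
    simp only [add_mul, Finset.sum_add_distrib] at e2
    rw [e3] at e2
    simp only [mul_add, add_mul, Finset.sum_add_distrib, Finset.mul_sum, Finset.sum_mul]
    have e4 : ∑ a, ∑ b, ∑ d, ε a * (G b d a x * θ d x (Y x) * θ b x u * θ a x (Z x)) =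
        ∑ a, ∑ b, ∑ d, ε a * G b d a x * (θ d x (Y x) * θ b x u * θ a x (Z x)) := by
      simp only [mul_assoc]
    have e5 : ∑ a, ∑ b, ∑ d, ε a * (θ a x (Y x) * (G b d a x * θ d x (Z x) * θ b x u)) =
        ∑ a, ∑ b, ∑ d, ε a * G b d a x * (θ a x (Y x) * θ b x u * θ d x (Z x)) := by
      refine Finset.sum_congr rfl fun a _ => Finset.sum_congr rfl fun b _ =>
        Finset.sum_congr rfl fun d _ => ?_
      ring
    have e6 : ∑ a, ε a * (θ a x (Z x) * mvfderiv I (fun y => θ a y (Y y)) x u) =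
        ∑ a, ε a * (mvfderiv I (fun y => θ a y (Y y)) x u * θ a x (Z x)) := by
      refine Finset.sum_congr rfl fun a _ => ?_
      ring
    rw [e4, e5, e6]
    linarith

end IsSmoothFrame

end FrameConnection


section FrameCurvature

variable {E : Type*} [NormedAddCommGroup E] [NormedSpace ℝ E] [FiniteDimensional ℝ E]
  {H : Type*} [TopologicalSpace H] {I : ModelWithCorners ℝ E H}
  {M : Type*} [TopologicalSpace M] [ChartedSpace H M] [IsManifold I ∞ M]
  {ι : Type*} [Fintype ι] [DecidableEq ι]

open Filter Topology VectorField

theorem curvature_swap (D : CovariantDerivative I E (TangentSpace I : M → Type _))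
    (X Y Z : Π x : M, TangentSpace I x) (x : M) :
    curvature I D X Y Z x = -curvature I D Y X Z x := by
  have : covD I D (mlieBracket I X Y) Z x = -covD I D (mlieBracket I Y X) Z x := by
    simp only [covD]
    rw [mlieBracket_swap_apply, map_neg]
  rw [curvature, curvature, this]
  abel

theorem covD_smul_left (D : CovariantDerivative I E (TangentSpace I : M → Type _)) (f : M → ℝ)
    (X Z : Π x : M, TangentSpace I x) : covD I D (f • X) Z = f • covD I D X Z := by
  funext x
  simp [covD]

theorem covD_add_left (D : CovariantDerivative I E (TangentSpace I : M → Type _))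
    (X X' Z : Π x : M, TangentSpace I x) :
    covD I D (X + X') Z = covD I D X Z + covD I D X' Z := by
  funext x
  simp [covD]

theorem trace_eq_sum_repr {κ V : Type*} [Fintype κ] [DecidableEq κ] [AddCommGroup V] [Module ℝ V]
    (b : Module.Basis κ ℝ V) (L : V →ₗ[ℝ] V) :
    LinearMap.trace ℝ V L = ∑ a, b.repr (L (b a)) a := by
  rw [LinearMap.trace_eq_matrix_trace ℝ b, Matrix.trace]
  simp [LinearMap.toMatrix_apply]

namespace IsSmoothFrame

variable {F : ι → Π x : M, TangentSpace I x} {θ : ι → Π x : M, TangentSpace I x →L[ℝ] ℝ}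
  {G : ι → ι → ι → M → ℝ}

theorem trace_eq (hF : IsSmoothFrame F θ) (x : M)
    (L : TangentSpace I x →ₗ[ℝ] TangentSpace I x) :
    LinearMap.trace ℝ (TangentSpace I x) L = ∑ a, θ a x (L (F a x)) := by
  rw [trace_eq_sum_repr (hF.basis x)]
  simp [basis_repr, basis_apply]

theorem mdifferentiableAt_covD (hF : IsSmoothFrame F θ)
    (hG : ∀ a b c, ContMDiff I 𝓘(ℝ, ℝ) ∞ (G a b c)) {X Z : Π x : M, TangentSpace I x} {x : M}
    (hX : MDifferentiableAt I I.tangent (fun y => (⟨y, X y⟩ : TangentBundle I M)) x)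
    (hZ : IsSmoothField I Z) :
    MDifferentiableAt I I.tangent
      (fun y => (⟨y, covD I (hF.connection G) X Z y⟩ : TangentBundle I M)) x := by
  rw [hF.covD_expand]
  exact .sum_section fun a _ => (hF.mdifferentiableAt_coframe hX a).smul_section
    ((hF.isSmoothField_covD hG a hZ).mdifferentiableAt x)

theorem tensorialAt_curvature (hF : IsSmoothFrame F θ)
    (hG : ∀ a b c, ContMDiff I 𝓘(ℝ, ℝ) ∞ (G a b c)) {Y Z : Π x : M, TangentSpace I x}
    (hZ : IsSmoothField I Z) (x : M) :
    TensorialAt I E (fun X => curvature I (hF.connection G) X Y Z x) x where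
  smul := by
    intro f X hf hX
    have h1 := (hF.connection G).isCovariantDerivativeOnUniv.leibniz
      (hF.mdifferentiableAt_covD hG hX hZ) hf
    simp only [curvature, covD_smul_left]
    have h2 : covD I (hF.connection G) Y (f • covD I (hF.connection G) X Z) x =
        f x • covD I (hF.connection G) Y (covD I (hF.connection G) X Z) x
          + mvfderiv I f x (Y x) • covD I (hF.connection G) X Z x := by
      conv_lhs => rw [covD]
      rw [h1]
      rfl
    have h3 : covD I (hF.connection G) (mlieBracket I (f • X) Y) Z x =
        f x • covD I (hF.connection G) (mlieBracket I X Y) Z x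
          - mvfderiv I f x (Y x) • covD I (hF.connection G) X Z x := by
      simp only [covD]
      rw [mlieBracket_smul_left hf hX, map_add, map_smul, map_smul, neg_smul]
      abel
    rw [h2, h3, Pi.smul_apply', smul_sub, smul_sub]
    abel
  add := by
    intro X X' hX hX'
    have : CompleteSpace E := FiniteDimensional.complete ℝ E
    have h1 := (hF.connection G).isCovariantDerivativeOnUniv.add
      (hF.mdifferentiableAt_covD hG hX hZ) (hF.mdifferentiableAt_covD hG hX' hZ)
    simp only [curvature, covD_add_left]
    have h2 : covD I (hF.connection G) Y
        (covD I (hF.connection G) X Z + covD I (hF.connection G) X' Z) x =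
        covD I (hF.connection G) Y (covD I (hF.connection G) X Z) x
          + covD I (hF.connection G) Y (covD I (hF.connection G) X' Z) x := by
      conv_lhs => rw [covD]
      rw [h1]
      rfl
    have h3 : covD I (hF.connection G) (mlieBracket I (X + X') Y) Z x =
        covD I (hF.connection G) (mlieBracket I X Y) Z x
          + covD I (hF.connection G) (mlieBracket I X' Y) Z x := by
      simp only [covD]
      rw [mlieBracket_add_left hX hX', map_add]
    rw [h2, h3, Pi.add_apply]
    abel

theorem curvature_expand (hF : IsSmoothFrame F θ)
    (hG : ∀ a b c, ContMDiff I 𝓘(ℝ, ℝ) ∞ (G a b c)) {X Y Z : Π x : M, TangentSpace I x}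
    {x : M} (hX : MDifferentiableAt I I.tangent (fun y => (⟨y, X y⟩ : TangentBundle I M)) x)
    (hZ : IsSmoothField I Z) :
    curvature I (hF.connection G) X Y Z x =
      ∑ a, θ a x (X x) • curvature I (hF.connection G) (F a) Y Z x := by
  have hT := hF.tensorialAt_curvature hG (Y := Y) hZ x
  rw [← TensorialAt.mkHom_apply hT hX]
  conv_lhs => rw [← hF.expand x (X x)]
  rw [map_sum]
  refine Finset.sum_congr rfl fun a _ => ?_
  rw [map_smul, TensorialAt.mkHom_apply hT ((hF.smooth a).mdifferentiableAt x)]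

theorem ricci_eq_sum (hF : IsSmoothFrame F θ)
    (hG : ∀ a b c, ContMDiff I 𝓘(ℝ, ℝ) ∞ (G a b c)) {Y Z : Π x : M, TangentSpace I x}
    (hZ : IsSmoothField I Z) (x : M) :
    ricci I (hF.connection G) Y Z x =
      ∑ a, θ a x (curvature I (hF.connection G) (F a) Y Z x) := by
  have hT := hF.tensorialAt_curvature hG (Y := Y) hZ x
  have h1 := hF.trace_eq x (TensorialAt.mkHom _ x hT).toLinearMap
  rw [trace_eq_sum_repr (tangentBasis I x)] at h1
  simp only [ContinuousLinearMap.coe_coe] at h1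
  rw [ricci]
  convert h1 using 2 with a _ a _
  · rw [Module.Basis.coord_apply, TensorialAt.mkHom_apply_eq_extend]
  · rw [TensorialAt.mkHom_apply hT ((hF.smooth a).mdifferentiableAt x)]

/-- The components `θ^c(R(F_a, F_b) F_d)` of the curvature of the connection with coefficients
`G`. -/
def _root_.frameCurvature (F : ι → Π x : M, TangentSpace I x)
    (θ : ι → Π x : M, TangentSpace I x →L[ℝ] ℝ) (G : ι → ι → ι → M → ℝ) (a b d c : ι) (x : M) : ℝ :=
  fieldDeriv I (F a) (G b d c) x - fieldDeriv I (F b) (G a d c) x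
    + ∑ e, (G a e c x * G b d e x - G b e c x * G a d e x - structFun F θ a b e x * G e d c x)

theorem coframe_curvature (hF : IsSmoothFrame F θ)
    (hG : ∀ a b c, ContMDiff I 𝓘(ℝ, ℝ) ∞ (G a b c)) {Z : Π x : M, TangentSpace I x}
    (hZ : IsSmoothField I Z) (a b c : ι) (x : M) :
    θ c x (curvature I (hF.connection G) (F a) (F b) Z x) =
      ∑ d, frameCurvature F θ G a b d c x * θ d x (Z x) := by
  have hz : ∀ d, ContMDiff I 𝓘(ℝ, ℝ) ∞ (fun y => θ d y (Z y)) :=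
    fun d x => hF.contMDiffAt_coframe (hZ x) d
  have hm : ∀ {f : M → ℝ}, ContMDiff I 𝓘(ℝ, ℝ) ∞ f → MDifferentiableAt I 𝓘(ℝ, ℝ) f x :=
    fun h => (h x).mdifferentiableAt (by simp)
  have key : ∀ a b, θ c x (covD I (hF.connection G) (F a) (covD I (hF.connection G) (F b) Z) x) =
      fieldDeriv I (F a) (fieldDeriv I (F b) (fun y => θ c y (Z y))) x
      + ∑ d, (G b d c x * fieldDeriv I (F a) (fun y => θ d y (Z y)) x
        + θ d x (Z x) * fieldDeriv I (F a) (G b d c) x)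
      + (∑ d, G a d c x * fieldDeriv I (F b) (fun y => θ d y (Z y)) x
        + ∑ d, (∑ e, G a e c x * G b d e x) * θ d x (Z x)) := by
    intro a b
    rw [coframe_covD]
    simp only [coframe_covD]
    rw [fieldDeriv_add (hm ((hF.smooth b).fieldDeriv (hz c)))
      (mdifferentiableAt_finset_sum (f := fun d y => G b d c y * θ d y (Z y))
        fun d _ => hm ((hG b d c).mul (hz d))),
      fieldDeriv_sum (f := fun d y => G b d c y * θ d y (Z y))
        fun d _ => hm ((hG b d c).mul (hz d))]
    congr 1
    · congr 1
      exact Finset.sum_congr rfl fun d _ => fieldDeriv_mul (hm (hG b d c)) (hm (hz d))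
    · simp only [mul_add, Finset.sum_add_distrib, Finset.mul_sum, Finset.sum_mul]
      congr 1
      rw [Finset.sum_comm]
      simp only [mul_assoc]
  have h3 : θ c x (covD I (hF.connection G) (mlieBracket I (F a) (F b)) Z x) =
      ∑ e, structFun F θ a b e x * fieldDeriv I (F e) (fun y => θ c y (Z y)) x
      + ∑ d, (∑ e, structFun F θ a b e x * G e d c x) * θ d x (Z x) := by
    rw [hF.covD_expand]
    simp only [map_sum, map_smul, smul_eq_mul, coframe_covD, mul_add, Finset.sum_add_distrib,
      Finset.mul_sum, Finset.sum_mul]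
    congr 1
    rw [Finset.sum_comm]
    simp only [mul_assoc]
    rfl
  have h4 := hF.commutator a b ((hz c) x)
  rw [curvature, map_sub, map_sub, key, key, h3]
  simp only [frameCurvature, add_mul, sub_mul, Finset.sum_add_distrib, Finset.sum_sub_distrib]
  have e1 : ∀ a b : ι, ∑ d, θ d x (Z x) * fieldDeriv I (F a) (G b d c) x =
      ∑ d, fieldDeriv I (F a) (G b d c) x * θ d x (Z x) :=
    fun a b => Finset.sum_congr rfl fun d _ => mul_comm _ _
  rw [e1, e1]
  linarith

/-- The Ricci curvature of the connection with coefficients `G` in terms of the frame. -/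
theorem ricci_eq (hF : IsSmoothFrame F θ)
    (hG : ∀ a b c, ContMDiff I 𝓘(ℝ, ℝ) ∞ (G a b c)) {Y Z : Π x : M, TangentSpace I x}
    (hY : IsSmoothField I Y) (hZ : IsSmoothField I Z) (x : M) :
    ricci I (hF.connection G) Y Z x = ∑ b, ∑ d, θ b x (Y x) * θ d x (Z x) *
      ∑ a, frameCurvature F θ G a b d a x := by
  have key : ∀ a, θ a x (curvature I (hF.connection G) (F a) Y Z x) =
      ∑ b, ∑ d, θ b x (Y x) * θ d x (Z x) * frameCurvature F θ G a b d a x := by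
    intro a
    rw [curvature_swap, hF.curvature_expand hG (hY.mdifferentiableAt x) hZ, map_neg, map_sum,
      ← Finset.sum_neg_distrib]
    refine Finset.sum_congr rfl fun b _ => ?_
    rw [curvature_swap, map_smul, map_neg, hF.coframe_curvature hG hZ, smul_eq_mul, mul_neg,
      neg_neg, Finset.mul_sum]
    exact Finset.sum_congr rfl fun d _ => by ring
  rw [hF.ricci_eq_sum hG hZ]
  simp only [key, Finset.mul_sum]
  rw [Finset.sum_comm]
  exact Finset.sum_congr rfl fun b _ => Finset.sum_comm

theorem metricGrad_eq (hF : IsSmoothFrame F θ)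
    {g : Π x : M, TangentSpace I x →L[ℝ] TangentSpace I x →L[ℝ] ℝ} {ε : ι → ℝ}
    (hε : ∀ a, ε a * ε a = 1)
    (hg : ∀ x u w, g x u w = ∑ a, ε a * (θ a x u * θ a x w)) (f : M → ℝ) :
    metricGrad I g f = fun x => ∑ a, (ε a * fieldDeriv I (F a) f x) • F a x := by
  funext x
  have hgF : ∀ u b, g x u (F b x) = ε b * θ b x u := by
    intro u b
    simp [hg, hF.dual x]
  have hinj : Function.Injective (fun v => g x v) := by
    intro u w huw
    refine hF.ext_coframe fun a => ?_
    have h := DFunLike.congr_fun huw (F a x)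
    simp only [hgF] at h
    calc θ a x u = ε a * ε a * θ a x u := by rw [hε, one_mul]
      _ = ε a * ε a * θ a x w := by rw [mul_assoc, h, mul_assoc]
      _ = θ a x w := by rw [hε, one_mul]
  have hgrad : g x (∑ a, (ε a * fieldDeriv I (F a) f x) • F a x) = mvfderiv I f x := by
    have hv := hF.coframe_sum x (fun a => ε a * fieldDeriv I (F a) f x)
    generalize (∑ a, (ε a * fieldDeriv I (F a) f x) • F a x) = v at hv
    ext w
    rw [← hF.expand x w]
    simp only [map_sum, map_smul, smul_eq_mul]
    refine Finset.sum_congr rfl fun b _ => ?_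
    rw [hgF, hv, ← mul_assoc (ε b), hε, one_mul]
    rfl
  rw [metricGrad, ← hgrad]
  exact Function.leftInverse_invFun hinj _

theorem waveOp_eq (hF : IsSmoothFrame F θ)
    {g : Π x : M, TangentSpace I x →L[ℝ] TangentSpace I x →L[ℝ] ℝ} {ε : ι → ℝ}
    (hε : ∀ a, ε a * ε a = 1)
    (hg : ∀ x u w, g x u w = ∑ a, ε a * (θ a x u * θ a x w)) {f : M → ℝ}
    (hf : ContMDiff I 𝓘(ℝ, ℝ) ∞ f) (x : M) :
    waveOp I g (hF.connection G) f x = ∑ a, (ε a * fieldDeriv I (F a) (fieldDeriv I (F a) f) x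
      + ∑ d, G a d a x * (ε d * fieldDeriv I (F d) f x)) := by
  rw [waveOp, hF.trace_eq, hF.metricGrad_eq hε hg]
  refine Finset.sum_congr rfl fun a _ => ?_
  have h := hF.coframe_covD (G := G) (fun x => ∑ a, (ε a * fieldDeriv I (F a) f x) • F a x) x a a
  have e : ∀ d y, θ d y (∑ a, (ε a * fieldDeriv I (F a) f y) • F a y) =
      ε d * fieldDeriv I (F d) f y := fun d y =>
    hF.coframe_sum y (fun a => ε a * fieldDeriv I (F a) f y) d
  simp only [e] at h
  rw [fieldDeriv_mul mdifferentiableAt_const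
    ((((hF.smooth a).fieldDeriv hf) x).mdifferentiableAt (by simp)), fieldDeriv_const] at h
  simpa [covD] using h

end IsSmoothFrame

end FrameCurvature


section TimeInterval

open Filter Topology

variable {𝒥 : Opens ℝ}

theorem opens_extChartAt_symm (t : 𝒥) :
    ∀ᶠ s in 𝓝 (t : ℝ), ((extChartAt 𝓘(ℝ, ℝ) t).symm s : ℝ) = s := by
  filter_upwards [extChartAt_target_mem_nhds (I := 𝓘(ℝ, ℝ)) t] with s hs
  exact (extChartAt 𝓘(ℝ, ℝ) t).right_inv hs

theorem opens_hasDerivAt {f : 𝒥 → ℝ} {t : 𝒥} (hf : MDifferentiableAt 𝓘(ℝ, ℝ) 𝓘(ℝ, ℝ) f t)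
    {f' : ℝ → ℝ} (hf' : ∀ s : 𝒥, f' s = f s) :
    HasDerivAt f' (mvfderiv 𝓘(ℝ, ℝ) f t (1 : ℝ)) t := by
  have key : ∀ (g : ℝ → ℝ) (L : ℝ →L[ℝ] ℝ),
      HasFDerivWithinAt g L (Set.range 𝓘(ℝ, ℝ)) (t : ℝ) → HasDerivAt g (L 1) (t : ℝ) := by
    intro g L h
    rw [ModelWithCorners.range_eq_univ, hasFDerivWithinAt_univ] at h
    exact h.hasDerivAt
  have h2 : HasDerivAt (f ∘ (extChartAt 𝓘(ℝ, ℝ) t).symm) (mvfderiv 𝓘(ℝ, ℝ) f t (1 : ℝ)) (t : ℝ) :=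
    key _ _ hf.hasMFDerivAt.2
  refine h2.congr_of_eventuallyEq ?_
  filter_upwards [opens_extChartAt_symm t] with s hs
  change f' s = f ((extChartAt 𝓘(ℝ, ℝ) t).symm s)
  rw [← hf', hs]

theorem opens_mvfderiv_val (t : 𝒥) (u : TangentSpace 𝓘(ℝ, ℝ) t) :
    mvfderiv 𝓘(ℝ, ℝ) (Subtype.val : 𝒥 → ℝ) t u = u := by
  have h1 := opens_hasDerivAt (f := (Subtype.val : 𝒥 → ℝ)) (t := t)
    (contMDiff_subtype_val.mdifferentiableAt (n := ∞) (by simp)) (f' := id) (fun _ => rfl)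
  have h2 : mvfderiv 𝓘(ℝ, ℝ) (Subtype.val : 𝒥 → ℝ) t (1 : ℝ) = 1 :=
    h1.unique (hasDerivAt_id _)
  have key : ∀ (L : ℝ →L[ℝ] ℝ) (u : ℝ), L 1 = 1 → L u = u := by
    intro L u hL
    rw [← mul_one u, ← smul_eq_mul, map_smul, hL]
  exact key _ u h2

theorem opens_contMDiff_one : ContMDiff 𝓘(ℝ, ℝ) 𝓘(ℝ, ℝ).tangent ∞
    (fun t : 𝒥 => (⟨t, (1 : ℝ)⟩ : TangentBundle 𝓘(ℝ, ℝ) 𝒥)) := by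
  intro t
  refine (contMDiffAt_section (E := fun x : 𝒥 => TangentSpace 𝓘(ℝ, ℝ) x)
    (s := fun _ : 𝒥 => (1 : ℝ)) t).2 ?_
  have : ∀ s : 𝒥, (trivializationAt ℝ (TangentSpace 𝓘(ℝ, ℝ)) t
      (⟨s, (1 : ℝ)⟩ : TangentBundle 𝓘(ℝ, ℝ) 𝒥)).2 = (1 : ℝ) := by
    intro s
    rw [TangentBundle.trivializationAt_apply]
    simp only [ModelWithCorners.range_eq_univ, fderivWithin_univ]
    have h : (extChartAt 𝓘(ℝ, ℝ) t ∘ (extChartAt 𝓘(ℝ, ℝ) s).symm) =ᶠ[𝓝 (s : ℝ)] id :=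
      opens_extChartAt_symm s
    have h2 := h.fderiv_eq (𝕜 := ℝ)
    rw [fderiv_id] at h2
    exact DFunLike.congr_fun h2 (1 : ℝ)
  exact (contMDiffAt_const (c := (1 : ℝ))).congr_of_eventuallyEq (Eventually.of_forall this)

end TimeInterval

section Product

open Filter Topology VectorField

variable {n : ℕ} {S : Type*} [TopologicalSpace S] [ChartedSpace (EuclideanSpace ℝ (Fin n)) S]
  {𝒥 : Opens ℝ}

theorem mvfderiv_sliceIncl {f : 𝒥 × S → ℝ} {x : 𝒥 × S}
    (hf : MDifferentiableAt (stModel n) 𝓘(ℝ, ℝ) f x) (u : TangentSpace (𝓡 n) x.2) :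
    mvfderiv (stModel n) f x (sliceIncl x u) = mvfderiv (𝓡 n) (fun q => f (x.1, q)) x.2 u := by
  have h := mvfderiv_comp_apply (g := f) (f := fun q : S => (x.1, q)) x.2 hf
    (mdifferentiableAt_const.prodMk mdifferentiableAt_id) u
  rw [mfderiv_prod_right] at h
  exact h.symm

theorem mvfderiv_comp_snd {h : S → ℝ} {x : 𝒥 × S}
    (hh : MDifferentiableAt (𝓡 n) 𝓘(ℝ, ℝ) h x.2) (w : TangentSpace (stModel n) x) :
    mvfderiv (stModel n) (fun y : 𝒥 × S => h y.2) x w = mvfderiv (𝓡 n) h x.2 (spaceProj x w) := by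
  have e := mvfderiv_comp_apply (g := h) (f := (Prod.snd : 𝒥 × S → S)) x hh
    mdifferentiableAt_snd w
  rw [mfderiv_snd] at e
  exact e

theorem contMDiff_time :
    ContMDiff (stModel n) 𝓘(ℝ, ℝ) ∞ (fun y : 𝒥 × S => (y.1 : ℝ)) :=
  contMDiff_subtype_val.comp contMDiff_fst

theorem mvfderiv_time (x : 𝒥 × S) (w : TangentSpace (stModel n) x) :
    mvfderiv (stModel n) (fun y : 𝒥 × S => (y.1 : ℝ)) x w = dt x w := by
  have e := mvfderiv_comp_apply (f := (Prod.fst : 𝒥 × S → 𝒥))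
    (g := (Subtype.val : 𝒥 → ℝ)) x (contMDiff_subtype_val.mdifferentiableAt (n := ∞) (by simp))
    mdifferentiableAt_fst w
  rw [mfderiv_fst, opens_mvfderiv_val] at e
  exact e

theorem hasDerivAt_partialT {f : 𝒥 × S → ℝ} {x : 𝒥 × S}
    (hf : MDifferentiableAt (stModel n) 𝓘(ℝ, ℝ) f x) {f' : ℝ → ℝ}
    (hf' : ∀ s : 𝒥, f' s = f (s, x.2)) :
    HasDerivAt f' (fieldDeriv (stModel n) partialT f x) x.1 := by
  have hm : MDifferentiableAt 𝓘(ℝ, ℝ) (stModel n) (fun s : 𝒥 => (s, x.2)) x.1 :=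
    mdifferentiableAt_id.prodMk mdifferentiableAt_const
  have h := mvfderiv_comp_apply (g := f) (f := fun s : 𝒥 => (s, x.2)) x.1 hf hm (1 : ℝ)
  rw [mfderiv_prod_left] at h
  have e : fieldDeriv (stModel n) partialT f x =
    mvfderiv 𝓘(ℝ, ℝ) (f ∘ fun s : 𝒥 => (s, x.2)) x.1 (1 : ℝ) := h.symm
  rw [e]
  exact opens_hasDerivAt (hf.comp x.1 hm) hf'

theorem dt_sliceIncl (x : 𝒥 × S) (u : TangentSpace (𝓡 n) x.2) : dt x (sliceIncl x u) = 0 := rfl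

theorem spaceProj_sliceIncl (x : 𝒥 × S) (u : TangentSpace (𝓡 n) x.2) :
    spaceProj x (sliceIncl x u) = u := rfl

theorem dt_partialT (x : 𝒥 × S) : dt x (partialT x : TangentSpace (stModel n) x) = 1 := rfl

theorem spaceProj_partialT (x : 𝒥 × S) :
    spaceProj x (partialT x : TangentSpace (stModel n) x) = 0 := rfl

theorem tangent_decomp (x : 𝒥 × S) (w : TangentSpace (stModel n) x) :
    dt x w • partialT x + sliceIncl x (spaceProj x w) = w := by
  refine Prod.ext ?_ ?_
  · change (dt x w) • (1 : ℝ) + 0 = _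
    rw [smul_eq_mul, mul_one, add_zero]
    rfl
  · change (dt x w) • (0 : EuclideanSpace ℝ (Fin n)) + _ = _
    rw [smul_zero, zero_add]
    rfl

variable [IsManifold (𝓡 n) ∞ S]

theorem isSmoothField_partialT :
    IsSmoothField (stModel n) (partialT : Π x : 𝒥 × S, TangentSpace (stModel n) x) := by
  have h1 : ContMDiff (stModel n) (𝓘(ℝ, ℝ).tangent.prod (𝓡 n).tangent) ∞
      (fun x : 𝒥 × S => ((⟨x.1, (1 : ℝ)⟩ : TangentBundle 𝓘(ℝ, ℝ) 𝒥),
        (⟨x.2, 0⟩ : TangentBundle (𝓡 n) S))) :=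
    (opens_contMDiff_one.comp contMDiff_fst).prodMk
      ((contMDiff_zeroSection ℝ (TangentSpace (𝓡 n))).comp contMDiff_snd)
  exact contMDiff_equivTangentBundleProd_symm.comp h1

theorem isSmoothField_sliceIncl {X : Π p : S, TangentSpace (𝓡 n) p} (hX : IsSmoothField (𝓡 n) X) :
    IsSmoothField (stModel n) (fun x : 𝒥 × S => sliceIncl x (X x.2)) := by
  have h1 : ContMDiff (stModel n) (𝓘(ℝ, ℝ).tangent.prod (𝓡 n).tangent) ∞
      (fun x : 𝒥 × S => ((⟨x.1, 0⟩ : TangentBundle 𝓘(ℝ, ℝ) 𝒥),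
        (⟨x.2, X x.2⟩ : TangentBundle (𝓡 n) S))) :=
    ((contMDiff_zeroSection ℝ (TangentSpace 𝓘(ℝ, ℝ))).comp contMDiff_fst).prodMk
      (hX.comp contMDiff_snd)
  exact contMDiff_equivTangentBundleProd_symm.comp h1

variable {E : Fin n → Π p : S, TangentSpace (𝓡 n) p}
  {η : Fin n → Π p : S, TangentSpace (𝓡 n) p →L[ℝ] ℝ}

theorem isSmoothFrame_of_isLocalFrameOn
    (hE : IsLocalFrameOn (𝓡 n) (EuclideanSpace ℝ (Fin n)) ∞ E Set.univ)
    (hη : IsDualCoframe (𝓡 n) η E) : IsSmoothFrame E η where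
  smooth i := contMDiffOn_univ.1 (hE.contMDiffOn i)
  dual := hη
  expand p u := by
    have h := hE.coeff_sum_eq (fun q => ∑ i, hE.coeff i p u • E i q) (Set.mem_univ p)
    have hu : u = ∑ i, hE.coeff i p u • E i p := by
      have b := (hE.toBasisAt (Set.mem_univ p)).sum_repr u
      simp only [IsLocalFrameOn.toBasisAt_coe] at b
      conv_lhs => rw [← b]
      simp [IsLocalFrameOn.coeff]
    conv_rhs => rw [hu]
    refine Finset.sum_congr rfl fun a _ => ?_
    congr 1
    conv_lhs => rw [hu]
    simp [hη p a]

/-- The frame `∂_t, E_1, …, E_n` of `𝒥 × S`. -/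
def productFrame (E : Fin n → Π p : S, TangentSpace (𝓡 n) p) :
    Option (Fin n) → Π x : 𝒥 × S, TangentSpace (stModel n) x
  | none => partialT
  | some i => fun x => sliceIncl x (E i x.2)

/-- The coframe `dt, η^1, …, η^n` of `𝒥 × S`. -/
def productCoframe (η : Fin n → Π p : S, TangentSpace (𝓡 n) p →L[ℝ] ℝ) :
    Option (Fin n) → Π x : 𝒥 × S, TangentSpace (stModel n) x →L[ℝ] ℝ
  | none => dt
  | some i => fun x => (η i x.2).comp (spaceProj x)

theorem isSmoothFrame_product (hE : IsSmoothFrame E η) :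
    IsSmoothFrame (productFrame E : Option (Fin n) → Π x : 𝒥 × S, TangentSpace (stModel n) x)
      (productCoframe η) where
  smooth
    | none => isSmoothField_partialT
    | some i => isSmoothField_sliceIncl (hE.smooth i)
  dual x a b := by
    cases a <;> cases b <;> simp [productFrame, productCoframe, dt_sliceIncl, dt_partialT,
      spaceProj_partialT, spaceProj_sliceIncl, hE.dual x.2]
  expand x u := by
    rw [Fintype.sum_option]
    conv_rhs => rw [← tangent_decomp x u, ← hE.expand x.2 (spaceProj x u), map_sum]
    simp only [map_smul]
    rfl

/-- The bracket of two fields tangent to the slices is the bracket within the slices. -/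
theorem spaceProj_mlieBracket_sliceIncl (hE : IsSmoothFrame E η)
    {A B : Π x : 𝒥 × S, TangentSpace (𝓡 n) x.2}
    (hA : IsSmoothField (stModel n) (fun x : 𝒥 × S => sliceIncl x (A x)))
    (hB : IsSmoothField (stModel n) (fun x : 𝒥 × S => sliceIncl x (B x))) (t : 𝒥) (p : S)
    (hA' : IsSmoothField (𝓡 n) (fun q => A (t, q)))
    (hB' : IsSmoothField (𝓡 n) (fun q => B (t, q))) :
    spaceProj (t, p) (mlieBracket (stModel n) (fun x : 𝒥 × S => sliceIncl x (A x))
      (fun x => sliceIncl x (B x)) (t, p)) =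
      mlieBracket (𝓡 n) (fun q => A (t, q)) (fun q => B (t, q)) p := by
  refine tangent_ext fun h hh => ?_
  have hev : ∀ᶠ q in 𝓝 p, MDifferentiableAt (𝓡 n) 𝓘(ℝ, ℝ) h q :=
    (contMDiffAt_iff_contMDiffAt_nhds (by simp)).1 (hh.of_le (by simp : (1 : ℕ∞ω) ≤ ∞)) |>.mono
      fun y hy => hy.mdifferentiableAt (by simp)
  have hs : ContMDiffAt (stModel n) 𝓘(ℝ, ℝ) ∞ (fun y : 𝒥 × S => h y.2) (t, p) :=
    hh.comp (t, p) contMDiffAt_snd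
  rw [← mvfderiv_comp_snd (x := (t, p)) (hh.mdifferentiableAt (by simp))]
  have h1 := (isSmoothFrame_product (𝒥 := 𝒥) hE).fieldDeriv_mlieBracket hA hB hs
  have h2 := hE.fieldDeriv_mlieBracket hA' hB' hh
  refine h1.trans (Eq.trans ?_ h2.symm)
  have key : ∀ A B : Π x : 𝒥 × S, TangentSpace (𝓡 n) x.2,
      IsSmoothField (stModel n) (fun x : 𝒥 × S => sliceIncl x (B x)) →
      fieldDeriv (stModel n) (fun x : 𝒥 × S => sliceIncl x (A x))
        (fieldDeriv (stModel n) (fun x : 𝒥 × S => sliceIncl x (B x)) fun y => h y.2) (t, p) =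
      fieldDeriv (𝓡 n) (fun q => A (t, q)) (fieldDeriv (𝓡 n) (fun q => B (t, q)) h) p := by
    intro A B hB
    rw [fieldDeriv, mvfderiv_sliceIncl
      ((contMDiffAt_fieldDeriv (hB (t, p)) hs).mdifferentiableAt (by simp)), fieldDeriv]
    have e : (fun q => fieldDeriv (stModel n) (fun x : 𝒥 × S => sliceIncl x (B x))
        (fun y => h y.2) (t, q)) =ᶠ[𝓝 p] fieldDeriv (𝓡 n) (fun q => B (t, q)) h := by
      filter_upwards [hev] with q hq
      rw [fieldDeriv, mvfderiv_comp_snd (x := (t, q)) hq]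
      rfl
    simp only [mvfderiv]
    rw [e.mfderiv_eq]
    rfl
  rw [key A B hB, key B A hA]

theorem dt_mlieBracket (hE : IsSmoothFrame E η) {X Y : Π x : 𝒥 × S, TangentSpace (stModel n) x}
    (hX : IsSmoothField (stModel n) X) (hY : IsSmoothField (stModel n) Y) {r s : ℝ}
    (hXr : ∀ x, dt x (X x) = r) (hYs : ∀ x, dt x (Y x) = s) (x : 𝒥 × S) :
    dt x (mlieBracket (stModel n) X Y x) = 0 := by
  have h := (isSmoothFrame_product (𝒥 := 𝒥) hE).fieldDeriv_mlieBracket hX hY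
    (contMDiff_time x)
  have e : ∀ {Z : Π x : 𝒥 × S, TangentSpace (stModel n) x} {r : ℝ}, (∀ x, dt x (Z x) = r) →
      fieldDeriv (stModel n) Z (fun y : 𝒥 × S => (y.1 : ℝ)) = fun _ => r := by
    intro Z r hZ
    funext y
    rw [fieldDeriv, mvfderiv_time, hZ]
  rw [e hXr, e hYs, fieldDeriv_const, fieldDeriv_const, sub_zero, fieldDeriv, mvfderiv_time] at h
  exact h

theorem mlieBracket_partialT_sliceIncl (hE : IsSmoothFrame E η) (i : Fin n) (x : 𝒥 × S) :
    mlieBracket (stModel n) partialT (fun x : 𝒥 × S => sliceIncl x (E i x.2)) x = 0 := by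
  have hs := isSmoothField_sliceIncl (𝒥 := 𝒥) (hE.smooth i)
  have h1 : dt x (mlieBracket (stModel n) partialT
      (fun x : 𝒥 × S => sliceIncl x (E i x.2)) x) = 0 :=
    dt_mlieBracket hE isSmoothField_partialT hs dt_partialT (fun x => dt_sliceIncl x _) x
  have h2 : spaceProj x (mlieBracket (stModel n) partialT
      (fun x : 𝒥 × S => sliceIncl x (E i x.2)) x) = 0 := by
    refine tangent_ext fun h hh => ?_
    have hev : ∀ᶠ q in 𝓝 x.2, MDifferentiableAt (𝓡 n) 𝓘(ℝ, ℝ) h q :=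
      (contMDiffAt_iff_contMDiffAt_nhds (by simp)).1 (hh.of_le (by simp : (1 : ℕ∞ω) ≤ ∞)) |>.mono
        fun y hy => hy.mdifferentiableAt (by simp)
    have hev' : ∀ᶠ y : 𝒥 × S in 𝓝 x, MDifferentiableAt (𝓡 n) 𝓘(ℝ, ℝ) h y.2 :=
      continuous_snd.continuousAt.eventually hev
    have hsm : ContMDiffAt (stModel n) 𝓘(ℝ, ℝ) ∞ (fun y : 𝒥 × S => h y.2) x :=
      hh.comp x contMDiffAt_snd
    rw [← mvfderiv_comp_snd (hh.mdifferentiableAt (by simp)), map_zero]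
    refine ((isSmoothFrame_product (𝒥 := 𝒥) hE).fieldDeriv_mlieBracket isSmoothField_partialT
      hs hsm).trans ?_
    have e1 : fieldDeriv (stModel n) partialT (fun y : 𝒥 × S => h y.2) =ᶠ[𝓝 x] fun _ => 0 := by
      filter_upwards [hev'] with y hy
      rw [fieldDeriv, mvfderiv_comp_snd hy, spaceProj_partialT, map_zero]
    have e2 : fieldDeriv (stModel n) (fun x : 𝒥 × S => sliceIncl x (E i x.2))
        (fun y : 𝒥 × S => h y.2) =ᶠ[𝓝 x] fun y => fieldDeriv (𝓡 n) (E i) h y.2 := by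
      filter_upwards [hev'] with y hy
      rw [fieldDeriv, mvfderiv_comp_snd hy, spaceProj_sliceIncl]
      rfl
    have e3 : fieldDeriv (stModel n) partialT (fun y : 𝒥 × S => fieldDeriv (𝓡 n) (E i) h y.2) x
        = 0 := by
      rw [fieldDeriv, mvfderiv_comp_snd
        ((contMDiffAt_fieldDeriv (hE.smooth i x.2) hh).mdifferentiableAt (by simp)),
        spaceProj_partialT, map_zero]
    have c : ∀ {X : Π x : 𝒥 × S, TangentSpace (stModel n) x} {f f' : 𝒥 × S → ℝ},
        f =ᶠ[𝓝 x] f' → fieldDeriv (stModel n) X f x = fieldDeriv (stModel n) X f' x := by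
      intro X f f' hff
      simp only [fieldDeriv, mvfderiv]
      rw [hff.mfderiv_eq]
      rfl
    rw [c e1, c e2, e3, fieldDeriv_const, sub_zero]
  rw [← tangent_decomp x (mlieBracket (stModel n) partialT
      (fun x : 𝒥 × S => sliceIncl x (E i x.2)) x), h1, h2, zero_smul, map_zero, add_zero]

end Product

section LinearODE

open Filter Topology

/-- A solution of a linear system of ordinary differential equations that vanishes at one time
vanishes identically. -/
theorem linearODE_eq_zero {ι : Type*} [Fintype ι] {J : Set ℝ} (hJ : IsOpen J) (hJ' : J.OrdConnected)
    {A : ι → ι → ℝ → ℝ} (hA : ∀ a b, ContinuousOn (A a b) J) {y : ι → ℝ → ℝ}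
    (hy : ∀ a, ∀ s ∈ J, HasDerivAt (y a) (∑ b, A a b s * y b s) s) {t₀ : ℝ} (ht₀ : t₀ ∈ J)
    (h0 : ∀ a, y a t₀ = 0) {s : ℝ} (hs : s ∈ J) (a : ι) : y a s = 0 := by
  obtain ⟨l, hl, hlJ⟩ : ∃ l < min t₀ s, Set.Icc l (min t₀ s) ⊆ J := by
    have hm : min t₀ s ∈ J := by rcases min_choice t₀ s with h | h <;> rw [h] <;> assumption
    obtain ⟨l, hl, h⟩ := exists_Ioc_subset_of_mem_nhds (hJ.mem_nhds hm) ⟨_, sub_one_lt _⟩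
    obtain ⟨l', h1, h2⟩ := exists_between hl
    exact ⟨l', h2, fun z hz => h ⟨h1.trans_le hz.1, hz.2⟩⟩
  obtain ⟨r, hr, hrJ⟩ : ∃ r > max t₀ s, Set.Icc (max t₀ s) r ⊆ J := by
    have hm : max t₀ s ∈ J := by rcases max_choice t₀ s with h | h <;> rw [h] <;> assumption
    obtain ⟨r, hr, h⟩ := exists_Ico_subset_of_mem_nhds (hJ.mem_nhds hm) ⟨_, lt_add_one _⟩
    obtain ⟨r', h1, h2⟩ := exists_between hr
    exact ⟨r', h1, fun z hz => h ⟨hz.1, hz.2.trans_lt h2⟩⟩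
  have hsub : Set.Icc l r ⊆ J := hJ'.out (hlJ ⟨le_rfl, hl.le⟩) (hrJ ⟨hr.le, le_rfl⟩)
  have hb : ∀ a b, ∃ C, ∀ z ∈ Set.Icc l r, ‖A a b z‖ ≤ C := fun a b =>
    isCompact_Icc.exists_bound_of_continuousOn ((hA a b).mono hsub)
  choose C hC using hb
  have hl' := lt_min_iff.1 hl
  have hr' := max_lt_iff.1 hr
  have hlr : l ∈ Set.Icc l r := ⟨le_rfl, (hl'.1.trans hr'.1).le⟩
  have hC0 : ∀ a b, 0 ≤ C a b := fun a b => (norm_nonneg _).trans (hC a b l hlr)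
  have hK : 0 ≤ ∑ a, ∑ b, C a b :=
    Finset.sum_nonneg fun a _ => Finset.sum_nonneg fun b _ => hC0 a b
  have hL : ∀ z ∈ Set.Ioo l r, LipschitzOnWith (∑ a, ∑ b, C a b).toNNReal
      (fun (w : ι → ℝ) a => ∑ b, A a b z * w b) Set.univ := by
    intro z hz
    refine LipschitzOnWith.of_dist_le_mul fun w _ w' _ => ?_
    rw [Real.coe_toNNReal _ hK, dist_pi_le_iff (by positivity)]
    intro a
    rw [Real.dist_eq, ← Finset.sum_sub_distrib]
    calc |∑ b, (A a b z * w b - A a b z * w' b)| ≤ ∑ b, C a b * dist w w' := by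
          refine (Finset.abs_sum_le_sum_abs _ _).trans (Finset.sum_le_sum fun b _ => ?_)
          rw [← mul_sub, abs_mul]
          exact mul_le_mul (hC a b z (Set.Ioo_subset_Icc_self hz)) (dist_le_pi_dist w w' b)
            (abs_nonneg _) (hC0 a b)
      _ = (∑ b, C a b) * dist w w' := by rw [Finset.sum_mul]
      _ ≤ _ := by
        refine mul_le_mul_of_nonneg_right ?_ dist_nonneg
        exact Finset.single_le_sum (f := fun a => ∑ b, C a b)
          (fun a _ => Finset.sum_nonneg fun b _ => hC0 a b) (Finset.mem_univ a)
  have hd : ∀ z ∈ J, HasDerivAt (fun z a => y a z) (fun a => ∑ b, A a b z * y b z) z :=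
    fun z hz => hasDerivAt_pi.2 fun a => hy a z hz
  have h := ODE_solution_unique_of_mem_Icc (v := fun z (w : ι → ℝ) a => ∑ b, A a b z * w b)
    (s := fun _ => Set.univ) (f := fun z a => y a z) (g := fun _ => 0) (a := l) (b := r) (t₀ := t₀)
    hL ⟨hl'.1, hr'.1⟩
    (fun z hz => (hd z (hsub hz)).continuousAt.continuousWithinAt)
    (fun z hz => hd z (hsub (Set.Ioo_subset_Icc_self hz))) (fun _ _ => trivial)
    continuousOn_const (fun z _ => by
      convert hasDerivAt_const z (0 : ι → ℝ) using 1
      funext a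
      simp)
    (fun _ _ => trivial) (funext h0)
  exact congrFun (h ⟨hl'.2.le, hr'.2.le⟩) a

variable {n : ℕ} {S : Type*} [TopologicalSpace S] [ChartedSpace (EuclideanSpace ℝ (Fin n)) S]
  {𝒥 : Opens ℝ}

theorem eq_zero_of_partialT (h𝒥 : (𝒥 : Set ℝ).OrdConnected) {ι : Type*} [Fintype ι]
    {A : ι → ι → 𝒥 × S → ℝ} (hA : ∀ a b, Continuous (A a b)) {y : ι → 𝒥 × S → ℝ}
    (hs : ∀ a, ContMDiff (stModel n) 𝓘(ℝ, ℝ) ∞ (y a))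
    (hy : ∀ a x, fieldDeriv (stModel n) partialT (y a) x = ∑ b, A a b x * y b x) {t₀ : 𝒥}
    (h0 : ∀ a p, y a (t₀, p) = 0) (a : ι) (x : 𝒥 × S) : y a x = 0 := by
  classical
  obtain ⟨t, p⟩ := x
  let ext : (𝒥 × S → ℝ) → ℝ → ℝ := fun f s => if h : s ∈ 𝒥 then f (⟨s, h⟩, p) else 0
  have hext : ∀ f (s : 𝒥), ext f s = f (s, p) := fun f s => by simp [ext]
  have h := linearODE_eq_zero (A := fun a b => ext (A a b)) (y := fun a => ext (y a)) 𝒥.isOpen h𝒥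
    (fun a b => ?_) (fun a s hsJ => ?_) t₀.2 (fun a => by rw [hext, h0]) t.2 a
  · rwa [hext] at h
  · rw [continuousOn_iff_continuous_domRestrict]
    refine ((hA a b).comp (Continuous.prodMk_left p)).congr fun s => (hext _ s).symm
  · have := hasDerivAt_partialT (x := ((⟨s, hsJ⟩, p) : 𝒥 × S))
      ((hs a _).mdifferentiableAt (by simp))
      (f' := ext (y a)) (hext _)
    rw [hy] at this
    simpa only [← hext] using this

namespace FRSVars

variable {v : FRSVars n 𝒥 S}

theorem partialT_eq (hN : ∀ x, 0 < v.N x) (x : 𝒥 × S) :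
    (partialT x : TangentSpace (stModel n) x) = v.N x • v.e0 x := by
  rw [e0, smul_smul, mul_inv_cancel₀ (hN x).ne', one_smul]

theorem fieldDeriv_partialT (hN : ∀ x, 0 < v.N x) (f : 𝒥 × S → ℝ) (x : 𝒥 × S) :
    fieldDeriv (stModel n) partialT f x = v.N x * v.d0 f x := by
  rw [fieldDeriv, partialT_eq hN, map_smul, d0, fieldDeriv, smul_eq_mul]

theorem eq_zero_of_d0 (hv : v.Smooth) (hN : ∀ x, 0 < v.N x) (h𝒥 : (𝒥 : Set ℝ).OrdConnected)
    {ι : Type*} [Fintype ι] {A : ι → ι → 𝒥 × S → ℝ} (hA : ∀ a b, Continuous (A a b))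
    {y : ι → 𝒥 × S → ℝ} (hs : ∀ a, ContMDiff (stModel n) 𝓘(ℝ, ℝ) ∞ (y a))
    (hy : ∀ a x, v.d0 (y a) x = ∑ b, A a b x * y b x) {t₀ : 𝒥}
    (h0 : ∀ a p, y a (t₀, p) = 0) (a : ι) (x : 𝒥 × S) : y a x = 0 :=
  eq_zero_of_partialT (A := fun a b x => v.N x * A a b x) h𝒥
    (fun a b => hv.N.continuous.mul (hA a b)) hs
    (fun a x => by simp only [fieldDeriv_partialT hN, hy, Finset.mul_sum, mul_assoc]) h0 a x

end FRSVars

end LinearODE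

section ChangeOfFrame

variable {n : ℕ} {S : Type*} [TopologicalSpace S] [ChartedSpace (EuclideanSpace ℝ (Fin n)) S]
  [IsManifold (𝓡 n) ∞ S] {ι : Type*} [Fintype ι] [DecidableEq ι]
  {E : ι → Π p : S, TangentSpace (𝓡 n) p} {η : ι → Π p : S, TangentSpace (𝓡 n) p →L[ℝ] ℝ}

theorem IsSmoothFrame.changeOfFrame (hE : IsSmoothFrame E η) {e om : ι → ι → S → ℝ}
    (he : ∀ I i, ContMDiff (𝓡 n) 𝓘(ℝ, ℝ) ∞ (e I i))
    (h : ∀ I J p, ∑ i, om I i p * e J i p = if I = J then 1 else 0) :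
    IsSmoothFrame (fun I p => ∑ i, e I i p • E i p) (fun I p => ∑ i, om I i p • η i p) where
  smooth I := IsSmoothField.sum fun i _ => (hE.smooth i).smul (he I i)
  dual p I J := by
    rw [← h I J p, sum_apply]
    refine Finset.sum_congr rfl fun i _ => ?_
    rw [smul_apply, hE.coframe_sum p (fun i => e J i p) i, smul_eq_mul]
  expand p u := by
    have hmat : (Matrix.of fun I i => om I i p) * (Matrix.of fun i J => e J i p) = 1 := by
      ext I J
      simp [Matrix.mul_apply, h, Matrix.one_apply]
    have hmat' := mul_eq_one_comm.1 hmat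
    refine hE.ext_coframe fun j => ?_
    simp only [Finset.smul_sum, smul_smul, map_sum]
    rw [Finset.sum_comm]
    simp only [map_smul, smul_eq_mul, hE.dual p j, mul_ite, mul_one, mul_zero]
    have hj : ∀ i, ∑ I, e I j p * om I i p = if j = i then 1 else 0 := by
      intro i
      have := congrFun (congrFun hmat' j) i
      simpa [Matrix.mul_apply, Matrix.one_apply] using this
    simp only [sum_apply, smul_apply, smul_eq_mul, Finset.sum_mul]
    rw [Finset.sum_comm]
    simp only [Finset.sum_ite_eq, Finset.mem_univ, if_true]
    rw [Finset.sum_comm]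
    calc ∑ i, ∑ I, om I i p * η i p u * e I j p
        = ∑ i, (∑ I, e I j p * om I i p) * η i p u := by
          refine Finset.sum_congr rfl fun i _ => ?_
          rw [Finset.sum_mul]
          exact Finset.sum_congr rfl fun I _ => by ring
      _ = η j p u := by simp [hj]

end ChangeOfFrame

section Solution

open Filter Topology VectorField

variable {n : ℕ} {S : Type*} [TopologicalSpace S] [ChartedSpace (EuclideanSpace ℝ (Fin n)) S]
  [IsManifold (𝓡 n) ∞ S] {𝒥 : Opens ℝ}
  {E : Fin n → Π p : S, TangentSpace (𝓡 n) p} {η : Fin n → Π p : S, TangentSpace (𝓡 n) p →L[ℝ] ℝ}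
  {V : ℝ → ℝ} {d : FRSInit n S} {t₀ : 𝒥} {v : FRSVars n 𝒥 S}

/-- `v` is a smooth solution of the FRS equations on an interval of positive times, with admissible
initial values `d` at `t₀`. -/
structure IsFRSSolution (E : Fin n → Π p : S, TangentSpace (𝓡 n) p)
    (η : Fin n → Π p : S, TangentSpace (𝓡 n) p →L[ℝ] ℝ) (V : ℝ → ℝ) (d : FRSInit n S) (t₀ : 𝒥)
    (v : FRSVars n 𝒥 S) : Prop where
  two_le : 2 ≤ n
  isFrame : IsSmoothFrame E η
  ordConnected : (𝒥 : Set ℝ).OrdConnected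
  time_pos : ∀ t ∈ 𝒥, (0 : ℝ) < t
  smooth : v.Smooth
  lapse_pos : ∀ x, 0 < v.N x
  solves : v.Solves E V
  admissible : d.Admissible E η t₀
  init : v.HasInit d t₀

namespace FRSVars

/-- The frame `e_0, e_1, …, e_n`. -/
def stFrame (v : FRSVars n 𝒥 S) (E : Fin n → Π p : S, TangentSpace (𝓡 n) p) :
    Option (Fin n) → Π x : 𝒥 × S, TangentSpace (stModel n) x
  | none => v.e0
  | some I => v.frame E I

/-- The coframe `N dt, ω^1, …, ω^n`. -/
def stCoframe (v : FRSVars n 𝒥 S) (η : Fin n → Π p : S, TangentSpace (𝓡 n) p →L[ℝ] ℝ) :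
    Option (Fin n) → Π x : 𝒥 × S, TangentSpace (stModel n) x →L[ℝ] ℝ
  | none => fun x => v.N x • dt x
  | some I => v.coframe η I

end FRSVars

namespace IsFRSSolution

theorem inv_time_contMDiff (h : IsFRSSolution E η V d t₀ v) :
    ContMDiff (stModel n) 𝓘(ℝ, ℝ) ∞ (fun x : 𝒥 × S => (x.1 : ℝ)⁻¹) := by
  intro x
  have h1 : ContMDiffAt 𝓘(ℝ, ℝ) 𝓘(ℝ, ℝ) ∞ (fun s : ℝ => s⁻¹) (x.1 : ℝ) :=
    (contDiffAt_inv ℝ (h.time_pos _ x.1.2).ne').contMDiffAt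
  exact h1.comp x (contMDiff_time x)

theorem mdiff {f : 𝒥 × S → ℝ} (hf : ContMDiff (stModel n) 𝓘(ℝ, ℝ) ∞ f) (x : 𝒥 × S) :
    MDifferentiableAt (stModel n) 𝓘(ℝ, ℝ) f x := (hf x).mdifferentiableAt (by simp)

theorem k_symm (h : IsFRSSolution E η V d t₀ v) (I J : Fin n) (x : 𝒥 × S) :
    v.k I J x = v.k J I x := by
  have hγs : ∀ K I J, v.γs K I J = v.γs K J I := fun K I J => by
    funext x; simp only [FRSVars.γs, add_comm]
  have := FRSVars.eq_zero_of_d0 (ι := Fin n × Fin n) h.smooth h.lapse_pos h.ordConnected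
    (A := fun a b x => if a = b then -(x.1 : ℝ)⁻¹ else 0)
    (y := fun a x => v.k a.1 a.2 x - v.k a.2 a.1 x) (t₀ := t₀)
    (fun a b => by
      split_ifs
      · exact h.inv_time_contMDiff.continuous.neg
      · exact continuous_const)
    (fun a => (h.smooth.k _ _).sub (h.smooth.k _ _))
    (fun a x => by
      rw [FRSVars.d0, fieldDeriv_sub (mdiff (h.smooth.k _ _) x) (mdiff (h.smooth.k _ _) x)]
      change v.d0 _ x - v.d0 _ x = _
      rw [h.solves.k_eq, h.solves.k_eq]
      have e1 : ∀ K, v.γs K a.2 a.1 = v.γs K a.1 a.2 := fun K => hγs K _ _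
      have e2 : ∀ K L, v.γs a.2 K L x * v.γs a.1 K L x = v.γs a.1 K L x * v.γs a.2 K L x :=
        fun K L => mul_comm _ _
      have e3 : ∀ K L, v.γ K L a.2 x * v.γ K L a.1 x = v.γ K L a.1 x * v.γ K L a.2 x :=
        fun K L => mul_comm _ _
      have e4 : ∀ K, v.dI E a.2 (v.γ a.1 K K) x + v.dI E a.1 (v.γ a.2 K K) x =
        v.dI E a.1 (v.γ a.2 K K) x + v.dI E a.2 (v.γ a.1 K K) x := fun K => add_comm _ _
      simp only [e1, e2, e3, e4, eq_comm (a := a.2)]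
      simp only [ite_mul, zero_mul, Finset.sum_ite_eq, Finset.mem_univ, if_true]
      ring)
    (fun a p => by simp only [h.init.k, h.admissible.k_symm a.1 a.2, sub_self]) (I, J) x
  exact sub_eq_zero.1 this

theorem om_mul_e (h : IsFRSSolution E η V d t₀ v) (I J : Fin n) (x : 𝒥 × S) :
    ∑ i, v.om I i x * v.e J i x = if I = J then 1 else 0 := by
  have hs : ∀ I J, ContMDiff (stModel n) 𝓘(ℝ, ℝ) ∞ (fun x => ∑ i, v.om I i x * v.e J i x) :=
    fun I J => contMDiff_finsetSum fun i _ => (h.smooth.om I i).mul (h.smooth.e J i)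
  have := FRSVars.eq_zero_of_d0 (ι := Fin n × Fin n) h.smooth h.lapse_pos h.ordConnected
    (A := fun a b x => (if a.2 = b.2 then v.k a.1 b.1 x else 0)
      - if a.1 = b.1 then v.k a.2 b.2 x else 0)
    (y := fun a x => ∑ i, v.om a.1 i x * v.e a.2 i x - if a.1 = a.2 then 1 else 0) (t₀ := t₀)
    (fun a b => by
      refine Continuous.sub ?_ ?_ <;> split_ifs <;>
        first | exact (h.smooth.k _ _).continuous | exact continuous_const)
    (fun a => (hs _ _).sub contMDiff_const)
    (fun a x => by
      rw [FRSVars.d0, fieldDeriv_sub (mdiff (hs _ _) x) (mdiff contMDiff_const x),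
        fieldDeriv_const, sub_zero, fieldDeriv_sum (f := fun i y => v.om a.1 i y * v.e a.2 i y)
          fun i _ =>
          mdiff ((h.smooth.om _ i).mul (h.smooth.e _ i)) x]
      simp only [fieldDeriv_mul (mdiff (h.smooth.om _ _) x) (mdiff (h.smooth.e _ _) x)]
      change ∑ i, (v.om a.1 i x * v.d0 (v.e a.2 i) x + v.e a.2 i x * v.d0 (v.om a.1 i) x) = _
      simp only [h.solves.frame_eq, h.solves.coframe_eq, Fintype.sum_prod_type, sub_mul, ite_mul,
        zero_mul, Finset.sum_sub_distrib, Finset.sum_ite_eq, Finset.mem_univ, if_true, mul_sub,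
        mul_ite, mul_one, mul_zero, Finset.sum_add_distrib, mul_neg, Finset.sum_neg_distrib,
        Finset.mul_sum]
      have c1 : ∀ I : Fin n, ∑ J, (if I = J then ∑ K, ∑ i, v.k a.2 K x * (v.om J i x * v.e K i x)
          else 0) = ∑ K, ∑ i, v.k a.2 K x * (v.om I i x * v.e K i x) := by
        intro I; simp
      have e1 : ∑ i, ∑ J, v.om a.1 i x * (v.k a.2 J x * v.e J i x) =
          ∑ J, ∑ i, v.k a.2 J x * (v.om a.1 i x * v.e J i x) := by
        rw [Finset.sum_comm]
        exact Finset.sum_congr rfl fun _ _ => Finset.sum_congr rfl fun _ _ => by ring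
      have e2 : ∑ i, ∑ J, v.e a.2 i x * (v.k a.1 J x * v.om J i x) =
          ∑ J, ∑ i, v.k a.1 J x * (v.om J i x * v.e a.2 i x) := by
        rw [Finset.sum_comm]
        exact Finset.sum_congr rfl fun _ _ => Finset.sum_congr rfl fun _ _ => by ring
      rw [e1, e2]
      simp
      rw [h.k_symm a.1 a.2]
      ring)
    (fun a p => by
      have h1 : ∑ i, d.om a.1 i p * d.e a.2 i p = if a.1 = a.2 then 1 else 0 := by
        rw [← h.admissible.coframe p a.1 a.2, FRSInit.coframe, sum_apply]
        refine Finset.sum_congr rfl fun i _ => ?_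
        rw [smul_apply, FRSInit.frame, h.isFrame.coframe_sum p (fun i => d.e a.2 i p) i,
          smul_eq_mul]
      simp only [h.init.om, h.init.e, h1, sub_self]) (I, J) x
  exact sub_eq_zero.1 this

theorem contMDiff_slice {f : 𝒥 × S → ℝ} (hf : ContMDiff (stModel n) 𝓘(ℝ, ℝ) ∞ f) (t : 𝒥) :
    ContMDiff (𝓡 n) 𝓘(ℝ, ℝ) ∞ (fun p => f (t, p)) :=
  hf.comp (contMDiff_const.prodMk contMDiff_id)

theorem isSmoothFrame_slice (h : IsFRSSolution E η V d t₀ v) (t : 𝒥) :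
    IsSmoothFrame (v.sliceFrame E t) (v.sliceCoframe η t) :=
  h.isFrame.changeOfFrame (e := fun I i p => v.e I i (t, p)) (om := fun I i p => v.om I i (t, p))
    (fun I i => contMDiff_slice (h.smooth.e I i) t) (fun I J p => h.om_mul_e I J (t, p))

theorem frame_eq_sum (I : Fin n) :
    v.frame E I = fun x => ∑ i, v.e I i x • sliceIncl x (E i x.2) := by
  funext x
  rw [FRSVars.frame, FRSVars.sliceFrame, map_sum]
  simp only [map_smul]

theorem contMDiff_inv_lapse (h : IsFRSSolution E η V d t₀ v) :
    ContMDiff (stModel n) 𝓘(ℝ, ℝ) ∞ (fun x => (v.N x)⁻¹) := by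
  intro x
  have h1 : ContMDiffAt 𝓘(ℝ, ℝ) 𝓘(ℝ, ℝ) ∞ (fun s : ℝ => s⁻¹) (v.N x) :=
    (contDiffAt_inv ℝ (h.lapse_pos x).ne').contMDiffAt
  exact h1.comp x (h.smooth.N x)

theorem isSmoothFrame (h : IsFRSSolution E η V d t₀ v) :
    IsSmoothFrame (v.stFrame E) (v.stCoframe η) where
  smooth
    | none => isSmoothField_partialT.smul h.contMDiff_inv_lapse
    | some I => by
      change IsSmoothField _ (v.frame E I)
      rw [frame_eq_sum]
      exact IsSmoothField.sum fun i _ =>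
        (isSmoothField_sliceIncl (h.isFrame.smooth i)).smul (h.smooth.e I i)
  dual x a b := by
    have hs := (h.isSmoothFrame_slice x.1).dual x.2
    cases a <;> cases b <;> simp [FRSVars.stFrame, FRSVars.stCoframe, FRSVars.e0, FRSVars.frame,
      FRSVars.coframe, dt_sliceIncl, dt_partialT, spaceProj_partialT, spaceProj_sliceIncl, hs,
      (h.lapse_pos x).ne']
  expand x u := by
    rw [Fintype.sum_option]
    conv_rhs => rw [← tangent_decomp x u, ← (h.isSmoothFrame_slice x.1).expand x.2 (spaceProj x u),
      map_sum]
    simp only [map_smul]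
    congr 1
    simp only [FRSVars.stFrame, FRSVars.stCoframe, FRSVars.e0, smul_apply, smul_smul, smul_eq_mul]
    rw [mul_right_comm, mul_inv_cancel₀ (h.lapse_pos x).ne', one_mul]

end IsFRSSolution

end Solution

section StructureFunctions

open Filter Topology VectorField

variable {n : ℕ} {S : Type*} [TopologicalSpace S] [ChartedSpace (EuclideanSpace ℝ (Fin n)) S]
  [IsManifold (𝓡 n) ∞ S] {𝒥 : Opens ℝ}
  {E : Fin n → Π p : S, TangentSpace (𝓡 n) p} {η : Fin n → Π p : S, TangentSpace (𝓡 n) p →L[ℝ] ℝ}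
  {V : ℝ → ℝ} {d : FRSInit n S} {t₀ : 𝒥} {v : FRSVars n 𝒥 S}

namespace IsFRSSolution

theorem smooth_frame (h : IsFRSSolution E η V d t₀ v) (I : Fin n) :
    IsSmoothField (stModel n) (v.frame E I) := h.isSmoothFrame.smooth (some I)

theorem mlieBracket_partialT_frame (h : IsFRSSolution E η V d t₀ v) (I : Fin n) (x : 𝒥 × S) :
    mlieBracket (stModel n) partialT (v.frame E I) x =
      ∑ J, (-(v.N x * v.k I J x)) • v.frame E J x := by
  rw [frame_eq_sum, mlieBracket_smul_sum_right (fun i _ => mdiff (h.smooth.e I i) x)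
    (fun i _ => (isSmoothField_sliceIncl (h.isFrame.smooth i)).mdifferentiableAt x)]
  simp only [mlieBracket_partialT_sliceIncl h.isFrame, smul_zero, add_zero,
    FRSVars.fieldDeriv_partialT h.lapse_pos, h.solves.frame_eq, frame_eq_sum, Finset.smul_sum,
    smul_smul]
  rw [Finset.sum_comm]
  refine Finset.sum_congr rfl fun i _ => ?_
  rw [← Finset.sum_smul]
  congr 1
  rw [mul_neg, Finset.mul_sum, ← Finset.sum_neg_distrib]
  exact Finset.sum_congr rfl fun J _ => by ring

theorem dI_inv_lapse (h : IsFRSSolution E η V d t₀ v) (I : Fin n) (x : 𝒥 × S) :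
    v.dI E I (fun y => (v.N y)⁻¹) x = -((v.N x)⁻¹ * ((v.N x)⁻¹ * v.dI E I v.N x)) := by
  have hN := (h.lapse_pos x).ne'
  have h1 := fieldDeriv_mul (X := v.frame E I) (mdiff h.smooth.N x) (mdiff h.contMDiff_inv_lapse x)
  have h2 : (fun y => v.N y * (v.N y)⁻¹) = fun _ => (1 : ℝ) :=
    funext fun y => mul_inv_cancel₀ (h.lapse_pos y).ne'
  rw [h2, fieldDeriv_const] at h1
  change 0 = v.N x * v.dI E I (fun y => (v.N y)⁻¹) x + (v.N x)⁻¹ * v.dI E I v.N x at h1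
  field_simp
  field_simp at h1
  linarith

theorem mlieBracket_e0_frame (h : IsFRSSolution E η V d t₀ v) (I : Fin n) (x : 𝒥 × S) :
    mlieBracket (stModel n) v.e0 (v.frame E I) x =
      ((v.N x)⁻¹ * v.dI E I v.N x) • v.e0 x + ∑ J, (-v.k I J x) • v.frame E J x := by
  have : CompleteSpace (ℝ × EuclideanSpace ℝ (Fin n)) := FiniteDimensional.complete ℝ _
  have h1 := mlieBracket_smul_left (W := v.frame E I) (mdiff h.contMDiff_inv_lapse x)
    ((isSmoothField_partialT (S := S) (𝒥 := 𝒥) (n := n)).mdifferentiableAt x)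
  have h2 : v.e0 = (fun x => (v.N x)⁻¹) • (partialT : Π x : 𝒥 × S, TangentSpace (stModel n) x) :=
    rfl
  rw [h2, h1, h.mlieBracket_partialT_frame]
  have h3 := h.dI_inv_lapse I x
  rw [FRSVars.dI, fieldDeriv] at h3
  rw [h3, Finset.smul_sum]
  have hN := (h.lapse_pos x).ne'
  congr 1
  · rw [Pi.smul_apply', smul_smul, neg_neg, mul_comm]
  · refine Finset.sum_congr rfl fun J _ => ?_
    rw [smul_smul]
    congr 1
    field_simp

theorem structFun_none_some_some (h : IsFRSSolution E η V d t₀ v) (I J : Fin n) (x : 𝒥 × S) :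
    structFun (v.stFrame E) (v.stCoframe η) none (some I) (some J) x = -v.k I J x := by
  rw [structFun]
  have := h.mlieBracket_e0_frame I x
  change mlieBracket (stModel n) (v.stFrame E none) (v.stFrame E (some I)) x =
    _ • v.stFrame E none x + ∑ J, _ • v.stFrame E (some J) x at this
  rw [this]
  simp [h.isSmoothFrame.dual x]

theorem structFun_none_some_none (h : IsFRSSolution E η V d t₀ v) (I : Fin n) (x : 𝒥 × S) :
    structFun (v.stFrame E) (v.stCoframe η) none (some I) none x =
      (v.N x)⁻¹ * v.dI E I v.N x := by
  rw [structFun]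
  have := h.mlieBracket_e0_frame I x
  change mlieBracket (stModel n) (v.stFrame E none) (v.stFrame E (some I)) x =
    _ • v.stFrame E none x + ∑ J, _ • v.stFrame E (some J) x at this
  rw [this]
  simp [h.isSmoothFrame.dual x]

theorem structFun_some_some_none (h : IsFRSSolution E η V d t₀ v) (I J : Fin n) (x : 𝒥 × S) :
    structFun (v.stFrame E) (v.stCoframe η) (some I) (some J) none x = 0 := by
  have := dt_mlieBracket h.isFrame (h.smooth_frame I) (h.smooth_frame J) (r := 0) (s := 0)
    (fun x => dt_sliceIncl x _) (fun x => dt_sliceIncl x _) x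
  change v.N x • dt x (mlieBracket (stModel n) (v.frame E I) (v.frame E J) x) = 0
  rw [this, smul_zero]

theorem structFun_self (a c : Option (Fin n)) (x : 𝒥 × S) :
    structFun (v.stFrame E) (v.stCoframe η) a a c x = 0 := by
  have := IsSmoothFrame.structFun_swap (F := v.stFrame E) (θ := v.stCoframe η) a a c x
  linarith

/-- The evolution of the structure functions of `(e_I)`, from the Jacobi identity. -/
theorem d0_structFun (h : IsFRSSolution E η V d t₀ v) (I J K : Fin n) (x : 𝒥 × S) :
    v.d0 (structFun (v.stFrame E) (v.stCoframe η) (some I) (some J) (some K)) x =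
      -((v.N x)⁻¹ * (v.dI E I (fun y => v.N y * v.k J K y) x
        - v.dI E J (fun y => v.N y * v.k I K y) x))
      - (∑ L, v.k I L x * structFun (v.stFrame E) (v.stCoframe η) (some L) (some J) (some K) x)
      - (∑ L, v.k J L x * structFun (v.stFrame E) (v.stCoframe η) (some I) (some L) (some K) x)
      + ∑ L, v.k K L x * structFun (v.stFrame E) (v.stCoframe η) (some I) (some J) (some L) x := by
  have hJ := h.isSmoothFrame.jacobi none (some I) (some J) (some K) x
  have hf : ∀ I J, structFun (v.stFrame E) (v.stCoframe η) none (some I) (some J) =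
      fun x => -v.k I J x := fun I J => funext fun x => h.structFun_none_some_some I J x
  have hs : ∀ J, structFun (v.stFrame E) (v.stCoframe η) (some J) none (some K) x = v.k J K x := by
    intro J
    rw [IsSmoothFrame.structFun_swap, h.structFun_none_some_some, neg_neg]
  simp only [Fintype.sum_option, h.structFun_some_some_none, structFun_self, hf, hs,
    h.structFun_none_some_none, fieldDeriv_neg, zero_mul, zero_add] at hJ
  change v.d0 (structFun (v.stFrame E) (v.stCoframe η) (some I) (some J) (some K)) x + _ =
    -(-v.dI E J (v.k I K) x + _) + (-v.dI E I (v.k J K) x + _) at hJ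
  have hm : ∀ I J K, v.dI E I (fun y => v.N y * v.k J K y) x =
      v.N x * v.dI E I (v.k J K) x + v.k J K x * v.dI E I v.N x :=
    fun I J K => fieldDeriv_mul (mdiff h.smooth.N x) (mdiff (h.smooth.k J K) x)
  have e1 : ∑ L, -v.k I L x * structFun (v.stFrame E) (v.stCoframe η) (some J) (some L) (some K) x =
      ∑ L, v.k I L x * structFun (v.stFrame E) (v.stCoframe η) (some L) (some J) (some K) x := by
    refine Finset.sum_congr rfl fun L _ => ?_
    rw [IsSmoothFrame.structFun_swap]
    ring
  have e2 : ∑ L, structFun (v.stFrame E) (v.stCoframe η) (some I) (some J) (some L) x * -v.k L K x =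
      -∑ L, v.k K L x * structFun (v.stFrame E) (v.stCoframe η) (some I) (some J) (some L) x := by
    rw [← Finset.sum_neg_distrib]
    refine Finset.sum_congr rfl fun L _ => ?_
    rw [h.k_symm K L]
    ring
  have e3 : ∑ L, -v.k J L x * structFun (v.stFrame E) (v.stCoframe η) (some I) (some L) (some K) x =
      -∑ L, v.k J L x * structFun (v.stFrame E) (v.stCoframe η) (some I) (some L) (some K) x := by
    rw [← Finset.sum_neg_distrib]
    exact Finset.sum_congr rfl fun L _ => by ring
  rw [e1, e2, e3] at hJ
  rw [hm, hm]
  have hN := (h.lapse_pos x).ne'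
  have e4 : (v.N x)⁻¹ * (v.N x * v.dI E I (v.k J K) x + v.k J K x * v.dI E I v.N x
      - (v.N x * v.dI E J (v.k I K) x + v.k I K x * v.dI E J v.N x)) =
      v.dI E I (v.k J K) x + (v.N x)⁻¹ * v.dI E I v.N x * v.k J K x
      - (v.dI E J (v.k I K) x + (v.N x)⁻¹ * v.dI E J v.N x * v.k I K x) := by
    field_simp
  rw [e4]
  linarith

/-- The functions `γ` are the structure functions of `(e_I)`. -/
theorem γ_eq_structFun (h : IsFRSSolution E η V d t₀ v) (I J K : Fin n) (x : 𝒥 × S) :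
    v.γ I J K x = structFun (v.stFrame E) (v.stCoframe η) (some I) (some J) (some K) x := by
  set c := fun I J K => structFun (v.stFrame E) (v.stCoframe η) (some I) (some J) (some K) with hc
  have hcs : ∀ I J K, ContMDiff (stModel n) 𝓘(ℝ, ℝ) ∞ (c I J K) :=
    fun I J K => h.isSmoothFrame.contMDiff_structFun _ _ _
  have := FRSVars.eq_zero_of_d0 (ι := Fin n × Fin n × Fin n) h.smooth h.lapse_pos h.ordConnected
    (A := fun a b x => (if a.2.2 = b.2.2 then if a.1 = b.1 then -v.k a.2.1 b.2.1 x else 0 else 0)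
      - (if a.2.2 = b.2.2 then if a.2.1 = b.2.1 then v.k a.1 b.1 x else 0 else 0)
      + if a.2.1 = b.2.1 then if a.1 = b.1 then v.k a.2.2 b.2.2 x else 0 else 0)
    (y := fun a x => v.γ a.1 a.2.1 a.2.2 x - c a.1 a.2.1 a.2.2 x) (t₀ := t₀)
    (fun a b => by
      refine (Continuous.sub ?_ ?_).add ?_ <;> split_ifs <;>
        first | exact (h.smooth.k _ _).continuous | exact (h.smooth.k _ _).continuous.neg
              | exact continuous_const)
    (fun a => (h.smooth.γ _ _ _).sub (hcs _ _ _))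
    (fun a x => by
      obtain ⟨I, J, K⟩ := a
      rw [FRSVars.d0, fieldDeriv_sub (mdiff (h.smooth.γ _ _ _) x) (mdiff (hcs _ _ _) x)]
      change v.d0 _ x - v.d0 _ x = _
      rw [h.solves.γ_eq, h.d0_structFun]
      simp only [Fintype.sum_prod_type, add_mul, sub_mul, ite_mul, zero_mul,
        Finset.sum_sub_distrib, Finset.sum_add_distrib, Finset.sum_ite_eq, Finset.mem_univ, if_true,
        mul_sub]
      simp only [Finset.sum_ite_irrel, Finset.sum_const_zero, Finset.sum_ite_eq, Finset.mem_univ,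
        if_true, neg_mul, Finset.sum_neg_distrib]
      ring)
    (fun a p => by
      obtain ⟨I, J, K⟩ := a
      have hfr : ∀ I, v.sliceFrame E t₀ I = d.frame E I := by
        intro I; funext p; simp only [FRSVars.sliceFrame, FRSInit.frame, h.init.e]
      have hco : v.sliceCoframe η t₀ K p = d.coframe η K p := by
        simp only [FRSVars.sliceCoframe, FRSInit.coframe, h.init.om]
      have hb := spaceProj_mlieBracket_sliceIncl h.isFrame (h.smooth_frame I) (h.smooth_frame J)
        t₀ p ((h.isSmoothFrame_slice t₀).smooth I) ((h.isSmoothFrame_slice t₀).smooth J)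
      have : c I J K (t₀, p) = v.sliceCoframe η t₀ K p (mlieBracket (𝓡 n) (v.sliceFrame E t₀ I)
          (v.sliceFrame E t₀ J) p) := congrArg (v.sliceCoframe η t₀ K p) hb
      rw [this, h.init.γ, h.admissible.γ_eq, hco, hfr, hfr, sub_self]) (I, J, K) x
  exact sub_eq_zero.1 this

theorem γ_swap (h : IsFRSSolution E η V d t₀ v) (I J K : Fin n) (x : 𝒥 × S) :
    v.γ I J K x = -v.γ J I K x := by
  rw [h.γ_eq_structFun, h.γ_eq_structFun, IsSmoothFrame.structFun_swap]

end IsFRSSolution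

end StructureFunctions

section MeanCurvature

open Filter Topology VectorField

variable {n : ℕ} {S : Type*} [TopologicalSpace S] [ChartedSpace (EuclideanSpace ℝ (Fin n)) S]
  [IsManifold (𝓡 n) ∞ S] {𝒥 : Opens ℝ}
  {E : Fin n → Π p : S, TangentSpace (𝓡 n) p} {η : Fin n → Π p : S, TangentSpace (𝓡 n) p →L[ℝ] ℝ}
  {V : ℝ → ℝ} {d : FRSInit n S} {t₀ : 𝒥} {v : FRSVars n 𝒥 S}

namespace IsFRSSolution

theorem smooth_γs (h : IsFRSSolution E η V d t₀ v) (I J K : Fin n) :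
    ContMDiff (stModel n) 𝓘(ℝ, ℝ) ∞ (v.γs I J K) := by
  have : v.γs I J K = fun x => (v.γ I J K x + v.γ I K J x) * (1 / 2) := by
    funext x; rw [FRSVars.γs]; ring
  rw [this]
  exact ((h.smooth.γ I J K).add (h.smooth.γ I K J)).mul contMDiff_const

theorem dI_lapse_mul (h : IsFRSSolution E η V d t₀ v) {f : 𝒥 × S → ℝ}
    (hf : ContMDiff (stModel n) 𝓘(ℝ, ℝ) ∞ f) (I : Fin n) (x : 𝒥 × S) :
    v.dI E I (fun y => v.N y * f y) x = v.N x * v.dI E I f x + f x * v.dI E I v.N x :=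
  fieldDeriv_mul (mdiff h.smooth.N x) (mdiff hf x)

theorem fieldDeriv_inv_time (h : IsFRSSolution E η V d t₀ v)
    (X : Π x : 𝒥 × S, TangentSpace (stModel n) x) (x : 𝒥 × S) :
    fieldDeriv (stModel n) X (fun y : 𝒥 × S => (y.1 : ℝ)⁻¹) x
      = -(((x.1 : ℝ)⁻¹) ^ 2 * dt x (X x)) := by
  have hN := (h.time_pos _ x.1.2).ne'
  have h1 := fieldDeriv_mul (X := X) (mdiff contMDiff_time x) (mdiff h.inv_time_contMDiff x)
  have h2 : (fun y : 𝒥 × S => (y.1 : ℝ) * (y.1 : ℝ)⁻¹) = fun _ => (1 : ℝ) :=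
    funext fun y => mul_inv_cancel₀ (h.time_pos _ y.1.2).ne'
  have h3 : fieldDeriv (stModel n) X (fun y : 𝒥 × S => (y.1 : ℝ)) x = dt x (X x) :=
    mvfderiv_time x _
  rw [h2, fieldDeriv_const, h3] at h1
  field_simp
  field_simp at h1
  linarith

/-- The part of the evolution equation of the mean curvature that is quadratic in `γ`. -/
theorem sum_γs_mul_γs (x : 𝒥 × S) :
    ∑ I, ∑ K, ∑ L, v.γs I K L x * v.γs I K L x
      - 1 / 4 * ∑ I, ∑ K, ∑ L, v.γ K L I x * v.γ K L I x =
    1 / 4 * ∑ I, ∑ J, ∑ K, v.γ I J K x * (v.γ I J K x + 2 * v.γ I K J x) := by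
  have e1 : ∑ I, ∑ K, ∑ L, v.γ K L I x * v.γ K L I x =
      ∑ I, ∑ K, ∑ L, v.γ I K L x * v.γ I K L x := by
    rw [Finset.sum_comm]
    exact Finset.sum_congr rfl fun K _ => Finset.sum_comm
  have e2 : ∀ I, ∑ K, ∑ L, v.γ I L K x * v.γ I L K x = ∑ K, ∑ L, v.γ I K L x * v.γ I K L x :=
    fun I => Finset.sum_comm
  have e3 : ∑ I, ∑ K, ∑ L, v.γs I K L x * v.γs I K L x =
      1 / 4 * ∑ I, ∑ K, ∑ L, v.γ I K L x * v.γ I K L x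
        + 1 / 4 * ∑ I, ∑ K, ∑ L, v.γ I L K x * v.γ I L K x
        + 1 / 2 * ∑ I, ∑ K, ∑ L, v.γ I K L x * v.γ I L K x := by
    simp only [Finset.mul_sum, ← Finset.sum_add_distrib]
    refine Finset.sum_congr rfl fun I _ => Finset.sum_congr rfl fun K _ =>
      Finset.sum_congr rfl fun L _ => ?_
    rw [FRSVars.γs]
    ring
  have e4 : ∑ I, ∑ J, ∑ K, v.γ I J K x * (v.γ I J K x + 2 * v.γ I K J x) =
      ∑ I, ∑ K, ∑ L, v.γ I K L x * v.γ I K L x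
        + 2 * ∑ I, ∑ K, ∑ L, v.γ I K L x * v.γ I L K x := by
    simp only [Finset.mul_sum, ← Finset.sum_add_distrib]
    refine Finset.sum_congr rfl fun I _ => Finset.sum_congr rfl fun K _ =>
      Finset.sum_congr rfl fun L _ => ?_
    ring
  rw [e1, e3, e4]
  simp only [e2]
  ring

theorem d0_trace (h : IsFRSSolution E η V d t₀ v) (x : 𝒥 × S) :
    ∑ I, v.d0 (v.k I I) x =
      ((x.1 : ℝ)⁻¹) ^ 2 * (1 - (v.N x)⁻¹) - (x.1 : ℝ)⁻¹ * ∑ I, v.k I I x := by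
  have hN := (h.lapse_pos x).ne'
  have hn : (n : ℝ) - 1 ≠ 0 := by
    have : (2 : ℝ) ≤ n := by exact_mod_cast h.two_le
    intro h0
    linarith
  have hγs : ∀ K I, v.γs K I I = v.γ K I I := fun K I => by
    funext y; simp only [FRSVars.γs]; ring
  have hsum2 : ∑ I, ∑ K, v.dI E K (fun y => v.N y * v.γ K I I y) x =
      v.N x * ∑ I, ∑ J, v.dI E I (v.γ I J J) x + ∑ I, ∑ J, v.γ J I I x * v.dI E J v.N x := by
    have : ∑ I, ∑ J, v.dI E I (v.γ I J J) x = ∑ I, ∑ J, v.dI E J (v.γ J I I) x := Finset.sum_comm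
    rw [this, Finset.mul_sum, ← Finset.sum_add_distrib]
    refine Finset.sum_congr rfl fun I _ => ?_
    rw [Finset.mul_sum, ← Finset.sum_add_distrib]
    exact Finset.sum_congr rfl fun K _ => h.dI_lapse_mul (h.smooth.γ K I I) K x
  have hsum3 : ∑ I, ∑ K, ∑ L, v.γ K L L x * v.γ K I I x =
      ∑ I, ∑ J, ∑ K, v.γ I J J x * v.γ I K K x := by
    rw [Finset.sum_comm]
    exact Finset.sum_congr rfl fun K _ => Finset.sum_congr rfl fun I _ =>
      Finset.sum_congr rfl fun L _ => mul_comm _ _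
  have hl := h.solves.lapse x
  have hq := sum_γs_mul_γs (v := v) x
  simp only [h.solves.k_eq, hγs, Finset.sum_add_distrib, Finset.sum_sub_distrib,
    ← Finset.mul_sum, if_true, Finset.sum_const, Finset.card_univ, Fintype.card_fin,
    nsmul_eq_mul, hsum2, hsum3, add_self_div_two]
  rw [hl, FRSVars.scalExpr]
  rw [sub_eq_iff_eq_add] at hq
  rw [hq]
  simp only [← Finset.mul_sum]
  generalize (x.1 : ℝ)⁻¹ = τ
  field_simp
  ring

theorem trace_k (h : IsFRSSolution E η V d t₀ v) (x : 𝒥 × S) :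
    ∑ I, v.k I I x = (x.1 : ℝ)⁻¹ := by
  have hs : ContMDiff (stModel n) 𝓘(ℝ, ℝ) ∞ (fun x => ∑ I, v.k I I x) :=
    contMDiff_finsetSum fun I _ => h.smooth.k I I
  have := FRSVars.eq_zero_of_d0 (ι := Unit) h.smooth h.lapse_pos h.ordConnected
    (A := fun _ _ x => -(x.1 : ℝ)⁻¹) (y := fun _ x => ∑ I, v.k I I x - (x.1 : ℝ)⁻¹) (t₀ := t₀)
    (fun _ _ => h.inv_time_contMDiff.continuous.neg)
    (fun _ => hs.sub h.inv_time_contMDiff)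
    (fun _ x => by
      rw [FRSVars.d0, fieldDeriv_sub (mdiff hs x) (mdiff h.inv_time_contMDiff x),
        h.fieldDeriv_inv_time, fieldDeriv_sum fun I _ => mdiff (h.smooth.k I I) x]
      change ∑ I, v.d0 (v.k I I) x - _ = _
      have : dt x (v.e0 x) = (v.N x)⁻¹ := by
        rw [FRSVars.e0, map_smul, dt_partialT, smul_eq_mul, mul_one]
      rw [h.d0_trace, this]
      simp
      ring)
    (fun _ p => by
      simp only [h.init.k, h.admissible.k_trace, one_div, sub_self]) () x
  exact sub_eq_zero.1 this

end IsFRSSolution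

end MeanCurvature

section SpacetimeConnection

open Filter Topology VectorField

variable {n : ℕ} {S : Type*} [TopologicalSpace S] [ChartedSpace (EuclideanSpace ℝ (Fin n)) S]
  [IsManifold (𝓡 n) ∞ S] {𝒥 : Opens ℝ}
  {E : Fin n → Π p : S, TangentSpace (𝓡 n) p} {η : Fin n → Π p : S, TangentSpace (𝓡 n) p →L[ℝ] ℝ}
  {V : ℝ → ℝ} {d : FRSInit n S} {t₀ : 𝒥} {v : FRSVars n 𝒥 S}

namespace FRSVars

/-- The logarithmic derivative `e_I(ln N)` of the lapse. -/
def dlog (v : FRSVars n 𝒥 S) (E : Fin n → Π p : S, TangentSpace (𝓡 n) p) (I : Fin n)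
    (x : 𝒥 × S) : ℝ :=
  (v.N x)⁻¹ * v.dI E I v.N x

/-- The connection coefficients of the slices: `∇_{e_I} e_J = Γ_IJK e_K` within the slices. -/
def Γ (v : FRSVars n 𝒥 S) (I J K : Fin n) (x : 𝒥 × S) : ℝ :=
  1 / 2 * v.γ I J K x + v.γs K I J x

/-- The coefficients `G b d c = θ^c(∇_{F_b} F_d)` of the Levi-Civita connection in the frame
`e_0, …, e_n`. -/
def coeff (v : FRSVars n 𝒥 S) (E : Fin n → Π p : S, TangentSpace (𝓡 n) p) :
    Option (Fin n) → Option (Fin n) → Option (Fin n) → 𝒥 × S → ℝ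
  | none, none, none => fun _ => 0
  | none, none, some I => v.dlog E I
  | none, some I, none => v.dlog E I
  | none, some _, some _ => fun _ => 0
  | some _, none, none => fun _ => 0
  | some I, none, some J => v.k I J
  | some I, some J, none => v.k I J
  | some I, some J, some K => v.Γ I J K

/-- The signs `(-, +, …, +)` of the metric. -/
def sign : Option (Fin n) → ℝ
  | none => -1
  | some _ => 1

theorem sign_mul_self (a : Option (Fin n)) : sign a * sign a = 1 := by
  cases a <;> simp [sign]

theorem metric_eq (x : 𝒥 × S) (u w : TangentSpace (stModel n) x) :
    v.metric η x u w = ∑ a, sign a * (v.stCoframe η a x u * v.stCoframe η a x w) := by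
  rw [Fintype.sum_option]
  simp only [metric, sign, stCoframe, add_apply, sum_apply,
    ContinuousLinearMap.smulRight_apply, smul_apply, smul_eq_mul, one_mul]
  ring

end FRSVars

namespace IsFRSSolution

theorem smooth_dI (h : IsFRSSolution E η V d t₀ v) {f : 𝒥 × S → ℝ}
    (hf : ContMDiff (stModel n) 𝓘(ℝ, ℝ) ∞ f) (I : Fin n) :
    ContMDiff (stModel n) 𝓘(ℝ, ℝ) ∞ (v.dI E I f) :=
  (h.smooth_frame I).fieldDeriv hf

theorem smooth_dlog (h : IsFRSSolution E η V d t₀ v) (I : Fin n) :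
    ContMDiff (stModel n) 𝓘(ℝ, ℝ) ∞ (v.dlog E I) :=
  h.contMDiff_inv_lapse.mul (h.smooth_dI h.smooth.N I)

theorem smooth_Γ (h : IsFRSSolution E η V d t₀ v) (I J K : Fin n) :
    ContMDiff (stModel n) 𝓘(ℝ, ℝ) ∞ (v.Γ I J K) :=
  (contMDiff_const.mul (h.smooth.γ I J K)).add (h.smooth_γs K I J)

theorem smooth_coeff (h : IsFRSSolution E η V d t₀ v) (a b c : Option (Fin n)) :
    ContMDiff (stModel n) 𝓘(ℝ, ℝ) ∞ (v.coeff E a b c) := by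
  cases a <;> cases b <;> cases c <;>
    first | exact contMDiff_const | exact h.smooth_dlog _ | exact h.smooth.k _ _
          | exact h.smooth_Γ _ _ _

theorem Γ_swap (h : IsFRSSolution E η V d t₀ v) (I J K : Fin n) (x : 𝒥 × S) :
    v.Γ I J K x = -v.Γ I K J x := by
  simp only [FRSVars.Γ, FRSVars.γs]
  rw [h.γ_swap J I K, h.γ_swap J K I, h.γ_swap K I J]
  ring

theorem Γ_sub (h : IsFRSSolution E η V d t₀ v) (I J K : Fin n) (x : 𝒥 × S) :
    v.Γ I J K x - v.Γ J I K x = v.γ I J K x := by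
  simp only [FRSVars.Γ, FRSVars.γs]
  rw [h.γ_swap J I K]
  ring

theorem Γ_self (h : IsFRSSolution E η V d t₀ v) (I J : Fin n) :
    v.Γ I J I = fun x => -v.γ J I I x := by
  funext x
  have := h.γ_swap I I J x
  simp only [FRSVars.Γ, FRSVars.γs]
  rw [h.γ_swap I J I]
  linarith

theorem isLeviCivita (h : IsFRSSolution E η V d t₀ v) :
    IsLeviCivita (stModel n) (v.metric η) (h.isSmoothFrame.connection (v.coeff E)) := by
  refine h.isSmoothFrame.isLeviCivita_connection (ε := FRSVars.sign) (FRSVars.metric_eq)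
    (fun a b c x => ?_) (fun a b c x => ?_)
  · have hs := fun a b c => IsSmoothFrame.structFun_swap (F := v.stFrame E) (θ := v.stCoframe η)
      a b c x
    rcases a with _ | I <;> rcases b with _ | J <;> rcases c with _ | K <;>
      simp only [FRSVars.coeff, structFun_self, h.structFun_none_some_some,
        h.structFun_none_some_none, h.structFun_some_some_none, hs (some _) none, sub_self,
        sub_zero, zero_sub, neg_neg, FRSVars.dlog]
    · rw [h.k_symm I J, sub_self]
    · rw [h.Γ_sub, h.γ_eq_structFun]
  · rcases a with _ | I <;> rcases b with _ | J <;> rcases c with _ | K <;>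
      simp only [FRSVars.coeff, FRSVars.sign, mul_zero, add_zero] <;> try ring1
    rw [h.Γ_swap I J K]
    ring

end IsFRSSolution

end SpacetimeConnection

section SpacetimeRicci

open Filter Topology VectorField

variable {n : ℕ} {S : Type*} [TopologicalSpace S] [ChartedSpace (EuclideanSpace ℝ (Fin n)) S]
  [IsManifold (𝓡 n) ∞ S] {𝒥 : Opens ℝ}
  {E : Fin n → Π p : S, TangentSpace (𝓡 n) p} {η : Fin n → Π p : S, TangentSpace (𝓡 n) p →L[ℝ] ℝ}
  {V : ℝ → ℝ} {d : FRSInit n S} {t₀ : 𝒥} {v : FRSVars n 𝒥 S}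

namespace FRSVars

/-- The components `Ric(F_b, F_d)` of the Ricci curvature in the frame `e_0, …, e_n`. -/
def ric (v : FRSVars n 𝒥 S) (E : Fin n → Π p : S, TangentSpace (𝓡 n) p)
    (η : Fin n → Π p : S, TangentSpace (𝓡 n) p →L[ℝ] ℝ) (b d : Option (Fin n)) (x : 𝒥 × S) : ℝ :=
  ∑ a, frameCurvature (v.stFrame E) (v.stCoframe η) (v.coeff E) a b d a x

theorem fieldDeriv_stFrame_none (f : 𝒥 × S → ℝ) (x : 𝒥 × S) :
    fieldDeriv (stModel n) (v.stFrame E none) f x = v.d0 f x := rfl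

theorem fieldDeriv_stFrame_some (I : Fin n) (f : 𝒥 × S → ℝ) (x : 𝒥 × S) :
    fieldDeriv (stModel n) (v.stFrame E (some I)) f x = v.dI E I f x := rfl

theorem d0_const (r : ℝ) (x : 𝒥 × S) : v.d0 (fun _ => r) x = 0 := fieldDeriv_const r

theorem dI_const (I : Fin n) (r : ℝ) (x : 𝒥 × S) : v.dI E I (fun _ => r) x = 0 :=
  fieldDeriv_const r

end FRSVars

namespace IsFRSSolution

theorem structFun_some_none_some (h : IsFRSSolution E η V d t₀ v) (I J : Fin n) (x : 𝒥 × S) :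
    structFun (v.stFrame E) (v.stCoframe η) (some I) none (some J) x = v.k I J x := by
  rw [IsSmoothFrame.structFun_swap, h.structFun_none_some_some, neg_neg]

theorem structFun_some_none_none (h : IsFRSSolution E η V d t₀ v) (I : Fin n) (x : 𝒥 × S) :
    structFun (v.stFrame E) (v.stCoframe η) (some I) none none x = -v.dlog E I x := by
  rw [IsSmoothFrame.structFun_swap, h.structFun_none_some_none, FRSVars.dlog]

theorem dI_trace (h : IsFRSSolution E η V d t₀ v) (J : Fin n) (x : 𝒥 × S) :
    ∑ I, v.dI E J (v.k I I) x = 0 := by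
  have h1 := fieldDeriv_sum (X := v.frame E J) (s := Finset.univ) (f := fun I => v.k I I)
    fun I _ => mdiff (h.smooth.k I I) x
  have h2 : (fun y => ∑ I, v.k I I y) = fun y => (y.1 : ℝ)⁻¹ := funext h.trace_k
  have h3 : dt x (v.frame E J x) = 0 := dt_sliceIncl x _
  rw [h2, h.fieldDeriv_inv_time, h3, mul_zero, neg_zero] at h1
  exact h1.symm

theorem dI_dlog (h : IsFRSSolution E η V d t₀ v) (I J : Fin n) (x : 𝒥 × S) :
    v.dI E I (v.dlog E J) x =
      (v.N x)⁻¹ * v.dI E I (v.dI E J v.N) x - v.dlog E I x * v.dlog E J x := by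
  have h1 := fieldDeriv_mul (X := v.frame E I) (mdiff h.contMDiff_inv_lapse x)
    (mdiff (h.smooth_dI h.smooth.N J) x)
  change v.dI E I (v.dlog E J) x = (v.N x)⁻¹ * v.dI E I (v.dI E J v.N) x
    + v.dI E J v.N x * v.dI E I (fun y => (v.N y)⁻¹) x at h1
  rw [h1, h.dI_inv_lapse, FRSVars.dlog, FRSVars.dlog]
  ring

/-- `k_IJ A_IJ` vanishes for antisymmetric `A`. -/
theorem sum_k_mul_eq_zero (h : IsFRSSolution E η V d t₀ v) {A : Fin n → Fin n → ℝ}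
    (hA : ∀ I J, A I J = -A J I) (x : 𝒥 × S) : ∑ I, ∑ J, v.k I J x * A I J = 0 := by
  have h1 : ∑ I, ∑ J, v.k I J x * A I J = -∑ I, ∑ J, v.k I J x * A I J := by
    conv_lhs => rw [Finset.sum_comm]
    rw [← Finset.sum_neg_distrib]
    refine Finset.sum_congr rfl fun I _ => ?_
    rw [← Finset.sum_neg_distrib]
    refine Finset.sum_congr rfl fun J _ => ?_
    rw [h.k_symm J I, hA J I]
    ring
  linarith

theorem ric_none_none (h : IsFRSSolution E η V d t₀ v) (x : 𝒥 × S) :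
    v.ric E η none none x = v.d0 v.φ x ^ 2 - 2 / ((n : ℝ) - 1) * V (v.φ x) := by
  have hN := (h.lapse_pos x).ne'
  have hn : (n : ℝ) - 1 ≠ 0 := by
    have : (2 : ℝ) ≤ n := by exact_mod_cast h.two_le
    intro h0
    linarith
  have hd : ∑ I, v.d0 (v.k I I) x = _ := h.d0_trace x
  rw [h.trace_k] at hd
  have hk : ∑ I, ∑ L, v.k I L x * v.k L I x = ∑ I, ∑ L, v.k I L x * v.k I L x :=
    Finset.sum_congr rfl fun I _ => Finset.sum_congr rfl fun L _ => by rw [h.k_symm L I]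
  have hl := h.solves.lapse x
  have hH := h.solves.hamiltonian x
  have ha : ∑ I, ∑ L, v.γ L I I x * v.dlog E L x =
      (v.N x)⁻¹ * ∑ I, ∑ J, v.γ J I I x * v.dI E J v.N x := by
    simp only [Finset.mul_sum, FRSVars.dlog]
    exact Finset.sum_congr rfl fun I _ => Finset.sum_congr rfl fun L _ => by ring
  simp only [FRSVars.ric, Fintype.sum_option, frameCurvature, FRSVars.coeff, structFun_self,
    h.structFun_some_none_some, h.structFun_some_none_none, FRSVars.fieldDeriv_stFrame_none,
    FRSVars.fieldDeriv_stFrame_some, h.Γ_self, FRSVars.d0_const, neg_zero, mul_zero, zero_mul,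
    sub_self, sub_zero, zero_sub, add_zero, zero_add, Finset.sum_const_zero, h.dI_dlog, neg_mul, sub_neg_eq_add]
  have e : ∑ I, ((v.N x)⁻¹ * v.dI E I (v.dI E I v.N) x - v.dlog E I x * v.dlog E I x
        - v.d0 (v.k I I) x
      + (v.dlog E I x * v.dlog E I x + ∑ L, (-(v.γ L I I x * v.dlog E L x) - v.k I L x * v.k L I x)))
      = (v.N x)⁻¹ * ∑ I, v.dI E I (v.dI E I v.N) x - ∑ I, v.d0 (v.k I I) x
        - ∑ I, ∑ L, v.γ L I I x * v.dlog E L x - ∑ I, ∑ L, v.k I L x * v.k L I x := by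
    simp only [Finset.sum_add_distrib, Finset.sum_sub_distrib, Finset.sum_neg_distrib,
      Finset.mul_sum]
    ring
  refine e.trans ?_
  rw [hd, hk, ha, hl]
  have hs : ∑ I, ∑ J, v.k I J x * v.k I J x = v.scalExpr E x + ((x.1 : ℝ)⁻¹) ^ 2 -
    ((v.d0 v.φ x) ^ 2 + (∑ I, v.dI E I v.φ x * v.dI E I v.φ x) + 2 * V (v.φ x)) := by linarith
  rw [hs]
  generalize (x.1 : ℝ)⁻¹ = τ
  field_simp
  ring

theorem ric_some_none (h : IsFRSSolution E η V d t₀ v) (J : Fin n) (x : 𝒥 × S) :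
    v.ric E η (some J) none x = v.d0 v.φ x * v.dI E J v.φ x := by
  have hm := h.solves.momentum J x
  have hz := h.sum_k_mul_eq_zero (A := fun L I => v.Γ J L I x) (fun L I => h.Γ_swap J L I x) x
  simp only [FRSVars.ric, Fintype.sum_option, frameCurvature, FRSVars.coeff,
    h.structFun_none_some_none, h.structFun_none_some_some, h.structFun_some_some_none,
    ← h.γ_eq_structFun, FRSVars.fieldDeriv_stFrame_none,
    FRSVars.fieldDeriv_stFrame_some, h.Γ_self, FRSVars.d0_const, FRSVars.dI_const, neg_zero, mul_zero, zero_mul,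
    sub_self, sub_zero, zero_sub, zero_add, neg_mul]
  have e1 : ∑ I, (v.dI E I (v.k J I) x - v.dI E J (v.k I I) x
      + ∑ L, (-(v.γ L I I x * v.k J L x) - v.Γ J L I x * v.k I L x - v.γ I J L x * v.k L I x)) =
      ∑ I, v.dI E I (v.k I J) x - ∑ I, v.dI E J (v.k I I) x
        - ∑ L, ∑ I, v.γ L I I x * v.k L J x - ∑ L, ∑ I, v.k L I x * v.Γ J L I x
        - ∑ I, ∑ L, v.γ I J L x * v.k I L x := by
    rw [Finset.sum_comm (f := fun L I => v.γ L I I x * v.k L J x),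
      Finset.sum_comm (f := fun L I => v.k L I x * v.Γ J L I x)]
    simp only [← Finset.sum_sub_distrib]
    refine Finset.sum_congr rfl fun I _ => ?_
    have hk : v.k J I = v.k I J := funext fun y => h.k_symm J I y
    rw [hk]
    simp only [Finset.sum_sub_distrib, h.k_symm J, h.k_symm I, Finset.sum_neg_distrib]
    simp only [mul_comm (v.Γ _ _ _ x)]
    ring
  have e2 : ∀ I, v.dlog E I x * v.k J I x - v.k J I x * v.dlog E I x = 0 := fun I => by ring
  simp only [e2, Finset.sum_const_zero, zero_add]
  rw [e1, h.dI_trace, hz, hm]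
  ring

theorem ric_none_some (h : IsFRSSolution E η V d t₀ v) (J : Fin n) (x : 𝒥 × S) :
    v.ric E η none (some J) x = v.d0 v.φ x * v.dI E J v.φ x := by
  have hN := (h.lapse_pos x).ne'
  have hm := h.solves.momentum J x
  have hγ : ∑ I, v.d0 (v.γ J I I) x = ∑ I, v.dI E I (v.k I J) x - ∑ I, v.dI E J (v.k I I) x
      - (∑ I, v.k I I x) * v.dlog E J x + ∑ I, v.k I J x * v.dlog E I x
      - ∑ L, ∑ I, v.γ L I I x * v.k L J x := by
    have hz : ∑ I, ∑ L, v.k I L x * v.γ J L I x = ∑ I, ∑ L, v.k I L x * v.γ J I L x := by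
      rw [Finset.sum_comm]
      exact Finset.sum_congr rfl fun L _ => Finset.sum_congr rfl fun I _ => by rw [h.k_symm L I]
    have : ∀ I, v.d0 (v.γ J I I) x = v.dI E I (v.k I J) x - v.dI E J (v.k I I) x
        - v.k I I x * v.dlog E J x + v.k I J x * v.dlog E I x - ∑ L, v.γ L I I x * v.k L J x
        - ∑ L, v.k I L x * v.γ J L I x + ∑ L, v.k I L x * v.γ J I L x := by
      intro I
      have hk : v.k J I = v.k I J := funext fun y => h.k_symm J I y
      rw [h.solves.γ_eq, h.dI_lapse_mul (h.smooth.k _ _), h.dI_lapse_mul (h.smooth.k _ _), hk]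
      simp only [FRSVars.dlog, h.k_symm J, mul_comm (v.k _ J x) (v.γ _ _ _ x)]
      field_simp
      ring
    simp only [this, Finset.sum_add_distrib, Finset.sum_sub_distrib, hz, Finset.sum_mul]
    rw [Finset.sum_comm (f := fun L I => v.γ L I I x * v.k L J x)]
    ring
  have hΓ : ∑ I, ∑ L, v.k I L x * v.Γ L J I x = ∑ I, ∑ L, v.γ I J L x * v.k I L x := by
    have hz := h.sum_k_mul_eq_zero (A := fun I L => 1 / 2 * v.γ I L J x)
      (fun I L => by rw [h.γ_swap I L J]; ring) x
    have h2 : ∑ I, ∑ L, v.k I L x * v.γ L J I x = ∑ I, ∑ L, v.γ I J L x * v.k I L x := by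
      rw [Finset.sum_comm]
      exact Finset.sum_congr rfl fun L _ => Finset.sum_congr rfl fun I _ => by
        rw [h.k_symm I L, mul_comm]
    have h3 : ∑ I, ∑ L, v.k I L x * v.Γ L J I x =
        1 / 2 * ∑ I, ∑ L, v.k I L x * v.γ L J I x + 1 / 2 * ∑ I, ∑ L, v.γ I J L x * v.k I L x
        + ∑ I, ∑ L, v.k I L x * (1 / 2 * v.γ I L J x) := by
      simp only [Finset.mul_sum, ← Finset.sum_add_distrib]
      refine Finset.sum_congr rfl fun I _ => Finset.sum_congr rfl fun L _ => ?_
      rw [FRSVars.Γ, FRSVars.γs]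
      ring
    rw [h3, hz, h2]
    ring
  simp only [FRSVars.ric, Fintype.sum_option, frameCurvature, FRSVars.coeff, structFun_self,
    h.structFun_some_none_some, h.structFun_some_none_none, FRSVars.fieldDeriv_stFrame_none,
    FRSVars.fieldDeriv_stFrame_some, h.Γ_self, FRSVars.dI_const, neg_zero, mul_zero, zero_mul,
    sub_self, sub_zero, zero_sub, add_zero, zero_add, Finset.sum_const_zero]
  have hneg : ∀ I, v.d0 (fun y => -v.γ J I I y) x = -v.d0 (v.γ J I I) x :=
    fun I => fieldDeriv_neg
  have e : ∑ I, (v.d0 (v.γ J I I) x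
      + (v.k I I x * v.dlog E J x - v.dlog E I x * v.k I J x - ∑ L, v.k I L x * v.Γ L J I x)) =
      ∑ I, v.d0 (v.γ J I I) x + (∑ I, v.k I I x) * v.dlog E J x - ∑ I, v.k I J x * v.dlog E I x
        - ∑ I, ∑ L, v.k I L x * v.Γ L J I x := by
    simp only [Finset.sum_mul, ← Finset.sum_add_distrib, ← Finset.sum_sub_distrib]
    exact Finset.sum_congr rfl fun I _ => by ring
  simp only [hneg, neg_neg, Finset.sum_neg_distrib, ← sub_eq_add_neg]
  rw [e, hγ, hΓ, h.dI_trace, hm]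
  ring

theorem commutator_lapse (h : IsFRSSolution E η V d t₀ v) (I J : Fin n) (x : 𝒥 × S) :
    v.dI E I (v.dI E J v.N) x - v.dI E J (v.dI E I v.N) x = ∑ L, v.γ I J L x * v.dI E L v.N x := by
  have := h.isSmoothFrame.commutator (some I) (some J) (h.smooth.N x)
  rw [Fintype.sum_option, h.structFun_some_some_none, zero_mul, zero_add] at this
  simp only [← h.γ_eq_structFun] at this
  exact this

/-- The contracted Jacobi identity for `(e_I)`. -/
theorem jacobi_trace (h : IsFRSSolution E η V d t₀ v) (I J : Fin n) (x : 𝒥 × S) :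
    ∑ K, v.dI E K (v.γ I J K) x = ∑ K, v.dI E J (v.γ I K K) x - ∑ K, v.dI E I (v.γ J K K) x
      + ∑ K, ∑ L, v.γ L K K x * v.γ I J L x := by
  have hγ : ∀ I J K, structFun (v.stFrame E) (v.stCoframe η) (some I) (some J) (some K) =
      v.γ I J K := fun I J K => funext fun y => (h.γ_eq_structFun I J K y).symm
  have hK : ∀ K, v.dI E K (v.γ I J K) x + ∑ L, v.γ I J L x * v.γ K L K x =
      -(v.dI E J (v.γ K I K) x + ∑ L, v.γ K I L x * v.γ J L K x)
        + (v.dI E I (v.γ K J K) x + ∑ L, v.γ K J L x * v.γ I L K x) := by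
    intro K
    have := h.isSmoothFrame.jacobi (some K) (some I) (some J) (some K) x
    simpa only [Fintype.sum_option, h.structFun_some_some_none, zero_mul, zero_add, hγ,
      FRSVars.fieldDeriv_stFrame_some] using this
  have hd : ∀ A I K, v.dI E A (v.γ K I K) x = -v.dI E A (v.γ I K K) x := by
    intro A I K
    have : v.γ K I K = fun y => -v.γ I K K y := funext fun y => h.γ_swap K I K y
    rw [this]
    exact fieldDeriv_neg
  have hq : ∑ K, ∑ L, v.γ K I L x * v.γ J L K x = ∑ K, ∑ L, v.γ K J L x * v.γ I L K x := by
    rw [Finset.sum_comm]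
    refine Finset.sum_congr rfl fun L _ => Finset.sum_congr rfl fun K _ => ?_
    rw [h.γ_swap K I L, h.γ_swap J L K]
    ring
  have hl : ∑ K, ∑ L, v.γ I J L x * v.γ K L K x = -∑ K, ∑ L, v.γ L K K x * v.γ I J L x := by
    simp only [← Finset.sum_neg_distrib]
    refine Finset.sum_congr rfl fun K _ => Finset.sum_congr rfl fun L _ => ?_
    rw [h.γ_swap K L K]
    ring
  have hsum := Finset.sum_congr (rfl : (Finset.univ : Finset (Fin n)) = Finset.univ)
    fun K _ => hK K
  simp only [hd, Finset.sum_add_distrib, Finset.sum_neg_distrib, neg_add, neg_neg, hq, hl] at hsum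
  linarith

/-- The terms of the spatial components of the Ricci curvature that are quadratic in `γ`. -/
theorem ric_quadratic (h : IsFRSSolution E η V d t₀ v) (I J : Fin n) (x : 𝒥 × S) :
    ∑ K, ∑ L, (v.γs I K L x * v.γs J K L x - 1 / 4 * (v.γ K L I x * v.γ K L J x)
      - v.Γ I L K x * v.Γ K J L x - v.γ K I L x * v.Γ L J K x) = 0 := by
  set f := fun K L => v.γs I K L x * v.γs J K L x - 1 / 4 * (v.γ K L I x * v.γ K L J x)
      - v.Γ I L K x * v.Γ K J L x - v.γ K I L x * v.Γ L J K x with hf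
  have h1 : ∀ K L, f K L + f L K = 0 := by
    intro K L
    simp only [hf, FRSVars.Γ, FRSVars.γs]
    rw [h.γ_swap K I L, h.γ_swap L I K, h.γ_swap L K I, h.γ_swap L K J, h.γ_swap K J L,
      h.γ_swap L J K]
    ring
  have h2 : ∑ K, ∑ L, f K L = ∑ K, ∑ L, f L K := Finset.sum_comm
  have h3 : ∑ K, ∑ L, (f K L + f L K) = 0 := by simp [h1]
  simp only [Finset.sum_add_distrib] at h3
  linarith

theorem ric_some_some (h : IsFRSSolution E η V d t₀ v) (I J : Fin n) (x : 𝒥 × S) :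
    v.ric E η (some I) (some J) x = v.dI E I v.φ x * v.dI E J v.φ x
      + 2 / ((n : ℝ) - 1) * V (v.φ x) * (if I = J then 1 else 0) := by
  have hN := (h.lapse_pos x).ne'
  have hQ := h.ric_quadratic I J x
  have hJ := h.jacobi_trace I J x
  have hC := h.commutator_lapse I J x
  have hk := h.solves.k_eq I J x
  have hdΓ : ∀ K, v.dI E K (v.Γ I J K) x =
      1 / 2 * v.dI E K (v.γ I J K) x + v.dI E K (v.γs K I J) x := by
    intro K
    have h1 := fieldDeriv_add (X := v.frame E K)
      (mdiff (contMDiff_const.mul (h.smooth.γ I J K) (f := fun _ => (1 / 2 : ℝ))) x)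
      (mdiff (h.smooth_γs K I J) x)
    have h2 := fieldDeriv_mul (X := v.frame E K) (mdiff (contMDiff_const (c := (1 / 2 : ℝ))) x)
      (mdiff (h.smooth.γ I J K) x)
    rw [fieldDeriv_const, mul_zero, add_zero] at h2
    exact h1.trans (congrArg (· + _) h2)
  have hneg : ∀ K, v.dI E I (fun y => -v.γ J K K y) x = -v.dI E I (v.γ J K K) x :=
    fun K => fieldDeriv_neg
  simp only [FRSVars.ric, Fintype.sum_option, frameCurvature, FRSVars.coeff,
    h.structFun_none_some_none, h.structFun_none_some_some, h.structFun_some_some_none,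
    ← h.γ_eq_structFun, FRSVars.fieldDeriv_stFrame_none,
    FRSVars.fieldDeriv_stFrame_some, h.Γ_self,
    mul_zero, zero_mul, sub_zero, zero_sub, neg_mul, sub_neg_eq_add, hdΓ, hneg, h.dI_dlog]
  have e : v.d0 (v.k I J) x
      - ((v.N x)⁻¹ * v.dI E I (v.dI E J v.N) x - v.dlog E I x * v.dlog E J x)
      + (-((v.N x)⁻¹ * v.dI E I v.N x * v.dlog E J x)
        + ∑ L, (v.dlog E L x * v.Γ I J L x + v.k I L x * v.k L J x))
      + ∑ K, (1 / 2 * v.dI E K (v.γ I J K) x + v.dI E K (v.γs K I J) x + v.dI E I (v.γ J K K) x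
        + (v.k K K x * v.k I J x - v.k I K x * v.k K J x
        + ∑ L, (-(v.γ L K K x * v.Γ I J L x) - v.Γ I L K x * v.Γ K J L x
          - v.γ K I L x * v.Γ L J K x))) =
      v.d0 (v.k I J) x - (v.N x)⁻¹ * v.dI E I (v.dI E J v.N) x
      + ∑ L, v.dlog E L x * v.Γ I J L x + 1 / 2 * ∑ K, v.dI E K (v.γ I J K) x
      + ∑ K, v.dI E K (v.γs K I J) x + ∑ K, v.dI E I (v.γ J K K) x
      + (∑ K, v.k K K x) * v.k I J x
      - ∑ K, ∑ L, v.γ L K K x * v.Γ I J L x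
      - ∑ K, ∑ L, (v.Γ I L K x * v.Γ K J L x + v.γ K I L x * v.Γ L J K x) := by
    have : ∀ K, ∑ L, (-(v.γ L K K x * v.Γ I J L x) - v.Γ I L K x * v.Γ K J L x
          - v.γ K I L x * v.Γ L J K x) = -∑ L, v.γ L K K x * v.Γ I J L x
          - ∑ L, (v.Γ I L K x * v.Γ K J L x + v.γ K I L x * v.Γ L J K x) := by
      intro K
      rw [← Finset.sum_neg_distrib, ← Finset.sum_sub_distrib]
      exact Finset.sum_congr rfl fun L _ => by ring
    simp only [this]
    simp only [Finset.sum_add_distrib, Finset.sum_sub_distrib, Finset.sum_neg_distrib,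
      Finset.mul_sum, Finset.sum_mul, FRSVars.dlog]
    ring
  refine e.trans ?_
  have f1 : (v.N x)⁻¹ * ∑ K, v.dI E K (fun y => v.N y * v.γs K I J y) x =
      ∑ K, v.dI E K (v.γs K I J) x + ∑ K, v.dlog E K x * v.γs K I J x := by
    rw [Finset.mul_sum, ← Finset.sum_add_distrib]
    refine Finset.sum_congr rfl fun K _ => ?_
    rw [h.dI_lapse_mul (h.smooth_γs K I J), FRSVars.dlog]
    field_simp
  have f2 : ∑ K, (v.dI E I (v.γ J K K) x + v.dI E J (v.γ I K K) x) / 2 =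
      1 / 2 * ∑ K, v.dI E I (v.γ J K K) x + 1 / 2 * ∑ K, v.dI E J (v.γ I K K) x := by
    simp only [Finset.mul_sum, ← Finset.sum_add_distrib]
    exact Finset.sum_congr rfl fun K _ => by ring
  have f3 : ∑ L, v.dlog E L x * v.Γ I J L x =
      1 / 2 * ((v.N x)⁻¹ * ∑ L, v.γ I J L x * v.dI E L v.N x)
        + ∑ L, v.dlog E L x * v.γs L I J x := by
    simp only [Finset.mul_sum, ← Finset.sum_add_distrib]
    refine Finset.sum_congr rfl fun L _ => ?_
    rw [FRSVars.Γ, FRSVars.dlog]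
    ring
  have f4 : ∑ K, ∑ L, v.γ L K K x * v.Γ I J L x =
      1 / 2 * ∑ K, ∑ L, v.γ L K K x * v.γ I J L x + ∑ K, ∑ L, v.γ K L L x * v.γs K I J x := by
    rw [Finset.sum_comm (f := fun K L => v.γ K L L x * v.γs K I J x)]
    simp only [Finset.mul_sum, ← Finset.sum_add_distrib]
    refine Finset.sum_congr rfl fun K _ => Finset.sum_congr rfl fun L _ => ?_
    rw [FRSVars.Γ]
    ring
  have f5 : ∑ K, ∑ L, (v.Γ I L K x * v.Γ K J L x + v.γ K I L x * v.Γ L J K x) =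
      ∑ K, ∑ L, v.γs I K L x * v.γs J K L x - 1 / 4 * ∑ K, ∑ L, v.γ K L I x * v.γ K L J x := by
    rw [eq_comm, ← sub_eq_zero, ← hQ]
    simp only [Finset.mul_sum, ← Finset.sum_sub_distrib]
    exact Finset.sum_congr rfl fun K _ => Finset.sum_congr rfl fun L _ => by ring
  rw [hk, f1, f2, f3, f4, f5, h.trace_k, hJ, ← hC]
  ring

/-- The Einstein equations. -/
theorem ricci_connection (h : IsFRSSolution E η V d t₀ v)
    {Y Z : Π x : 𝒥 × S, TangentSpace (stModel n) x} (hY : IsSmoothField (stModel n) Y)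
    (hZ : IsSmoothField (stModel n) Z) (x : 𝒥 × S) :
    ricci (stModel n) (h.isSmoothFrame.connection (v.coeff E)) Y Z x =
      fieldDeriv (stModel n) Y v.φ x * fieldDeriv (stModel n) Z v.φ x
        + 2 / ((n : ℝ) - 1) * V (v.φ x) * v.metric η x (Y x) (Z x) := by
  have hφ : ∀ Y : Π x : 𝒥 × S, TangentSpace (stModel n) x, fieldDeriv (stModel n) Y v.φ x =
      ∑ b, v.stCoframe η b x (Y x) * fieldDeriv (stModel n) (v.stFrame E b) v.φ x := by
    intro Y
    rw [fieldDeriv, ← h.isSmoothFrame.expand x (Y x), map_sum]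
    simp only [map_smul, smul_eq_mul, fieldDeriv, h.isSmoothFrame.expand x]
  have hR : ∀ b c, v.ric E η b c x = fieldDeriv (stModel n) (v.stFrame E b) v.φ x *
      fieldDeriv (stModel n) (v.stFrame E c) v.φ x
      + 2 / ((n : ℝ) - 1) * V (v.φ x) * (if b = c then FRSVars.sign b else 0) := by
    intro b c
    rcases b with _ | I <;> rcases c with _ | J <;>
      simp only [h.ric_none_none, h.ric_none_some, h.ric_some_none, h.ric_some_some,
        FRSVars.fieldDeriv_stFrame_none, FRSVars.fieldDeriv_stFrame_some, FRSVars.sign,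
        Option.some.injEq, if_true, reduceCtorEq, if_false] <;> ring
  rw [h.isSmoothFrame.ricci_eq h.smooth_coeff hY hZ x, FRSVars.metric_eq, hφ Y, hφ Z]
  change ∑ b, ∑ c, v.stCoframe η b x (Y x) * v.stCoframe η c x (Z x) * v.ric E η b c x = _
  simp only [hR, mul_add, Finset.sum_add_distrib, mul_ite, mul_zero, Finset.sum_ite_eq,
    Finset.mem_univ, if_true]
  congr 1
  · rw [Finset.sum_mul_sum]
    exact Finset.sum_congr rfl fun b _ => Finset.sum_congr rfl fun c _ => by ring
  · rw [Finset.mul_sum]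
    exact Finset.sum_congr rfl fun b _ => by ring

/-- The scalar field equation. -/
theorem waveOp_connection (h : IsFRSSolution E η V d t₀ v) (x : 𝒥 × S) :
    waveOp (stModel n) (v.metric η) (h.isSmoothFrame.connection (v.coeff E)) v.φ x =
      deriv V (v.φ x) := by
  rw [h.isSmoothFrame.waveOp_eq FRSVars.sign_mul_self FRSVars.metric_eq h.smooth.φ x]
  simp only [Fintype.sum_option, FRSVars.coeff, FRSVars.sign, h.Γ_self,
    FRSVars.fieldDeriv_stFrame_none, FRSVars.fieldDeriv_stFrame_some, one_mul, neg_mul, zero_mul,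
    zero_add, mul_neg, Finset.sum_add_distrib, Finset.sum_neg_distrib]
  have h1 : v.d0 (fieldDeriv (stModel n) (v.stFrame E none) v.φ) x = _ := h.solves.φ_eq x
  have h2 : ∀ I, v.dI E I (fieldDeriv (stModel n) (v.stFrame E (some I)) v.φ) x =
      v.dI E I (v.dI E I v.φ) x := fun _ => rfl
  have h3 : ∑ I, v.k I I x * v.d0 v.φ x = (x.1 : ℝ)⁻¹ * v.d0 v.φ x := by
    rw [← Finset.sum_mul, h.trace_k]
  have h4 : ∑ I, v.dlog E I x * v.dI E I v.φ x =
      (v.N x)⁻¹ * (∑ I, v.dI E I v.N x * v.dI E I v.φ x) := by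
    rw [Finset.mul_sum]
    exact Finset.sum_congr rfl fun I _ => by rw [FRSVars.dlog]; ring
  simp only [h1, h2, h3, h4]
  ring

end IsFRSSolution

end SpacetimeRicci

section SliceGeometry

open Filter Topology VectorField

variable {n : ℕ} {S : Type*} [TopologicalSpace S] [ChartedSpace (EuclideanSpace ℝ (Fin n)) S]
  [IsManifold (𝓡 n) ∞ S] {𝒥 : Opens ℝ}
  {E : Fin n → Π p : S, TangentSpace (𝓡 n) p} {η : Fin n → Π p : S, TangentSpace (𝓡 n) p →L[ℝ] ℝ}
  {V : ℝ → ℝ} {d : FRSInit n S} {t₀ : 𝒥} {v : FRSVars n 𝒥 S}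

theorem fieldDeriv_log {EM : Type*} [NormedAddCommGroup EM] [NormedSpace ℝ EM]
    {HM : Type*} [TopologicalSpace HM] {I : ModelWithCorners ℝ EM HM}
    {M : Type*} [TopologicalSpace M] [ChartedSpace HM M] {X : Π x : M, TangentSpace I x}
    {f : M → ℝ} {x : M} (hf : MDifferentiableAt I 𝓘(ℝ, ℝ) f x) (hx : f x ≠ 0) :
    fieldDeriv I X (fun y => Real.log (f y)) x = (f x)⁻¹ * fieldDeriv I X f x := by
  have h1 : HasMFDerivAt 𝓘(ℝ, ℝ) 𝓘(ℝ, ℝ) Real.log (f x)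
      (ContinuousLinearMap.toSpanSingleton ℝ (f x)⁻¹ : ℝ →L[ℝ] ℝ) :=
    (Real.hasDerivAt_log hx).hasFDerivAt.hasMFDerivAt
  have h2 := (h1.comp x hf.hasMFDerivAt).mfderiv
  have h3 : fieldDeriv I X (fun y => Real.log (f y)) x =
    mfderiv I 𝓘(ℝ, ℝ) (Real.log ∘ f) x (X x) := rfl
  rw [h3, h2]
  change fieldDeriv I X f x * (f x)⁻¹ = _
  rw [mul_comm]

/-- The trace of `k_IJ θ^I θ^J` with respect to `θ^I θ^I`, for a coframe `θ`. -/
theorem metricTrace_eq {e : Fin n → Π p : S, TangentSpace (𝓡 n) p}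
    {θ : Fin n → Π p : S, TangentSpace (𝓡 n) p →L[ℝ] ℝ} (hF : IsSmoothFrame e θ) (p : S)
    (k : Fin n → Fin n → ℝ) :
    metricTrace (𝓡 n) (x := p) (fun u w => ∑ I, θ I p u * θ I p w)
      (fun u w => ∑ I, ∑ J, k I J * θ I p u * θ J p w) = ∑ I, k I I := by
  set b := tangentBasis (𝓡 n) p with hb
  let P : Matrix _ (Fin n) ℝ := Matrix.of fun a I => θ I p (b a)
  let Q : Matrix (Fin n) _ ℝ := Matrix.of fun I a => b.repr (e I p) a
  have hQP : Q * P = 1 := by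
    ext I J
    have h1 : ∑ a, b.repr (e I p) a * θ J p (b a) = θ J p (e I p) := by
      conv_rhs => rw [← b.sum_repr (e I p), map_sum]
      simp
    rw [Matrix.mul_apply, Matrix.one_apply]
    refine h1.trans ((hF.dual p J I).trans ?_)
    simp only [eq_comm]
  have hPQ : P * Q = 1 := by
    ext a c
    have h1 : ∑ I, θ I p (b a) * b.repr (e I p) c = b.repr (b a) c := by
      conv_rhs => rw [← hF.expand p (b a), map_sum]
      simp
    rw [Matrix.mul_apply, Matrix.one_apply]
    refine h1.trans ?_
    rw [b.repr_self, Finsupp.single_apply]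
  have hH : (Matrix.of fun a c => ∑ I, θ I p (b a) * θ I p (b c)) = P * P.transpose := by
    ext a c
    simp [Matrix.mul_apply, P]
  have hK : (Matrix.of fun a c => ∑ I, ∑ J, k I J * θ I p (b a) * θ J p (b c)) =
      P * Matrix.of k * P.transpose := by
    ext a c
    simp only [Matrix.mul_apply, P, Matrix.of_apply, Matrix.transpose_apply, Finset.sum_mul]
    rw [Finset.sum_comm]
    exact Finset.sum_congr rfl fun I _ => Finset.sum_congr rfl fun J _ => by ring
  have hinv : (P * P.transpose)⁻¹ = Q.transpose * Q := by
    refine Matrix.inv_eq_left_inv ?_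
    rw [Matrix.mul_assoc, ← Matrix.mul_assoc Q, hQP, Matrix.one_mul, ← Matrix.transpose_mul, hPQ,
      Matrix.transpose_one]
  rw [metricTrace, hH, hK, hinv]
  have : Q.transpose * Q * (P * Matrix.of k * P.transpose) =
      Q.transpose * (Matrix.of k * P.transpose) := by
    rw [Matrix.mul_assoc, Matrix.mul_assoc P, ← Matrix.mul_assoc Q P, hQP, Matrix.one_mul]
  rw [this, Matrix.trace_mul_comm, Matrix.mul_assoc, ← Matrix.transpose_mul, hQP,
    Matrix.transpose_one, Matrix.mul_one]
  rfl

namespace IsFRSSolution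

theorem stCoframe_none_sliceIncl (x : 𝒥 × S) (u : TangentSpace (𝓡 n) x.2) :
    v.stCoframe η none x (sliceIncl x u) = 0 := by
  change v.N x • dt x (sliceIncl x u) = 0
  rw [dt_sliceIncl, smul_zero]

theorem stCoframe_some_sliceIncl (I : Fin n) (x : 𝒥 × S) (u : TangentSpace (𝓡 n) x.2) :
    v.stCoframe η (some I) x (sliceIncl x u) = v.sliceCoframe η x.1 I x.2 u := rfl

theorem firstForm_eq (x : 𝒥 × S) (u w : TangentSpace (𝓡 n) x.2) :
    firstForm (v.metric η) x u w =
      ∑ I, v.sliceCoframe η x.1 I x.2 u * v.sliceCoframe η x.1 I x.2 w := by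
  rw [firstForm, FRSVars.metric_eq, Fintype.sum_option]
  simp [stCoframe_none_sliceIncl, stCoframe_some_sliceIncl, FRSVars.sign]

theorem firstForm_pos (h : IsFRSSolution E η V d t₀ v) (x : 𝒥 × S) (u : TangentSpace (𝓡 n) x.2)
    (hu : u ≠ 0) : 0 < firstForm (v.metric η) x u u := by
  rw [firstForm_eq]
  refine lt_of_le_of_ne (Finset.sum_nonneg fun I _ => mul_self_nonneg _) fun h0 => hu ?_
  rw [eq_comm, Finset.sum_eq_zero_iff_of_nonneg fun I _ => mul_self_nonneg _] at h0
  refine (h.isSmoothFrame_slice x.1).ext_coframe fun I => ?_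
  rw [map_zero]
  exact mul_self_eq_zero.1 (h0 I (Finset.mem_univ I))

theorem metric_frame (h : IsFRSSolution E η V d t₀ v) (x : 𝒥 × S) (b : Option (Fin n))
    (w : TangentSpace (stModel n) x) :
    v.metric η x (v.stFrame E b x) w = FRSVars.sign b * v.stCoframe η b x w := by
  rw [FRSVars.metric_eq, Finset.sum_eq_single b]
  · rw [h.isSmoothFrame.dual x, if_pos rfl, one_mul]
  · intro a _ hab
    rw [h.isSmoothFrame.dual x, if_neg hab, zero_mul, mul_zero]
  · simp

theorem isLorentzMetric (h : IsFRSSolution E η V d t₀ v) :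
    IsLorentzMetric (stModel n) (v.metric η) where
  symm x u w := by
    rw [FRSVars.metric_eq, FRSVars.metric_eq]
    exact Finset.sum_congr rfl fun a _ => by ring
  smooth X Y hX hY := by
    simp only [FRSVars.metric_eq]
    exact contMDiff_finsetSum fun a _ => contMDiff_const.mul
      (ContMDiff.mul (fun x => h.isSmoothFrame.contMDiffAt_coframe (hX x) a)
        (fun x => h.isSmoothFrame.contMDiffAt_coframe (hY x) a))
  signature x := by
    refine ⟨v.stFrame E none x, ?_, fun w hw hw0 => ?_⟩
    · rw [h.metric_frame, h.isSmoothFrame.dual x, if_pos rfl, FRSVars.sign]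
      norm_num
    · rw [h.metric_frame, FRSVars.sign, neg_one_mul, neg_eq_zero] at hw
      rw [FRSVars.metric_eq, Fintype.sum_option, hw, mul_zero, mul_zero, zero_add]
      simp only [FRSVars.sign, one_mul]
      refine lt_of_le_of_ne (Finset.sum_nonneg fun I _ => mul_self_nonneg _) fun h0 => hw0 ?_
      rw [eq_comm, Finset.sum_eq_zero_iff_of_nonneg fun I _ => mul_self_nonneg _] at h0
      refine h.isSmoothFrame.ext_coframe fun a => ?_
      rw [map_zero]
      cases a with
      | none => exact hw
      | some I => exact mul_self_eq_zero.1 (h0 I (Finset.mem_univ I))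

theorem isFutureUnitNormal (h : IsFRSSolution E η V d t₀ v) :
    IsFutureUnitNormal (v.metric η) v.e0 := by
  intro x
  refine ⟨?_, fun u => ?_, ?_⟩
  · refine (h.metric_frame x none _).trans ?_
    change _ * v.stCoframe η none x (v.stFrame E none x) = _
    rw [h.isSmoothFrame.dual x, if_pos rfl, FRSVars.sign, mul_one]
  · refine (h.metric_frame x none _).trans ?_
    rw [stCoframe_none_sliceIncl, mul_zero]
  · rw [FRSVars.e0, map_smul, dt_partialT, smul_eq_mul, mul_one]
    exact inv_pos.2 (h.lapse_pos x)

theorem secondForm_eq (h : IsFRSSolution E η V d t₀ v) (x : 𝒥 × S)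
    (u w : TangentSpace (𝓡 n) x.2) :
    secondForm (v.metric η) (h.isSmoothFrame.connection (v.coeff E)) v.e0 x u w =
      ∑ I, ∑ J, v.k I J x * v.sliceCoframe η x.1 I x.2 u * v.sliceCoframe η x.1 J x.2 w := by
  have hc : ∀ J, v.stCoframe η (some J) x
      (h.isSmoothFrame.connection (v.coeff E) v.e0 x (sliceIncl x u)) =
      ∑ I, v.k I J x * v.sliceCoframe η x.1 I x.2 u := by
    intro J
    refine (h.isSmoothFrame.coframe_connection_frame x (sliceIncl x u) (some J) none).trans ?_
    rw [Fintype.sum_option, stCoframe_none_sliceIncl, mul_zero, zero_add]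
    rfl
  rw [secondForm, FRSVars.metric_eq, Fintype.sum_option, stCoframe_none_sliceIncl, mul_zero,
    mul_zero, zero_add]
  simp only [hc, FRSVars.sign, one_mul, Finset.sum_mul, stCoframe_some_sliceIncl]
  exact Finset.sum_comm

theorem meanCurvature_eq (h : IsFRSSolution E η V d t₀ v) (x : 𝒥 × S) :
    meanCurvature (v.metric η) (h.isSmoothFrame.connection (v.coeff E)) v.e0 x = 1 / (x.1 : ℝ) := by
  have h1 : firstForm (v.metric η) x = fun u w =>
      ∑ I, v.sliceCoframe η x.1 I x.2 u * v.sliceCoframe η x.1 I x.2 w :=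
    funext fun u => funext fun w => firstForm_eq x u w
  have h2 : secondForm (v.metric η) (h.isSmoothFrame.connection (v.coeff E)) v.e0 x = fun u w =>
      ∑ I, ∑ J, v.k I J x * v.sliceCoframe η x.1 I x.2 u * v.sliceCoframe η x.1 J x.2 w :=
    funext fun u => funext fun w => h.secondForm_eq x u w
  rw [meanCurvature, h1, h2, metricTrace_eq (h.isSmoothFrame_slice x.1) x.2 fun I J => v.k I J x,
    h.trace_k, one_div]

theorem covD_e0_frame (h : IsFRSSolution E η V d t₀ v) (I : Fin n) (x : 𝒥 × S) :
    covD (stModel n) (h.isSmoothFrame.connection (v.coeff E)) v.e0 (v.frame E I) x =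
      fieldDeriv (stModel n) (v.frame E I) (fun y => Real.log (v.N y)) x • v.e0 x := by
  rw [fieldDeriv_log (mdiff h.smooth.N x) (h.lapse_pos x).ne']
  refine h.isSmoothFrame.ext_coframe fun c => ?_
  refine (h.isSmoothFrame.coframe_covD_frame x none c (some I)).trans ?_
  rw [map_smul]
  change _ = _ • v.stCoframe η c x (v.stFrame E none x)
  rw [h.isSmoothFrame.dual x]
  cases c with
  | none => rw [if_pos rfl, smul_eq_mul, mul_one]; rfl
  | some J => rw [if_neg (by simp), smul_zero]; rfl

theorem sliceCoframe_init (h : IsFRSSolution E η V d t₀ v) (I : Fin n) :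
    v.sliceCoframe η t₀ I = d.coframe η I := by
  funext p
  simp only [FRSVars.sliceCoframe, FRSInit.coframe, h.init.om]

end IsFRSSolution

end SliceGeometry

section CausalCurves

open Filter Topology

theorem lt_of_deriv_pos_off_finset {f f' : ℝ → ℝ} (hf : Continuous f) (F : Finset ℝ) :
    ∀ {r s : ℝ}, r < s → (∀ z ∈ Set.Ioo r s, z ∉ F → HasDerivAt f (f' z) z ∧ 0 < f' z) →
      f r < f s := by
  induction F using Finset.induction_on with
  | empty =>
    intro r s hrs h
    refine strictMonoOn_of_deriv_pos (convex_Icc r s) hf.continuousOn (fun z hz => ?_)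
      ⟨le_rfl, hrs.le⟩ ⟨hrs.le, le_rfl⟩ hrs
    rw [interior_Icc] at hz
    have := h z hz (Finset.notMem_empty z)
    rw [this.1.deriv]
    exact this.2
  | insert b F hb ih =>
    intro r s hrs h
    by_cases hbrs : b ∈ Set.Ioo r s
    · refine (ih hbrs.1 fun z hz hzF => h z ⟨hz.1, hz.2.trans hbrs.2⟩ ?_).trans
        (ih hbrs.2 fun z hz hzF => h z ⟨hbrs.1.trans hz.1, hz.2⟩ ?_)
      · rw [Finset.mem_insert, not_or]
        exact ⟨hz.2.ne, hzF⟩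
      · rw [Finset.mem_insert, not_or]
        exact ⟨hz.1.ne', hzF⟩
    · refine ih hrs fun z hz hzF => h z hz ?_
      rw [Finset.mem_insert, not_or]
      exact ⟨fun e => hbrs (e ▸ hz), hzF⟩

theorem lt_of_deriv_pos_off_locallyFinite {f f' : ℝ → ℝ} (hf : Continuous f) {B : Set ℝ}
    (hB : ∀ r s : ℝ, (B ∩ Set.Icc r s).Finite) {r s : ℝ} (hrs : r < s)
    (h : ∀ z ∈ Set.Ioo r s, z ∉ B → HasDerivAt f (f' z) z ∧ 0 < f' z) : f r < f s := by
  refine lt_of_deriv_pos_off_finset hf (hB r s).toFinset hrs fun z hz hzB => h z hz fun hb => ?_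
  rw [Set.Finite.mem_toFinset] at hzB
  exact hzB ⟨hb, Set.Ioo_subset_Icc_self hz⟩

theorem tendsto_atTop_of_monotoneOn {f : ℝ → ℝ} (hf : MonotoneOn f (Set.Ici 0)) {C : ℝ}
    (hC : ∀ s, 0 ≤ s → f s ≤ C) : ∃ L, Tendsto f atTop (𝓝 L) := by
  have h1 : Monotone fun s => f (max s 0) := fun r s hrs =>
    hf (Set.mem_Ici.2 (le_max_right r 0)) (Set.mem_Ici.2 (le_max_right s 0))
      (max_le_max_right 0 hrs)
  refine ⟨_, (tendsto_atTop_ciSup h1 ⟨C, ?_⟩).congr' ?_⟩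
  · rintro _ ⟨s, rfl⟩
    exact hC _ (le_max_right s 0)
  · filter_upwards [eventually_ge_atTop 0] with s hs
    rw [max_eq_left hs]

theorem tendsto_atBot_of_monotoneOn {f : ℝ → ℝ} (hf : MonotoneOn f (Set.Iic 0)) {C : ℝ}
    (hC : ∀ s, s ≤ 0 → C ≤ f s) : ∃ L, Tendsto f atBot (𝓝 L) := by
  have h1 : Monotone fun s => f (min s 0) := fun r s hrs =>
    hf (Set.mem_Iic.2 (min_le_right r 0)) (Set.mem_Iic.2 (min_le_right s 0))
      (min_le_min_right 0 hrs)
  refine ⟨_, (tendsto_atBot_ciInf h1 ⟨C, ?_⟩).congr' ?_⟩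
  · rintro _ ⟨s, rfl⟩
    exact hC _ (min_le_right s 0)
  · filter_upwards [eventually_le_atBot 0] with s hs
    rw [min_eq_left hs]

variable {n : ℕ} {S : Type*} [TopologicalSpace S] [ChartedSpace (EuclideanSpace ℝ (Fin n)) S]
  [IsManifold (𝓡 n) ∞ S] {𝒥 : Opens ℝ}

/-- A map into a compact manifold converges if its composition with each smooth function does. -/
theorem exists_tendsto_of_smooth [T2Space S] [CompactSpace S] {α : Type*} {l : Filter α} [l.NeBot]
    {p : α → S} (h : ∀ f : S → ℝ, ContMDiff (𝓡 n) 𝓘(ℝ, ℝ) ∞ f → ∃ L, Tendsto (f ∘ p) l (𝓝 L)) :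
    ∃ q, Tendsto p l (𝓝 q) := by
  obtain ⟨q, hq⟩ := exists_clusterPt_of_compactSpace (map p l)
  refine ⟨q, fun U hU => ?_⟩
  obtain ⟨f, -, hf⟩ := (SmoothBumpFunction.nhds_basis_tsupport (I := 𝓡 n) q).mem_iff.1 hU
  obtain ⟨L, hL⟩ := h f f.contMDiff
  have h1 : MapClusterPt (f q) l (f ∘ p) :=
    MapClusterPt.continuousAt_comp f.continuous.continuousAt hq
  have h2 : f q = L := by
    by_contra hne
    exact hne (eq_of_nhds_neBot (ClusterPt.mono h1 hL))
  rw [f.eq_one] at h2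
  have h3 : ∀ᶠ s in l, 0 < f (p s) := by
    rw [← h2] at hL
    exact hL.eventually (lt_mem_nhds one_pos)
  exact h3.mono fun s hs => hf (subset_tsupport _ hs.ne')

variable {E : Fin n → Π p : S, TangentSpace (𝓡 n) p}
  {η : Fin n → Π p : S, TangentSpace (𝓡 n) p →L[ℝ] ℝ}
  {V : ℝ → ℝ} {d : FRSInit n S} {t₀ : 𝒥} {v : FRSVars n 𝒥 S}

theorem isCompact_timeRange [CompactSpace S] {a b : ℝ} (hab : Set.Icc a b ⊆ 𝒥) :
    IsCompact {x : 𝒥 × S | (x.1 : ℝ) ∈ Set.Icc a b} := by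
  have h1 : IsCompact ((Subtype.val : 𝒥 → ℝ) ⁻¹' Set.Icc a b) :=
    Topology.IsInducing.subtypeVal.isCompact_preimage' isCompact_Icc
      (by rw [Subtype.range_coe]; exact hab)
  have h2 := h1.prod (isCompact_univ (X := S))
  convert h2 using 1
  ext x
  simp

theorem hasDerivAt_comp_curve {f : 𝒥 × S → ℝ} {c : ℝ → 𝒥 × S} {s : ℝ}
    (hf : MDifferentiableAt (stModel n) 𝓘(ℝ, ℝ) f (c s))
    (hc : MDifferentiableAt 𝓘(ℝ, ℝ) (stModel n) c s) :
    HasDerivAt (fun z => f (c z))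
      (mvfderiv (stModel n) f (c s) (mfderiv 𝓘(ℝ, ℝ) (stModel n) c s (1 : ℝ))) s := by
  have key : ∀ (g : ℝ → ℝ) (L : ℝ →L[ℝ] ℝ), HasFDerivAt g L s → HasDerivAt g (L 1) s :=
    fun g L h => h.hasDerivAt
  exact key _ _ (hf.hasMFDerivAt.comp s hc.hasMFDerivAt).hasFDerivAt

namespace IsFRSSolution

theorem dt_pos_of_causal (h : IsFRSSolution E η V d t₀ v) {x : 𝒥 × S}
    {w : TangentSpace (stModel n) x} (hw : v.metric η x w (partialT x) < 0) : 0 < dt x w := by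
  have h1 : v.metric η x w (partialT x) = -(v.N x ^ 2 * dt x w) := by
    rw [h.isLorentzMetric.symm, FRSVars.partialT_eq h.lapse_pos, map_smul, smul_apply]
    have := h.metric_frame x none w
    change v.metric η x (v.e0 x) w = -1 * (v.N x • dt x) w at this
    rw [this, smul_apply, smul_eq_mul, smul_eq_mul]
    ring
  rw [h1, neg_lt_zero] at hw
  exact pos_of_mul_pos_right hw (sq_nonneg _)

theorem abs_coframe_le_of_causal (h : IsFRSSolution E η V d t₀ v) {x : 𝒥 × S}
    {w : TangentSpace (stModel n) x} (hw : v.metric η x w w ≤ 0) (hw' : 0 < dt x w) (I : Fin n) :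
    |v.coframe η I x w| ≤ v.N x * dt x w := by
  rw [FRSVars.metric_eq, Fintype.sum_option] at hw
  have h1 : v.stCoframe η none x w = v.N x * dt x w := rfl
  have h2 : v.coframe η I x w * v.coframe η I x w ≤
      ∑ J, v.coframe η J x w * v.coframe η J x w :=
    Finset.single_le_sum (f := fun J => v.coframe η J x w * v.coframe η J x w)
      (fun J _ => mul_self_nonneg _) (Finset.mem_univ I)
  simp only [FRSVars.sign, h1, neg_one_mul, one_mul] at hw
  change -_ + ∑ J, v.coframe η J x w * v.coframe η J x w ≤ 0 at hw
  exact abs_le_of_sq_le_sq' (by rw [sq, sq]; linarith) (mul_pos (h.lapse_pos x) hw').le |> abs_le.2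

/-- On a compact range of times, a smooth function on `S` varies along a causal curve no faster
than a multiple of the time. -/
theorem exists_add_mul_time_lt [CompactSpace S] (h : IsFRSSolution E η V d t₀ v) {a b : ℝ}
    (hab : Set.Icc a b ⊆ 𝒥) {f : S → ℝ} (hf : ContMDiff (𝓡 n) 𝓘(ℝ, ℝ) ∞ f) {c : ℝ → 𝒥 × S}
    (hc : IsFutureCausalCurve (stModel n) (v.metric η) partialT c) :
    ∃ C : ℝ, ∀ r s, r < s → (∀ z ∈ Set.Ioo r s, ((c z).1 : ℝ) ∈ Set.Icc a b) →
      f (c r).2 + C * (c r).1 < f (c s).2 + C * (c s).1 := by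
  obtain ⟨B, hB, hcB⟩ := hc.causal
  have hf2 : ContMDiff (stModel n) 𝓘(ℝ, ℝ) ∞ (fun x : 𝒥 × S => f x.2) := hf.comp contMDiff_snd
  let A : 𝒥 × S → ℝ := fun x => ∑ I, v.N x * |v.dI E I (fun x : 𝒥 × S => f x.2) x|
  have hA : Continuous A := continuous_finsetSum _ fun I _ =>
    h.smooth.N.continuous.mul (h.smooth_dI hf2 I).continuous.abs
  obtain ⟨C, hC⟩ := (isCompact_timeRange (S := S) hab).exists_bound_of_continuousOn hA.continuousOn
  refine ⟨C + 1, fun r s hrs hz => ?_⟩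
  have hcont : Continuous fun z => f (c z).2 + (C + 1) * ((c z).1 : ℝ) := by
    have h1 := hf2.continuous.comp hc.continuous
    have h2 := (contMDiff_time (S := S) (n := n) (𝒥 := 𝒥)).continuous.comp hc.continuous
    exact h1.add (continuous_const.mul h2)
  refine lt_of_deriv_pos_off_locallyFinite hcont hB hrs
    (f' := fun z => mvfderiv (stModel n) (fun x : 𝒥 × S => f x.2) (c z)
        (mfderiv 𝓘(ℝ, ℝ) (stModel n) c z (1 : ℝ))
      + (C + 1) * dt (c z) (mfderiv 𝓘(ℝ, ℝ) (stModel n) c z (1 : ℝ))) fun z hzm hzB => ?_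
  obtain ⟨hd, hg, hT⟩ := hcB z hzB
  set w : TangentSpace (stModel n) (c z) := mfderiv 𝓘(ℝ, ℝ) (stModel n) c z (1 : ℝ) with hw
  have hdt := h.dt_pos_of_causal hT
  refine ⟨?_, ?_⟩
  · have h1 := hasDerivAt_comp_curve (mdiff hf2 (c z)) hd
    have h2 := hasDerivAt_comp_curve (mdiff contMDiff_time (c z)) hd
    rw [mvfderiv_time] at h2
    exact h1.add (h2.const_mul (C + 1))
  · have hbound : |mvfderiv (stModel n) (fun x : 𝒥 × S => f x.2) (c z) w| ≤
        A (c z) * dt (c z) w := by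
      have he : mvfderiv (stModel n) (fun x : 𝒥 × S => f x.2) (c z) w =
          ∑ I, v.coframe η I (c z) w * v.dI E I (fun x : 𝒥 × S => f x.2) (c z) := by
        have h2 : ∀ I, v.dI E I (fun x : 𝒥 × S => f x.2) (c z) =
            mvfderiv (𝓡 n) f (c z).2 (v.sliceFrame E (c z).1 I (c z).2) := by
          intro I
          rw [FRSVars.dI, fieldDeriv, mvfderiv_comp_snd ((hf _).mdifferentiableAt (by simp))]
          rfl
        simp only [h2]
        rw [mvfderiv_comp_snd ((hf _).mdifferentiableAt (by simp)),
          ← (h.isSmoothFrame_slice (c z).1).expand (c z).2 (spaceProj (c z) w), map_sum]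
        simp only [map_smul, smul_eq_mul]
        rfl
      rw [he, Finset.sum_mul]
      refine (Finset.abs_sum_le_sum_abs _ _).trans (Finset.sum_le_sum fun I _ => ?_)
      rw [abs_mul]
      calc _ ≤ v.N (c z) * dt (c z) w * |v.dI E I (fun x : 𝒥 × S => f x.2) (c z)| :=
            mul_le_mul_of_nonneg_right (h.abs_coframe_le_of_causal hg hdt I) (abs_nonneg _)
        _ = _ := by ring
    have hCz : A (c z) ≤ C := (le_abs_self _).trans (hC (c z) (hz z hzm))
    have h1 := neg_le_of_abs_le hbound
    nlinarith

theorem time_strictMono (h : IsFRSSolution E η V d t₀ v) {c : ℝ → 𝒥 × S}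
    (hc : IsFutureCausalCurve (stModel n) (v.metric η) partialT c) :
    StrictMono fun s => ((c s).1 : ℝ) := by
  obtain ⟨B, hB, hcB⟩ := hc.causal
  intro r s hrs
  have hcont : Continuous fun s => ((c s).1 : ℝ) :=
    (contMDiff_time (S := S) (n := n) (𝒥 := 𝒥)).continuous.comp hc.continuous
  refine lt_of_deriv_pos_off_locallyFinite hcont hB hrs
    (f' := fun z => dt (c z) (mfderiv 𝓘(ℝ, ℝ) (stModel n) c z (1 : ℝ))) fun z _ hzB => ?_
  obtain ⟨hd, hg, hT⟩ := hcB z hzB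
  have h2 := hasDerivAt_comp_curve (mdiff contMDiff_time (c z)) hd
  rw [mvfderiv_time] at h2
  exact ⟨h2, h.dt_pos_of_causal hT⟩

theorem exists_tendsto_curve [T2Space S] [CompactSpace S] {l : Filter ℝ} [l.NeBot] {c : ℝ → 𝒥 × S}
    {t : ℝ} (ht : t ∈ 𝒥) (htime : Tendsto (fun s => ((c s).1 : ℝ)) l (𝓝 t))
    (hf : ∀ f : S → ℝ, ContMDiff (𝓡 n) 𝓘(ℝ, ℝ) ∞ f →
      ∃ C L : ℝ, Tendsto (fun s => f (c s).2 + C * ((c s).1 : ℝ)) l (𝓝 L)) :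
    ∃ q, Tendsto c l (𝓝 q) := by
  obtain ⟨q, hq⟩ := exists_tendsto_of_smooth (n := n) (p := fun s => (c s).2) (l := l)
    fun f hfs => by
      obtain ⟨C, L, hL⟩ := hf f hfs
      refine ⟨L - C * t, (hL.sub (htime.const_mul C)).congr fun s => ?_⟩
      simp
  have h1 : Tendsto (fun s => (c s).1) l (𝓝 (⟨t, ht⟩ : 𝒥)) := tendsto_subtype_rng.2 htime
  exact ⟨(⟨t, ht⟩, q), h1.prodMk_nhds hq⟩

theorem exists_le_time [T2Space S] [CompactSpace S] (h : IsFRSSolution E η V d t₀ v)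
    {c : ℝ → 𝒥 × S} (hc : IsFutureCausalCurve (stModel n) (v.metric η) partialT c)
    (hc' : ∀ q, ¬Tendsto c atTop (𝓝 q)) (t : 𝒥) : ∃ s, (t : ℝ) ≤ (c s).1 := by
  by_contra! hlt
  have hm := h.time_strictMono hc
  have hab : Set.Icc ((c 0).1 : ℝ) t ⊆ 𝒥 := h.ordConnected.out (c 0).1.2 t.2
  have hbdd : BddAbove (Set.range fun s => ((c s).1 : ℝ)) :=
    ⟨t, by rintro _ ⟨s, rfl⟩; exact (hlt s).le⟩
  have hrange : ∀ s, 0 ≤ s → ((c s).1 : ℝ) ∈ Set.Icc ((c 0).1 : ℝ) t :=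
    fun s hs => ⟨hm.monotone hs, (hlt s).le⟩
  obtain ⟨q, hq⟩ := exists_tendsto_curve (n := n) (l := atTop) (c := c)
    (hab ⟨le_ciSup hbdd 0, ciSup_le fun s => (hlt s).le⟩)
    (tendsto_atTop_ciSup hm.monotone hbdd) fun f hf => by
      obtain ⟨C, hC⟩ := h.exists_add_mul_time_lt hab hf hc
      obtain ⟨K, hK⟩ := (isCompact_timeRange (S := S) hab).exists_bound_of_continuousOn
        (f := fun x : 𝒥 × S => f x.2 + C * (x.1 : ℝ))
        ((hf.continuous.comp continuous_snd).add
          (continuous_const.mul (continuous_subtype_val.comp continuous_fst))).continuousOn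
      refine ⟨C, tendsto_atTop_of_monotoneOn (C := K) (StrictMonoOn.monotoneOn
        fun r hr s _ hrs => hC r s hrs fun z hz => hrange z (le_trans hr hz.1.le))
        fun s hs => (le_abs_self _).trans (hK _ (hrange s hs))⟩
  exact hc' q hq

theorem exists_time_le [T2Space S] [CompactSpace S] (h : IsFRSSolution E η V d t₀ v)
    {c : ℝ → 𝒥 × S} (hc : IsFutureCausalCurve (stModel n) (v.metric η) partialT c)
    (hc' : ∀ q, ¬Tendsto c atBot (𝓝 q)) (t : 𝒥) : ∃ s, ((c s).1 : ℝ) ≤ t := by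
  by_contra! hlt
  have hm := h.time_strictMono hc
  have hab : Set.Icc (t : ℝ) (c 0).1 ⊆ 𝒥 := h.ordConnected.out t.2 (c 0).1.2
  have hbdd : BddBelow (Set.range fun s => ((c s).1 : ℝ)) :=
    ⟨t, by rintro _ ⟨s, rfl⟩; exact (hlt s).le⟩
  have hrange : ∀ s, s ≤ 0 → ((c s).1 : ℝ) ∈ Set.Icc (t : ℝ) (c 0).1 :=
    fun s hs => ⟨(hlt s).le, hm.monotone hs⟩
  obtain ⟨q, hq⟩ := exists_tendsto_curve (n := n) (l := atBot) (c := c)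
    (hab ⟨le_ciInf fun s => (hlt s).le, ciInf_le hbdd 0⟩)
    (tendsto_atBot_ciInf hm.monotone hbdd) fun f hf => by
      obtain ⟨C, hC⟩ := h.exists_add_mul_time_lt hab hf hc
      obtain ⟨K, hK⟩ := (isCompact_timeRange (S := S) hab).exists_bound_of_continuousOn
        (f := fun x : 𝒥 × S => f x.2 + C * (x.1 : ℝ))
        ((hf.continuous.comp continuous_snd).add
          (continuous_const.mul (continuous_subtype_val.comp continuous_fst))).continuousOn
      refine ⟨C, tendsto_atBot_of_monotoneOn (C := -K) (StrictMonoOn.monotoneOn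
        fun r _ s hs hrs => hC r s hrs fun z hz => hrange z (le_trans hz.2.le hs))
        fun s hs => neg_le_of_abs_le (hK _ (hrange s hs))⟩
  exact hc' q hq

theorem isCauchy_slice [T2Space S] [CompactSpace S] (h : IsFRSSolution E η V d t₀ v) (t : 𝒥) :
    IsCauchy (stModel n) (v.metric η) partialT (slice S t) := by
  intro c hc hc'
  have hcont : Continuous fun s => ((c s).1 : ℝ) :=
    continuous_subtype_val.comp (continuous_fst.comp hc.continuous)
  obtain ⟨s₁, h₁⟩ := h.exists_time_le hc hc'.2 t
  obtain ⟨s₂, h₂⟩ := h.exists_le_time hc hc'.1 t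
  obtain ⟨s, hs⟩ := mem_range_of_exists_le_of_exists_ge hcont ⟨s₁, h₁⟩ ⟨s₂, h₂⟩
  refine ⟨s, Subtype.ext hs, fun r hr => (h.time_strictMono hc).injective ?_⟩
  exact (congrArg Subtype.val (hr : (c r).1 = t)).trans hs.symm

end IsFRSSolution

end CausalCurves

end

theorem proposition2p1 {n : ℕ} (hn : 2 ≤ n)
    -- a closed Riemannian `n`-manifold with a global orthonormal frame and its dual frame
    {S : Type*} [TopologicalSpace S] [T2Space S] [CompactSpace S]
    [ChartedSpace (EuclideanSpace ℝ (Fin n)) S] [IsManifold (𝓡 n) ∞ S]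
    (href : ContMDiffRiemannianMetric (𝓡 n) ∞ (EuclideanSpace ℝ (Fin n))
      (TangentSpace (𝓡 n) : S → Type _))
    (E : Fin n → Π p : S, TangentSpace (𝓡 n) p)
    (hE : IsLocalFrameOn (𝓡 n) (EuclideanSpace ℝ (Fin n)) ∞ E Set.univ)
    (hEon : ∀ p i j, href.inner p (E i p) (E j p) = if i = j then 1 else 0)
    (η : Fin n → Π p : S, TangentSpace (𝓡 n) p →L[ℝ] ℝ) (hη : IsDualCoframe (𝓡 n) η E)
    (V : ℝ → ℝ) (hV : ContDiff ℝ ∞ V)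
    -- an open interval of positive times, containing the initial time
    (𝒥 : Opens ℝ) (h𝒥 : (𝒥 : Set ℝ).OrdConnected) (h𝒥pos : ∀ t ∈ 𝒥, (0 : ℝ) < t) (t₀ : 𝒥)
    (d : FRSInit n S) (hd : d.Smooth) (hd' : d.Admissible E η t₀)
    (v : FRSVars n 𝒥 S) (hv : v.Smooth) (hN : ∀ x, 0 < v.N x)
    (hsol : v.Solves E V) (hinit : v.HasInit d t₀) :
    -- `g` is a Lorentz metric, and the slices are spacelike Cauchy hypersurfaces
    IsLorentzMetric (stModel n) (v.metric η) ∧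
    (∀ (x : 𝒥 × S) (u : TangentSpace (𝓡 n) x.2), u ≠ 0 → 0 < firstForm (v.metric η) x u u) ∧
    (∀ t : 𝒥, IsCauchy (stModel n) (v.metric η) partialT (slice S t)) ∧
    -- `e_I` is a smooth frame on each slice, `ω^I` is its dual frame
    (∀ t : 𝒥, IsLocalFrameOn (𝓡 n) (EuclideanSpace ℝ (Fin n)) ∞
      (v.sliceFrame E t) Set.univ) ∧
    (∀ t : 𝒥, IsDualCoframe (𝓡 n) (v.sliceCoframe η t)
      (v.sliceFrame E t)) ∧
    -- `γ_IJK = ω^K([e_I, e_J])`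
    (∀ I J K (x : 𝒥 × S), v.γ I J K x =
      v.coframe η K x (VectorField.mlieBracket (stModel n) (v.frame E I) (v.frame E J) x)) ∧
    IsFutureUnitNormal (v.metric η) v.e0 ∧
    ∃ D : CovariantDerivative (stModel n) (ℝ × EuclideanSpace ℝ (Fin n))
        (TangentSpace (stModel n) : 𝒥 × S → Type _),
      IsLeviCivita (stModel n) (v.metric η) D ∧
      -- the Einstein equations and the scalar field equation
      (∀ Y Z : Π x : 𝒥 × S, TangentSpace (stModel n) x,
        IsSmoothField (stModel n) Y → IsSmoothField (stModel n) Z → ∀ x,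
        ricci (stModel n) D Y Z x =
          fieldDeriv (stModel n) Y v.φ x * fieldDeriv (stModel n) Z v.φ x
            + 2 / ((n : ℝ) - 1) * V (v.φ x) * v.metric η x (Y x) (Z x)) ∧
      (∀ x, waveOp (stModel n) (v.metric η) D v.φ x = deriv V (v.φ x)) ∧
      -- `k` is the second fundamental form, and the mean curvature of `{t} × S` is `1 / t`
      (∀ (x : 𝒥 × S) (u w : TangentSpace (𝓡 n) x.2),
        secondForm (v.metric η) D v.e0 x u w =
          ∑ I, ∑ J, v.k I J x * v.sliceCoframe η x.1 I x.2 u * v.sliceCoframe η x.1 J x.2 w) ∧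
      (∀ x : 𝒥 × S, meanCurvature (v.metric η) D v.e0 x = 1 / (x.1 : ℝ)) ∧
      -- the frame is Fermi-Walker propagated
      (∀ I (x : 𝒥 × S), covD (stModel n) D v.e0 (v.frame E I) x =
        fieldDeriv (stModel n) (v.frame E I) (fun y => Real.log (v.N y)) x • v.e0 x) ∧
      -- the initial data induced at `t₀`
      (∀ (p : S) (u w : TangentSpace (𝓡 n) p),
        firstForm (v.metric η) ((t₀, p) : 𝒥 × S) u w =
            ∑ I, d.coframe η I p u * d.coframe η I p w ∧
        secondForm (v.metric η) D v.e0 ((t₀, p) : 𝒥 × S) u w =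
            ∑ I, ∑ J, d.k I J p * d.coframe η I p u * d.coframe η J p w ∧
        v.φ (t₀, p) = d.φ₀ p ∧
        fieldDeriv (stModel n) v.e0 v.φ (t₀, p) = d.φ₁ p) := by
  have h : IsFRSSolution E η V d t₀ v :=
    ⟨hn, isSmoothFrame_of_isLocalFrameOn hE hη, h𝒥, h𝒥pos, hv, hN, hsol, hd', hinit⟩
  refine ⟨h.isLorentzMetric, h.firstForm_pos, h.isCauchy_slice,
    fun t => (h.isSmoothFrame_slice t).isLocalFrameOn, fun t => (h.isSmoothFrame_slice t).dual,
    h.γ_eq_structFun, h.isFutureUnitNormal, h.isSmoothFrame.connection (v.coeff E), h.isLeviCivita,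
    fun Y Z hY hZ x => h.ricci_connection hY hZ x, h.waveOp_connection, h.secondForm_eq,
    h.meanCurvature_eq, h.covD_e0_frame, fun p u w => ⟨?_, ?_, h.init.φ p, h.init.e0φ p⟩⟩
  · rw [IsFRSSolution.firstForm_eq]
    simp only [h.sliceCoframe_init]
  · rw [h.secondForm_eq]
    simp only [h.sliceCoframe_init, h.init.k]
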